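/- **Lemma 2.2.** Let $n\ge 4$, let $B$ be the open unit ball of $\mathbb R^n$ centered at the origin, $e_n=(0,\dots,0,1)$, $p=\frac{n+2}{n-2}$, $\alpha_n=[n(n-2)]^{\frac{n-2}{4}}$, and for $\delta>0$, $\xi\in\mathbb R^n$ let $$U_{\delta,\xi}(x)=\alpha_n\frac{\delta^{\frac{n-2}{2}}}{(\delta^2+|x-\xi|^2)^{\frac{n-2}{2}}},\qquad W_\delta=U_{\delta,e_n}-U_{\delta,-e_n}.$$ Let $PW_\delta$ be the solution of $$-\Delta PW_\delta=U_{\delta,e_n}^p-U_{\delta,-e_n}^p\ \text{ in }B,\qquad \partial_\nu PW_\delta=0\ \text{ on }\partial B,\qquad \int_B PW_\delta=0,$$ and let $\varphi_0$ be the solution of $$-\Delta\varphi_0=0\ \text{ in }\mathbb R^n_+=\{x_n>0\},\qquad \frac{\partial\varphi_0}{\partial x_n}=\alpha_n\frac{n-2}{2}\frac{|x'|^2}{(1+|x'|^2)^{n/2}}\ \text{ on }\partial\mathbb R^n_+,\qquad \varphi_0(x)\to0\ \text{ as }|x|\to\infty,$$ where $x'=(x_1,\dots,x_{n-1})$. Then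 for $\delta>0$ and $x\in B$ $$PW_\delta(x)=W_\delta(x)-\delta^{-\frac{n-4}{2}}\Big(\varphi_0\Big(\frac{e_n-x}{\delta}\Big)-\varphi_0\Big(\frac{e_n+x}{\delta}\Big)\Big)+\zeta_\delta(x),$$ where $\zeta_\delta(x)$ and $PW_\delta(x)-W_\delta(x)$ are differentiable in $\delta$ and, uniformly in $x\in B$ as $\delta\to0^+$, $$\zeta_\delta=O(\delta^{\frac{6-n}{2}}),\quad \partial_\delta\zeta_\delta=O(\delta^{\frac{4-n}{2}})\qquad\text{if }n\ge5,$$ $$\zeta_\delta=O(\delta|\log\delta|),\quad \partial_\delta\zeta_\delta=O(|\log\delta|)\qquad\text{if }n=4.$$ Moreover, there is $C>0$ such that for all $\delta>0$ and $x\in B$ $$|\zeta_\delta(x)|,\ |PW_\delta(x)-W_\delta(x)|\le \frac{C\delta^{\frac{n-2}{2}}}{(\delta+|x-e_n|)^{n-3}}+\frac{C\delta^{\frac{n-2}{2}}}{(\delta+|x+e_n|)^{n-3}}=\frac{C\delta^{\frac{4-n}{2}}}{(1+|\frac{x-e_n}{\delta}|)^{n-3}}+\frac{C\delta^{\frac{4-n}{2}}}{(1+|\frac{x+e_n}{\delta}|)^{n-3}},$$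 $$|\partial_\delta\zeta_\delta(x)|,\ |\partial_\delta(PW_\delta(x)-W_\delta(x))|\le \frac{C\delta^{\frac{n-4}{2}}}{(\delta+|x-e_n|)^{n-3}}+\frac{C\delta^{\frac{n-4}{2}}}{(\delta+|x+e_n|)^{n-3}}=\frac{C\delta^{\frac{2-n}{2}}}{(1+|\frac{x-e_n}{\delta}|)^{n-3}}+\frac{C\delta^{\frac{2-n}{2}}}{(1+|\frac{x+e_n}{\delta}|)^{n-3}}.$$ -/

import Mathlib

open Set Filter Topology MeasureTheory

noncomputable section

namespace NeumannBubble

/-- The constant `α_n = [n(n-2)]^((n-2)/4)`. -/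
def alpha (n : ℕ) : ℝ := ((n : ℝ) * ((n : ℝ) - 2)) ^ (((n : ℝ) - 2) / 4)

/-- The last vector `e_n = (0, …, 0, 1)` of the standard basis of `ℝⁿ`. -/
def eN (n : ℕ) : EuclideanSpace ℝ (Fin n) :=
  WithLp.toLp 2 (fun i => if (i : ℕ) + 1 = n then 1 else 0)

/-- The last coordinate `x_n` of `x ∈ ℝⁿ`. -/
def lastCoord (n : ℕ) (x : EuclideanSpace ℝ (Fin n)) : ℝ := inner ℝ (eN n) x

/-- The bubble `U_{δ,ξ}(x) = α_n δ^((n-2)/2) / (δ² + |x-ξ|²)^((n-2)/2)`. -/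
def bubble (n : ℕ) (δ : ℝ) (ξ x : EuclideanSpace ℝ (Fin n)) : ℝ :=
  alpha n * (δ ^ (((n : ℝ) - 2) / 2) / (δ ^ 2 + ‖x - ξ‖ ^ 2) ^ (((n : ℝ) - 2) / 2))

/-- `W_δ = U_{δ,e_n} - U_{δ,-e_n}`. -/
def W (n : ℕ) (δ : ℝ) (x : EuclideanSpace ℝ (Fin n)) : ℝ :=
  bubble n δ (eN n) x - bubble n δ (-eN n) x

/-- `u` is the (classical) solution of the Neumann problem in the open unit ball `B`:
`-Δu = h` in `B`, `∂_ν u = 0` on `∂B`, `∫_B u = 0`.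
On `∂B` the outward unit normal at `x` is `x` itself, so `∂_ν u(x)` is the derivative of
`t ↦ u(tx)` at `t = 1`, taken from within the ball. The values of `u` outside the closed ball
play no role. -/
structure IsNeumannSolution (n : ℕ) (h u : EuclideanSpace ℝ (Fin n) → ℝ) : Prop where
  contDiffOn : ContDiffOn ℝ 2 u (Metric.ball 0 1)
  continuousOn : ContinuousOn u (Metric.closedBall 0 1)
  equation : ∀ x ∈ Metric.ball (0 : EuclideanSpace ℝ (Fin n)) 1,
    -(Laplacian.laplacian u x) = h x
  neumann : ∀ x ∈ Metric.sphere (0 : EuclideanSpace ℝ (Fin n)) 1,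
    HasDerivWithinAt (fun t : ℝ => u (t • x)) 0 (Iic 1) 1
  mean_zero : ∫ x in Metric.ball (0 : EuclideanSpace ℝ (Fin n)) 1, u x = 0

/-- `u = PW_δ`, the solution of `-Δu = U_{δ,e_n}^p - U_{δ,-e_n}^p` in `B`, `∂_ν u = 0` on `∂B`,
`∫_B u = 0`, where `p = (n+2)/(n-2)`. -/
def IsPW (n : ℕ) (δ : ℝ) (u : EuclideanSpace ℝ (Fin n) → ℝ) : Prop :=
  IsNeumannSolution n
    (fun x => bubble n δ (eN n) x ^ (((n : ℝ) + 2) / ((n : ℝ) - 2))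
      - bubble n δ (-eN n) x ^ (((n : ℝ) + 2) / ((n : ℝ) - 2))) u

/-- `φ` is the half-space corrector: it is harmonic in `{x_n > 0}`, continuous up to the boundary,
satisfies `∂φ/∂x_n = α_n (n-2)/2 · |x'|² / (1+|x'|²)^(n/2)` on `{x_n = 0}`
(where `|x'| = |x|`, and the derivative is taken from inside), and tends to `0` at infinity.
The values of `φ` on `{x_n < 0}` play no role. -/
structure IsCorrector (n : ℕ) (φ : EuclideanSpace ℝ (Fin n) → ℝ) : Prop where
  harmonic : InnerProductSpace.HarmonicOnNhd φ {x | 0 < lastCoord n x}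
  continuousOn : ContinuousOn φ {x | 0 ≤ lastCoord n x}
  neumann : ∀ x, lastCoord n x = 0 →
    HasDerivWithinAt (fun t : ℝ => φ (x + t • eN n))
      (alpha n * (((n : ℝ) - 2) / 2) * (‖x‖ ^ 2 / (1 + ‖x‖ ^ 2) ^ ((n : ℝ) / 2))) (Ici 0) 0
  tendsto_zero :
    Tendsto φ (Bornology.cobounded (EuclideanSpace ℝ (Fin n)) ⊓ 𝓟 {x | 0 ≤ lastCoord n x}) (𝓝 0)

end NeumannBubble

end

/-! Both corrections have closed forms, so every estimate compares two explicit functions. Write `n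
= k + 4`, `e = e_n`, `Γ(x, y) = |x - y|^{-(k+2)}`, and let `τ > 0` solve `τ - 1/τ = δ`, `ρ = τ²`.

In the ball: on the unit sphere `δ² + |x - e|² = |x - ρe|²/ρ`, so there the bubble looks like a
fundamental solution with image pole `ρe` outside the ball. The potential `I_ρ(x) = ∫_ρ^∞ (s^{k+1}
Γ(x, se) - 1/s) ds` is harmonic in the ball and satisfies `I_ρ(lx) = I_{ρ/l}(x)`; hence its radial
derivative comes from the endpoint alone and equals `ρ^{k+2} Γ(x, ρe) - 1`. With suitable `a`, `b`,
adding `(k+2)(a I_ρ - b Γ(·, ρe))` to the bubble makes the normal derivative constant on the sphere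
(`hasDerivAt_projected_radial`). The constant cancels against the antipodal bubble, and uniqueness
together with oddness gives `PW - W` exactly (`IsPW.sub_W_eq`).

In the half-space, translation plays the part of dilation: `φ₀` is a combination of `Γ(y, -e)` and
`∫_1^∞ Γ(y, -se) ds` (`IsCorrector.eq_halfSpaceSolution`). Rescaled at `e` it becomes, up to a
factor, `½ ∫_{1+δ}^∞ Γ(x, se) ds - δ/(2(k+2)) Γ(x, (1+δ)e)`: the ball formula with `a`, `b`, `ρ` and
the density replaced by `½`, `δ/(2(k+2))`, `1 + δ` and `1`.

As `δ → 0` these data differ by `O(δ)`, `O(δ²)`, `O(δ²)` and, near `s = 1`, `O(s - 1)`. Each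
replacement costs `O(δ^{-k})` before the prefactor `δ^{(k+2)/2}`, except that the change of density
costs `∫_{1+δ} (s-1)^{-(k+1)} ds`, which is logarithmic when `k = 0` (`paramBound_remainder`). The
decay bounds hold because `|x - se|` dominates a multiple of `s - 1 + |x - e|` on the ball.
Derivatives in `δ` are carried along by bounding `f` and `δ ∂_δ f` together (`ParamBound`), a
condition stable under sums and products. -/

namespace NeumannBubble

/-! ### A Laplacian along coordinate lines -/

/-- The function `u` is twice differentiable at `x` along the coordinate lines, and its second
derivatives along them add up to `L`. -/
def HasLineLaplacian {n : ℕ} (u : EuclideanSpace ℝ (Fin n) → ℝ) (x : EuclideanSpace ℝ (Fin n))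
    (L : ℝ) : Prop :=
  ∃ (g : Fin n → ℝ → ℝ) (d : Fin n → ℝ),
    (∀ i, ∀ᶠ t in 𝓝 (0 : ℝ),
      HasDerivAt (fun t : ℝ => u (x + t • EuclideanSpace.single i (1 : ℝ))) (g i t) t) ∧
    (∀ i, HasDerivAt (g i) (d i) 0) ∧ ∑ i, d i = L

namespace HasLineLaplacian

variable {n : ℕ} {u w : EuclideanSpace ℝ (Fin n) → ℝ} {x : EuclideanSpace ℝ (Fin n)} {L M : ℝ}

theorem add (hu : HasLineLaplacian u x L) (hw : HasLineLaplacian w x M) :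
    HasLineLaplacian (fun z => u z + w z) x (L + M) := by
  obtain ⟨g, d, h1, h2, rfl⟩ := hu
  obtain ⟨g', d', h1', h2', rfl⟩ := hw
  refine ⟨fun i t => g i t + g' i t, fun i => d i + d' i, fun i => ?_,
    fun i => (h2 i).add (h2' i), Finset.sum_add_distrib⟩
  filter_upwards [h1 i, h1' i] with t ht ht'
  exact ht.add ht'

theorem const_mul (c : ℝ) (hu : HasLineLaplacian u x L) :
    HasLineLaplacian (fun z => c * u z) x (c * L) := by
  obtain ⟨g, d, h1, h2, rfl⟩ := hu
  refine ⟨fun i t => c * g i t, fun i => c * d i, fun i => ?_,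
    fun i => (h2 i).const_mul c, (Finset.mul_sum _ _ _).symm⟩
  filter_upwards [h1 i] with t ht
  exact ht.const_mul c

theorem sub (hu : HasLineLaplacian u x L) (hw : HasLineLaplacian w x M) :
    HasLineLaplacian (fun z => u z - w z) x (L - M) := by
  have := hu.add (hw.const_mul (-1))
  simpa [sub_eq_add_neg] using this

theorem of_contDiffAt (hu : ContDiffAt ℝ 2 u x) :
    HasLineLaplacian u x (Laplacian.laplacian u x) := by
  have hev : ∀ᶠ y in 𝓝 x, DifferentiableAt ℝ u y := by
    filter_upwards [hu.eventually (by simp)] with y hy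
    exact hy.differentiableAt (by norm_num)
  have hf' : DifferentiableAt ℝ (fderiv ℝ u) x :=
    (hu.fderiv_right (m := 1) (by norm_num)).differentiableAt (by norm_num)
  have hline : ∀ (i : Fin n) (t : ℝ), HasDerivAt
      (fun t : ℝ => x + t • EuclideanSpace.single i (1 : ℝ)) (EuclideanSpace.single i (1 : ℝ)) t :=
    fun i t => by
      simpa using ((hasDerivAt_id t).smul_const (EuclideanSpace.single i (1 : ℝ))).const_add x
  refine ⟨fun i t => fderiv ℝ u (x + t • EuclideanSpace.single i (1 : ℝ))
      (EuclideanSpace.single i (1 : ℝ)),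
    fun i => fderiv ℝ (fderiv ℝ u) x (EuclideanSpace.single i (1 : ℝ))
      (EuclideanSpace.single i (1 : ℝ)), fun i => ?_, fun i => ?_, ?_⟩
  · have hc : Tendsto (fun t : ℝ => x + t • EuclideanSpace.single i (1 : ℝ)) (𝓝 0) (𝓝 x) := by
      have := (hline i 0).continuousAt.tendsto
      simpa using this
    filter_upwards [hc.eventually hev] with t ht
    exact ht.hasFDerivAt.comp_hasDerivAt t (hline i t)
  · have h0 : HasFDerivAt (fderiv ℝ u) (fderiv ℝ (fderiv ℝ u) x)
        (x + (0 : ℝ) • EuclideanSpace.single i (1 : ℝ)) := by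
      simpa using hf'.hasFDerivAt
    have h1 := h0.comp_hasDerivAt (0 : ℝ) (hline i 0)
    have h2 := HasDerivAt.clm_apply h1 (hasDerivAt_const (0 : ℝ) (EuclideanSpace.single i (1 : ℝ)))
    simpa using h2
  · rw [InnerProductSpace.laplacian_eq_iteratedFDeriv_orthonormalBasis u
      (EuclideanSpace.basisFun (Fin n) ℝ)]
    simp [iteratedFDeriv_two_apply]

/-- Some pure second derivative is positive. At a critical point this forces a local minimum along
that line; combined with a local maximum the restriction is locally constant, contradicting the
positive second derivative. Only derivatives along lines enter, so no `C²` regularity is needed for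
the maximum principle. -/
theorem not_isLocalMax (hu : HasLineLaplacian u x L) (hL : 0 < L) : ¬ IsLocalMax u x := by
  intro hm
  obtain ⟨g, d, h1, h2, rfl⟩ := hu
  obtain ⟨i, -, hi⟩ := Finset.exists_lt_of_sum_lt (s := Finset.univ) (f := fun _ => (0 : ℝ))
    (g := d) (by simpa using hL)
  set f : ℝ → ℝ := fun t => u (x + t • EuclideanSpace.single i (1 : ℝ)) with hf
  have hc : Tendsto (fun t : ℝ => x + t • EuclideanSpace.single i (1 : ℝ)) (𝓝 0) (𝓝 x) := by
    have : Continuous (fun t : ℝ => x + t • EuclideanSpace.single i (1 : ℝ)) := by fun_prop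
    simpa using this.tendsto 0
  have hmax : IsLocalMax f 0 := by
    have := hc.eventually hm
    filter_upwards [this] with t ht
    simpa [hf] using ht
  have hd1 : deriv f =ᶠ[𝓝 0] g i := (h1 i).mono fun t ht => ht.deriv
  have hd2 : deriv (deriv f) 0 = d i := by rw [hd1.deriv_eq, (h2 i).deriv]
  have hmin := isLocalMin_of_deriv_deriv_pos (by rw [hd2]; exact hi) hmax.deriv_eq_zero
    (h1 i).self_of_nhds.continuousAt
  have hconst : f =ᶠ[𝓝 0] fun _ => f 0 := by
    filter_upwards [hmax, hmin] with t h1 h2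
    exact le_antisymm h1 h2
  have : deriv (deriv f) 0 = 0 := by
    rw [hconst.deriv.deriv_eq]
    simp
  rw [hd2] at this
  exact hi.ne' this

theorem congr_val (hu : HasLineLaplacian u x L) (h : L = M) : HasLineLaplacian u x M := h ▸ hu

end HasLineLaplacian

theorem sum_coord_sq {n : ℕ} (z : EuclideanSpace ℝ (Fin n)) : ∑ i, z i ^ 2 = ‖z‖ ^ 2 := by
  simp [EuclideanSpace.norm_sq_eq]

theorem norm_sq_add_smul_single {n : ℕ} (z : EuclideanSpace ℝ (Fin n)) (i : Fin n) (t : ℝ) :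
    ‖z + t • EuclideanSpace.single i (1 : ℝ)‖ ^ 2 = ‖z‖ ^ 2 + 2 * t * z i + t ^ 2 := by
  rw [norm_add_sq_real, inner_smul_right, EuclideanSpace.inner_single_right, norm_smul]
  simp
  ring

theorem hasDerivAt_norm_sq_line {n : ℕ} (x y : EuclideanSpace ℝ (Fin n)) (i : Fin n) (t : ℝ) :
    HasDerivAt (fun t : ℝ => ‖x + t • EuclideanSpace.single i (1 : ℝ) - y‖ ^ 2)
      (2 * (x i - y i + t)) t := by
  have h : (fun t : ℝ => ‖x + t • EuclideanSpace.single i (1 : ℝ) - y‖ ^ 2) =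
      fun t => ‖x - y‖ ^ 2 + 2 * t * (x i - y i) + t ^ 2 := by
    ext t
    rw [add_sub_right_comm, norm_sq_add_smul_single]
    simp
  rw [h]
  have h1 := ((((hasDerivAt_id t).const_mul 2).mul_const (x i - y i)).const_add
    (‖x - y‖ ^ 2)).add (hasDerivAt_pow 2 t)
  refine h1.congr_deriv ?_
  simp
  ring

/-- First derivative of `(c + |x - y|²)^p` along a coordinate line. -/
theorem hasDerivAt_rpow_line {n : ℕ} (c p : ℝ) (x y : EuclideanSpace ℝ (Fin n)) (i : Fin n) (t : ℝ)
    (h : 0 < c + ‖x + t • EuclideanSpace.single i (1 : ℝ) - y‖ ^ 2) :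
    HasDerivAt (fun t : ℝ => (c + ‖x + t • EuclideanSpace.single i (1 : ℝ) - y‖ ^ 2) ^ p)
      (2 * p * (x i - y i + t) *
        (c + ‖x + t • EuclideanSpace.single i (1 : ℝ) - y‖ ^ 2) ^ (p - 1)) t := by
  have h1 := ((hasDerivAt_norm_sq_line x y i t).const_add c).rpow_const (p := p) (Or.inl h.ne')
  refine h1.congr_deriv ?_
  ring

/-- Second derivative of `(c + |x - y|²)^p` along a coordinate line. -/
theorem hasDerivAt_rpow_line_deriv {n : ℕ} (c p : ℝ) (x y : EuclideanSpace ℝ (Fin n)) (i : Fin n)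
    (t : ℝ) (h : 0 < c + ‖x + t • EuclideanSpace.single i (1 : ℝ) - y‖ ^ 2) :
    HasDerivAt (fun t : ℝ => 2 * p * (x i - y i + t) *
        (c + ‖x + t • EuclideanSpace.single i (1 : ℝ) - y‖ ^ 2) ^ (p - 1))
      (2 * p * (c + ‖x + t • EuclideanSpace.single i (1 : ℝ) - y‖ ^ 2) ^ (p - 1) +
        4 * p * (p - 1) * (x i - y i + t) ^ 2 *
        (c + ‖x + t • EuclideanSpace.single i (1 : ℝ) - y‖ ^ 2) ^ (p - 2)) t := by
  have h1 := (((hasDerivAt_id t).const_add (x i - y i)).const_mul (2 * p)).mul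
    (hasDerivAt_rpow_line c (p - 1) x y i t h)
  refine h1.congr_deriv ?_
  rw [show p - 1 - 1 = p - 2 by ring]
  simp
  ring

theorem hasLineLaplacian_rpow {n : ℕ} (c p : ℝ) (x y : EuclideanSpace ℝ (Fin n))
    (h : 0 < c + ‖x - y‖ ^ 2) :
    HasLineLaplacian (fun z => (c + ‖z - y‖ ^ 2) ^ p) x
      (2 * p * (c + ‖x - y‖ ^ 2) ^ (p - 2) * (2 * (p - 1) * ‖x - y‖ ^ 2 + n * (c + ‖x - y‖ ^ 2))) := by
  refine ⟨_, _, fun i => ?_, fun i => hasDerivAt_rpow_line_deriv c p x y i 0 (by simpa using h), ?_⟩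
  · have hc : Continuous
        (fun t : ℝ => c + ‖x + t • EuclideanSpace.single i (1 : ℝ) - y‖ ^ 2) := by fun_prop
    have h0 := hc.continuousAt.eventually (lt_mem_nhds (a := 0)
      (b := c + ‖x + (0 : ℝ) • EuclideanSpace.single i (1 : ℝ) - y‖ ^ 2) (by simpa using h))
    filter_upwards [h0] with t ht
    exact hasDerivAt_rpow_line c p x y i t ht
  · have hp : (c + ‖x - y‖ ^ 2) ^ (p - 1) = (c + ‖x - y‖ ^ 2) ^ (p - 2) * (c + ‖x - y‖ ^ 2) := by
      rw [← Real.rpow_add_one h.ne']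
      congr 1
      ring
    simp only [zero_smul, add_zero]
    rw [Finset.sum_add_distrib, Finset.sum_const, ← Finset.sum_mul, ← Finset.mul_sum]
    have : ∑ i, (x i - y i) ^ 2 = ‖x - y‖ ^ 2 := by rw [← sum_coord_sq]; simp
    rw [this, hp]
    simp
    ring

/-! ### Uniqueness for the Neumann problems in the ball and the half-space -/

/-- If `f` has a positive right derivative at `a`, then `a` is not a maximum to the right. -/
theorem exists_gt_of_hasDerivWithinAt_Ici {f : ℝ → ℝ} {f' a : ℝ}
    (h : HasDerivWithinAt f f' (Ici a) a) (hf' : 0 < f') : ∀ᶠ t in 𝓝[>] a, f a < f t := by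
  have h1 := (hasDerivWithinAt_iff_tendsto_slope.1 h)
  rw [show Ici a \ {a} = Ioi a by ext; simp] at h1
  filter_upwards [h1.eventually (lt_mem_nhds hf'), self_mem_nhdsWithin] with t ht hta
  rw [slope_def_field] at ht
  have : 0 < t - a := sub_pos.2 hta
  have := (div_pos_iff_of_pos_right this).1 ht
  linarith

theorem exists_gt_of_hasDerivWithinAt_Iic {f : ℝ → ℝ} {f' a : ℝ}
    (h : HasDerivWithinAt f f' (Iic a) a) (hf' : f' < 0) : ∀ᶠ t in 𝓝[<] a, f a < f t := by
  have h1 := (hasDerivWithinAt_iff_tendsto_slope.1 h)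
  rw [show Iic a \ {a} = Iio a by ext; simp] at h1
  filter_upwards [h1.eventually (gt_mem_nhds hf'), self_mem_nhdsWithin] with t ht hta
  rw [slope_def_field] at ht
  have h2 : t - a < 0 := sub_neg.2 hta
  by_contra hcon
  have : 0 ≤ (f t - f a) / (t - a) := div_nonneg_of_nonpos (by linarith [not_lt.1 hcon]) h2.le
  linarith

/-- A harmonic function in the unit ball with vanishing normal derivative is bounded from above by
its maximum on any smaller sphere. -/
theorem ball_neumann_le_of_le_sphere {n : ℕ} (hn : 1 ≤ n) {v : EuclideanSpace ℝ (Fin n) → ℝ}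
    (hc : ContinuousOn v (Metric.closedBall 0 1))
    (hl : ∀ x ∈ Metric.ball (0 : EuclideanSpace ℝ (Fin n)) 1, HasLineLaplacian v x 0)
    (hν : ∀ x ∈ Metric.sphere (0 : EuclideanSpace ℝ (Fin n)) 1,
      HasDerivWithinAt (fun t : ℝ => v (t • x)) 0 (Iic 1) 1)
    {r M : ℝ} (hr : 0 < r) (hM : ∀ y, ‖y‖ = r → v y ≤ M)
    {x : EuclideanSpace ℝ (Fin n)} (hx : r ≤ ‖x‖) (hx1 : ‖x‖ ≤ 1) : v x ≤ M := by
  have hn' : (0 : ℝ) < n := by exact_mod_cast hn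
  set b : EuclideanSpace ℝ (Fin n) → ℝ := fun z => (0 + ‖z - 0‖ ^ 2) ^ (-(n : ℝ)) with hb
  have hbnn : ∀ z, 0 ≤ b z := fun z => by positivity
  have hball : Metric.closedBall (0 : EuclideanSpace ℝ (Fin n)) 1 = {z | ‖z‖ ≤ 1} := by
    ext; simp
  -- The barrier `|z|^{-2n}` is strictly subharmonic and has negative radial derivative on the unit
  -- sphere. The perturbed function therefore has its maximum over the annulus neither in the
  -- interior nor on the outer sphere, which leaves the inner sphere.
  have key : ∀ η : ℝ, 0 < η → v x + η * b x ≤ M + η * (0 + r ^ 2) ^ (-(n : ℝ)) := by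
    intro η hη
    set K : Set (EuclideanSpace ℝ (Fin n)) := Metric.closedBall 0 1 ∩ {z | r ≤ ‖z‖} with hK
    have hKc : IsCompact K :=
      (isCompact_closedBall _ _).inter_right (isClosed_le continuous_const continuous_norm)
    have hxK : x ∈ K := by simp [hK, hx, hx1]
    have hbc : ContinuousOn b K := by
      refine ContinuousOn.rpow_const (by fun_prop) fun z hz => Or.inl ?_
      have : 0 < ‖z - 0‖ := by simpa using hr.trans_le hz.2
      positivity
    obtain ⟨y, hy, hmax⟩ := hKc.exists_isMaxOn ⟨x, hxK⟩
      ((hc.mono inter_subset_left).add (hbc.const_smul η))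
    have hmax' : ∀ z ∈ K, v z + η * b z ≤ v y + η * b y := fun z hz => hmax hz
    refine (hmax' x hxK).trans ?_
    have hy1 : ‖y‖ ≤ 1 := by simpa using hy.1
    have hyr : r ≤ ‖y‖ := hy.2
    rcases hyr.eq_or_lt with h | h
    · have : b y = (0 + r ^ 2) ^ (-(n : ℝ)) := by simp [hb, h]
      rw [this]
      gcongr
      exact hM y h.symm
    exfalso
    rcases hy1.eq_or_lt with h1 | h1
    · have hd : HasDerivWithinAt (fun t : ℝ => v (t • y) + η * b (t • y))
          (0 + η * (-(n : ℝ) * 2)) (Iic 1) 1 := by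
        refine (hν y (by simpa using h1)).add (HasDerivWithinAt.const_mul η ?_)
        have e : (fun t : ℝ => b (t • y)) = fun t : ℝ => (t ^ 2) ^ (-(n : ℝ)) := by
          ext t
          simp [hb, norm_smul, h1]
        rw [e]
        have := ((hasDerivAt_pow 2 (1 : ℝ)).rpow_const (p := -(n : ℝ)) (Or.inl (by norm_num)))
        refine this.hasDerivWithinAt.congr_deriv ?_
        simp
        ring
      have hev := exists_gt_of_hasDerivWithinAt_Iic hd (by nlinarith)
      have hr1 : ∀ᶠ t : ℝ in 𝓝[<] 1, max 0 r < t :=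
        nhdsWithin_le_nhds (lt_mem_nhds (by simp; linarith))
      obtain ⟨t, ht, htr, ht1⟩ := (hev.and (hr1.and self_mem_nhdsWithin)).exists
      have ht0 : 0 < t := (le_max_left _ _).trans_lt htr
      have ht1' : t < 1 := ht1
      have hn1 : ‖t • y‖ = t := by rw [norm_smul, h1, Real.norm_of_nonneg ht0.le, mul_one]
      have := hmax' (t • y) ⟨by simp [hn1, ht1'.le], by
        simp only [mem_ofPred_eq, hn1]; exact ((le_max_right _ _).trans_lt htr).le⟩
      simp only [one_smul] at ht
      linarith
    · have hy0 : 0 < 0 + ‖y - 0‖ ^ 2 := by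
        have : 0 < ‖y‖ := hr.trans h
        simp only [sub_zero]
        positivity
      have hL := (hl y (by simpa using h1)).add
        ((hasLineLaplacian_rpow 0 (-(n : ℝ)) y 0 hy0).const_mul η)
      refine hL.not_isLocalMax ?_ ?_
      · have h2 : 0 < (0 + ‖y - 0‖ ^ 2) ^ (-(n : ℝ) - 2) := Real.rpow_pos_of_pos hy0 _
        have h3 : (0 : ℝ) + η * (2 * -(n : ℝ) * (0 + ‖y - 0‖ ^ 2) ^ (-(n : ℝ) - 2) *
          (2 * (-(n : ℝ) - 1) * ‖y - 0‖ ^ 2 + n * (0 + ‖y - 0‖ ^ 2))) =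
          η * (2 * n * (0 + ‖y - 0‖ ^ 2) ^ (-(n : ℝ) - 2) *
            ((n + 2) * (0 + ‖y - 0‖ ^ 2))) := by ring
        rw [h3]
        positivity
      · have hU : K ∈ 𝓝 y := by
          have : Metric.ball (0 : EuclideanSpace ℝ (Fin n)) 1 ∩ {z | r < ‖z‖} ∈ 𝓝 y :=
            (Metric.isOpen_ball.inter (isOpen_lt continuous_const continuous_norm)).mem_nhds
              ⟨by simpa using h1, h⟩
          filter_upwards [this] with z hz
          have hrz : r < ‖z‖ := hz.2
          exact ⟨Metric.ball_subset_closedBall hz.1, hrz.le⟩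
        filter_upwards [hU] with z hz using hmax' z hz
  have key2 : ∀ η : ℝ, 0 < η → v x ≤ M + η * (0 + r ^ 2) ^ (-(n : ℝ)) := fun η hη => by
    have := key η hη
    have := mul_nonneg hη.le (hbnn x)
    linarith
  have hlim : Tendsto (fun η : ℝ => M + η * (0 + r ^ 2) ^ (-(n : ℝ))) (𝓝[>] 0) (𝓝 M) := by
    have : Continuous (fun η : ℝ => M + η * (0 + r ^ 2) ^ (-(n : ℝ))) := by fun_prop
    have := this.tendsto 0
    simp only [zero_mul, add_zero] at this
    exact this.mono_left nhdsWithin_le_nhds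
  exact ge_of_tendsto hlim (by filter_upwards [self_mem_nhdsWithin] with η hη using key2 η hη)

/-- Small spheres lie close to the origin, so by continuity the bound by the maximum on a sphere
becomes a bound by `v 0`. Applied to `v` and `-v` this already gives constancy, without a strong
maximum principle. -/
theorem ball_neumann_le {n : ℕ} (hn : 1 ≤ n) {v : EuclideanSpace ℝ (Fin n) → ℝ}
    (hc : ContinuousOn v (Metric.closedBall 0 1))
    (hl : ∀ x ∈ Metric.ball (0 : EuclideanSpace ℝ (Fin n)) 1, HasLineLaplacian v x 0)
    (hν : ∀ x ∈ Metric.sphere (0 : EuclideanSpace ℝ (Fin n)) 1,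
      HasDerivWithinAt (fun t : ℝ => v (t • x)) 0 (Iic 1) 1)
    {x : EuclideanSpace ℝ (Fin n)} (hx1 : ‖x‖ ≤ 1) : v x ≤ v 0 := by
  rcases eq_or_ne x 0 with rfl | hx0
  · rfl
  refine le_of_forall_pos_le_add fun ε hε => ?_
  have hc0 : ContinuousAt v 0 := hc.continuousAt (Metric.closedBall_mem_nhds _ one_pos)
  obtain ⟨ρ, hρ, h⟩ := Metric.continuousAt_iff.1 hc0 ε hε
  have hxn : 0 < ‖x‖ := norm_pos_iff.2 hx0
  refine ball_neumann_le_of_le_sphere hn hc hl hν (r := min (ρ / 2) ‖x‖) (by positivity)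
    (fun y hy => ?_) (min_le_right _ _) hx1
  have := h (x := y) (by
    rw [dist_zero_right, hy]
    exact (min_le_left _ _).trans_lt (by linarith))
  rw [Real.dist_eq, abs_lt] at this
  linarith

/-- A harmonic function in the unit ball with vanishing normal derivative is constant. -/
theorem ball_neumann_eq_const {n : ℕ} (hn : 1 ≤ n) {v : EuclideanSpace ℝ (Fin n) → ℝ}
    (hc : ContinuousOn v (Metric.closedBall 0 1))
    (hl : ∀ x ∈ Metric.ball (0 : EuclideanSpace ℝ (Fin n)) 1, HasLineLaplacian v x 0)
    (hν : ∀ x ∈ Metric.sphere (0 : EuclideanSpace ℝ (Fin n)) 1,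
      HasDerivWithinAt (fun t : ℝ => v (t • x)) 0 (Iic 1) 1)
    {x : EuclideanSpace ℝ (Fin n)} (hx1 : ‖x‖ ≤ 1) : v x = v 0 := by
  refine le_antisymm (ball_neumann_le hn hc hl hν hx1) ?_
  have := ball_neumann_le hn (v := fun z => -1 * v z) (hc.const_smul (-1 : ℝ))
    (fun z hz => ((hl z hz).const_mul (-1)).congr_val (by simp))
    (fun z hz => by simpa using (hν z hz).const_mul (-1)) hx1
  linarith

theorem norm_eN {n : ℕ} (hn : 1 ≤ n) : ‖eN n‖ = 1 := by
  obtain ⟨m, rfl⟩ : ∃ m, n = m + 1 := ⟨n - 1, by omega⟩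
  have : eN (m + 1) = EuclideanSpace.single (Fin.last m) 1 := by
    ext i
    simp [eN, Fin.ext_iff]
  rw [this]
  simp

theorem lastCoord_add_smul {n : ℕ} (hn : 1 ≤ n) (x : EuclideanSpace ℝ (Fin n)) (t : ℝ) :
    lastCoord n (x + t • eN n) = lastCoord n x + t := by
  simp [lastCoord, inner_add_right, inner_smul_right, norm_eN hn]

theorem norm_add_smul_eN_sq {n : ℕ} (hn : 1 ≤ n) (x : EuclideanSpace ℝ (Fin n)) (t : ℝ) :
    ‖x + t • eN n‖ ^ 2 = ‖x‖ ^ 2 + 2 * t * lastCoord n x + t ^ 2 := by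
  rw [norm_add_sq_real, inner_smul_right, norm_smul, norm_eN hn, real_inner_comm, lastCoord]
  simp
  ring

theorem continuous_lastCoord (n : ℕ) : Continuous (lastCoord n) := by
  unfold lastCoord
  fun_prop

/-- Uniqueness for the Neumann problem in the half-space, one inequality. -/
theorem halfSpace_neumann_nonpos {n : ℕ} (hn : 4 ≤ n) {v : EuclideanSpace ℝ (Fin n) → ℝ}
    (hc : ContinuousOn v {x | 0 ≤ lastCoord n x})
    (hl : ∀ x, 0 < lastCoord n x → HasLineLaplacian v x 0)
    (hν : ∀ x, lastCoord n x = 0 → HasDerivWithinAt (fun t : ℝ => v (x + t • eN n)) 0 (Ici 0) 0)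
    (hlim : Tendsto v (Bornology.cobounded (EuclideanSpace ℝ (Fin n)) ⊓
      𝓟 {x | 0 ≤ lastCoord n x}) (𝓝 0))
    {x : EuclideanSpace ℝ (Fin n)} (hx : 0 ≤ lastCoord n x) : v x ≤ 0 := by
  by_contra! hpos
  have hn1 : 1 ≤ n := by omega
  -- The barrier `|z + e_n|^{-1}` has its pole outside the half-space, is strictly superharmonic
  -- because `n > 3`, and decreases in the inward normal direction at the boundary. Subtracting a
  -- multiple of it rules out interior and boundary maxima.
  set b : EuclideanSpace ℝ (Fin n) → ℝ := fun z => (0 + ‖z - -eN n‖ ^ 2) ^ (-(1 / 2) : ℝ) with hb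
  have hbpos : ∀ z, 0 ≤ lastCoord n z → 1 ≤ 0 + ‖z - -eN n‖ ^ 2 := by
    intro z hz
    have := norm_add_smul_eN_sq hn1 z 1
    rw [one_smul] at this
    rw [sub_neg_eq_add, zero_add, this]
    nlinarith [sq_nonneg ‖z‖]
  have hbx : 0 ≤ b x := by positivity
  have hbnn : ∀ z, 0 ≤ b z := fun z => by positivity
  -- The value at `x` stays positive after subtracting the barrier, so the decay of `v` at infinity
  -- confines the competition for the maximum to a compact set.
  obtain ⟨ε, hε, hεx⟩ : ∃ ε : ℝ, 0 < ε ∧ 0 < v x - ε * b x :=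
    ⟨v x / (2 * (b x + 1)), by positivity, by
      have : v x / (2 * (b x + 1)) * b x < v x := by
        rw [div_mul_eq_mul_div, div_lt_iff₀ (by positivity)]
        nlinarith
      linarith⟩
  have hev := hlim.eventually (gt_mem_nhds hεx)
  rw [eventually_inf_principal] at hev
  have hbdd : Bornology.IsBounded {z : EuclideanSpace ℝ (Fin n) |
      ¬ (z ∈ {x | 0 ≤ lastCoord n x} → v z < v x - ε * b x)} := by
    rw [Bornology.isBounded_def]
    filter_upwards [hev] with z hz using not_not.2 hz
  obtain ⟨R, hR⟩ := hbdd.subset_closedBall 0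
  set K : Set (EuclideanSpace ℝ (Fin n)) :=
    Metric.closedBall 0 (max R ‖x‖) ∩ {z | 0 ≤ lastCoord n z} with hK
  have hKc : IsCompact K := (isCompact_closedBall _ _).inter_right
    (isClosed_le continuous_const (continuous_lastCoord n))
  have hxK : x ∈ K := by simp [hK, hx]
  have hbc : ContinuousOn b K := by
    refine ContinuousOn.rpow_const (by fun_prop) fun z hz => Or.inl ?_
    exact (zero_lt_one.trans_le (hbpos z hz.2)).ne'
  obtain ⟨y, hy, hmax⟩ := hKc.exists_isMaxOn ⟨x, hxK⟩
    ((hc.mono inter_subset_right).add (hbc.const_smul (-ε)))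
  have hmax' : ∀ z, 0 ≤ lastCoord n z → v z + -ε * b z ≤ v y + -ε * b y := by
    intro z hz
    by_cases hzK : z ∈ K
    · exact hmax hzK
    have h1 : v x + -ε * b x ≤ v y + -ε * b y := hmax hxK
    have h2 : v z < v x - ε * b x := by
      by_contra hcon
      apply hzK
      have : z ∈ Metric.closedBall (0 : EuclideanSpace ℝ (Fin n)) R := hR (by simp at hcon ⊢; exact ⟨hz, hcon⟩)
      exact ⟨Metric.closedBall_subset_closedBall (le_max_left _ _) this, hz⟩
    have h3 := mul_nonneg hε.le (hbnn z)
    linarith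
  have hylast : 0 ≤ lastCoord n y := hy.2
  have hy0 : 0 < 0 + ‖y - -eN n‖ ^ 2 := zero_lt_one.trans_le (hbpos y hylast)
  rcases hylast.eq_or_lt with h | h
  · have hd : HasDerivWithinAt (fun t : ℝ => v (y + t • eN n) + -ε * b (y + t • eN n))
        (0 + -ε * (-(1 / 2) * (2 * (0 + ‖y - -eN n‖ ^ 2) ^ (-(1 / 2) - 1 : ℝ)))) (Ici 0) 0 := by
      refine (hν y h.symm).add (HasDerivWithinAt.const_mul (-ε) ?_)
      have e : (fun t : ℝ => b (y + t • eN n)) =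
          fun t : ℝ => (‖y‖ ^ 2 + (1 + t) ^ 2) ^ (-(1 / 2) : ℝ) := by
        ext t
        have := norm_add_smul_eN_sq hn1 y (1 + t)
        rw [← h] at this
        simp only [hb]
        rw [sub_neg_eq_add, add_assoc, show t • eN n + eN n = (1 + t) • eN n by module, this]
        simp
      have e0 : 0 + ‖y - -eN n‖ ^ 2 = ‖y‖ ^ 2 + (1 + 0) ^ 2 := by
        have := norm_add_smul_eN_sq hn1 y 1
        rw [← h, one_smul] at this
        rw [sub_neg_eq_add, this]
        simp
      rw [e0] at hy0 ⊢
      rw [e]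
      have h1 : HasDerivAt (fun t : ℝ => ‖y‖ ^ 2 + (1 + t) ^ 2) 2 0 := by
        have := (((hasDerivAt_id (0 : ℝ)).const_add 1).pow 2).const_add (‖y‖ ^ 2)
        simpa using this
      refine (h1.rpow_const (p := (-(1 / 2) : ℝ)) (Or.inl hy0.ne')).hasDerivWithinAt.congr_deriv ?_
      ring
    have h2 : 0 < (0 + ‖y - -eN n‖ ^ 2) ^ (-(1 / 2) - 1 : ℝ) := Real.rpow_pos_of_pos hy0 _
    have hev := exists_gt_of_hasDerivWithinAt_Ici hd (by
      have := mul_pos hε h2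
      linarith)
    obtain ⟨t, ht, ht0⟩ := (hev.and self_mem_nhdsWithin).exists
    have ht0' : 0 < t := ht0
    have := hmax' (y + t • eN n) (by rw [lastCoord_add_smul hn1]; linarith)
    simp only [zero_smul, add_zero] at ht
    linarith
  · have hL := (hl y h).add ((hasLineLaplacian_rpow 0 (-(1 / 2)) y (-eN n) hy0).const_mul (-ε))
    refine hL.not_isLocalMax ?_ ?_
    · have hn4 : (4 : ℝ) ≤ n := by exact_mod_cast hn
      have h2 : 0 < (0 + ‖y - -eN n‖ ^ 2) ^ (-(1 / 2) - 2 : ℝ) := Real.rpow_pos_of_pos hy0 _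
      have h3 : (0 : ℝ) + -ε * (2 * -(1 / 2) * (0 + ‖y - -eN n‖ ^ 2) ^ (-(1 / 2) - 2 : ℝ) *
          (2 * (-(1 / 2) - 1) * ‖y - -eN n‖ ^ 2 + n * (0 + ‖y - -eN n‖ ^ 2))) =
          ε * ((0 + ‖y - -eN n‖ ^ 2) ^ (-(1 / 2) - 2 : ℝ) *
            ((n - 3) * (0 + ‖y - -eN n‖ ^ 2))) := by ring
      rw [h3]
      have : (0 : ℝ) < n - 3 := by linarith
      positivity
    · have hU : {z | 0 < lastCoord n z} ∈ 𝓝 y :=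
        (isOpen_lt continuous_const (continuous_lastCoord n)).mem_nhds h
      filter_upwards [hU] with z hz using hmax' z (le_of_lt hz)

theorem halfSpace_neumann_eq_zero {n : ℕ} (hn : 4 ≤ n) {v : EuclideanSpace ℝ (Fin n) → ℝ}
    (hc : ContinuousOn v {x | 0 ≤ lastCoord n x})
    (hl : ∀ x, 0 < lastCoord n x → HasLineLaplacian v x 0)
    (hν : ∀ x, lastCoord n x = 0 → HasDerivWithinAt (fun t : ℝ => v (x + t • eN n)) 0 (Ici 0) 0)
    (hlim : Tendsto v (Bornology.cobounded (EuclideanSpace ℝ (Fin n)) ⊓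
      𝓟 {x | 0 ≤ lastCoord n x}) (𝓝 0))
    {x : EuclideanSpace ℝ (Fin n)} (hx : 0 ≤ lastCoord n x) : v x = 0 := by
  refine le_antisymm (halfSpace_neumann_nonpos hn hc hl hν hlim hx) ?_
  have := halfSpace_neumann_nonpos hn (v := fun z => -1 * v z) (hc.const_smul (-1 : ℝ))
    (fun z hz => ((hl z hz).const_mul (-1)).congr_val (by simp))
    (fun z hz => by simpa using (hν z hz).const_mul (-1)) (by simpa using hlim.const_mul (-1)) hx
  linarith

/-! ### The fundamental solution and its derivatives along lines -/

/-- The fundamental solution `|x - y|^{-(k+2)}` in dimension `k + 4`, up to a constant. -/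
noncomputable def fund {n : ℕ} (k : ℕ) (x y : EuclideanSpace ℝ (Fin n)) : ℝ := (‖x - y‖ ^ (k + 2))⁻¹

/-- Writing the power as `m + 1` keeps the exponent nonzero, so at `q = 0` both sides are `0` by the
conventions for `0 ^ p` and `0⁻¹`. The pole then needs no separate treatment when rewriting. -/
theorem zero_add_sq_rpow {q : ℝ} (hq : 0 ≤ q) (m : ℕ) (p : ℝ) (hp : p = -((m : ℝ) + 1) / 2) :
    (0 + q ^ 2) ^ p = (q ^ (m + 1))⁻¹ := by
  rcases hq.eq_or_lt with rfl | hq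
  · have : p ≠ 0 := by rw [hp]; have : (0 : ℝ) ≤ m := m.cast_nonneg; intro h; linarith
    simp [Real.zero_rpow this]
  · rw [zero_add, ← Real.rpow_natCast q 2, ← Real.rpow_mul hq.le, hp,
      ← Real.rpow_natCast q (m + 1), ← Real.rpow_neg hq.le]
    congr 1
    push_cast
    ring

theorem fund_eq_rpow {n : ℕ} (k : ℕ) (x y : EuclideanSpace ℝ (Fin n)) :
    fund k x y = (0 + ‖x - y‖ ^ 2) ^ (-((k : ℝ) + 2) / 2) :=
  (zero_add_sq_rpow (norm_nonneg _) (k + 1) _ (by push_cast; ring)).symm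

theorem fund_nonneg {n : ℕ} (k : ℕ) (x y : EuclideanSpace ℝ (Fin n)) : 0 ≤ fund k x y := by
  unfold fund
  positivity

/-- The derivative of `fund k` along a coordinate line. -/
noncomputable def fundDeriv {n : ℕ} (k : ℕ) (x y : EuclideanSpace ℝ (Fin n)) (i : Fin n) (t : ℝ) : ℝ :=
  -((k : ℝ) + 2) * (x i - y i + t) * (‖x + t • EuclideanSpace.single i (1 : ℝ) - y‖ ^ (k + 4))⁻¹

/-- The second derivative of `fund k` along a coordinate line. -/
noncomputable def fundDerivTwo {n : ℕ} (k : ℕ) (x y : EuclideanSpace ℝ (Fin n)) (i : Fin n)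
    (t : ℝ) : ℝ :=
  -((k : ℝ) + 2) * (‖x + t • EuclideanSpace.single i (1 : ℝ) - y‖ ^ (k + 4))⁻¹ +
    (k + 2) * (k + 4) * (x i - y i + t) ^ 2 *
      (‖x + t • EuclideanSpace.single i (1 : ℝ) - y‖ ^ (k + 6))⁻¹

theorem hasDerivAt_fund_line {n : ℕ} (k : ℕ) (x y : EuclideanSpace ℝ (Fin n)) (i : Fin n) (t : ℝ)
    (h : 0 < ‖x + t • EuclideanSpace.single i (1 : ℝ) - y‖) :
    HasDerivAt (fun t : ℝ => fund k (x + t • EuclideanSpace.single i (1 : ℝ)) y)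
      (fundDeriv k x y i t) t := by
  simp only [fund_eq_rpow]
  refine (hasDerivAt_rpow_line 0 (-((k : ℝ) + 2) / 2) x y i t (by positivity)).congr_deriv ?_
  rw [zero_add_sq_rpow h.le (k + 3) _ (by push_cast; ring), fundDeriv]
  ring

theorem hasDerivAt_fundDeriv {n : ℕ} (k : ℕ) (x y : EuclideanSpace ℝ (Fin n)) (i : Fin n) (t : ℝ)
    (h : 0 < ‖x + t • EuclideanSpace.single i (1 : ℝ) - y‖) :
    HasDerivAt (fundDeriv k x y i) (fundDerivTwo k x y i t) t := by
  have e : fundDeriv k x y i = fun t : ℝ => 2 * (-((k : ℝ) + 2) / 2) * (x i - y i + t) *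
        (0 + ‖x + t • EuclideanSpace.single i (1 : ℝ) - y‖ ^ 2) ^ (-((k : ℝ) + 2) / 2 - 1) := by
    ext t
    rw [zero_add_sq_rpow (norm_nonneg _) (k + 3) _ (by push_cast; ring), fundDeriv]
    ring
  rw [e]
  refine (hasDerivAt_rpow_line_deriv 0 (-((k : ℝ) + 2) / 2) x y i t (by positivity)).congr_deriv ?_
  rw [zero_add_sq_rpow h.le (k + 3) _ (by push_cast; ring),
    zero_add_sq_rpow h.le (k + 5) _ (by push_cast; ring), fundDerivTwo]
  ring

theorem abs_coord_le {n : ℕ} (x y : EuclideanSpace ℝ (Fin n)) (i : Fin n) (t : ℝ) :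
    |x i - y i + t| ≤ ‖x + t • EuclideanSpace.single i (1 : ℝ) - y‖ := by
  have := PiLp.norm_apply_le (x + t • EuclideanSpace.single i (1 : ℝ) - y) i
  simp only [PiLp.sub_apply, PiLp.add_apply, PiLp.smul_apply, Real.norm_eq_abs] at this
  convert this using 2
  simp
  ring

theorem abs_fundDeriv_le {n : ℕ} (k : ℕ) (x y : EuclideanSpace ℝ (Fin n)) (i : Fin n) (t : ℝ)
    (h : 0 < ‖x + t • EuclideanSpace.single i (1 : ℝ) - y‖) :
    |fundDeriv k x y i t| ≤
      (k + 2) * (‖x + t • EuclideanSpace.single i (1 : ℝ) - y‖ ^ (k + 3))⁻¹ := by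
  have h1 := abs_coord_le x y i t
  set q := ‖x + t • EuclideanSpace.single i (1 : ℝ) - y‖ with hq
  have hk : (0 : ℝ) ≤ k := k.cast_nonneg
  rw [fundDeriv, ← hq, abs_mul, abs_mul, abs_neg, abs_of_pos (by positivity : (0 : ℝ) < k + 2),
    abs_of_pos (by positivity : 0 < (q ^ (k + 4))⁻¹), mul_assoc]
  gcongr
  calc |x i - y i + t| * (q ^ (k + 4))⁻¹ ≤ q * (q ^ (k + 4))⁻¹ := by gcongr
    _ = (q ^ (k + 3))⁻¹ := by field_simp; ring

theorem abs_fundDerivTwo_le {n : ℕ} (k : ℕ) (x y : EuclideanSpace ℝ (Fin n)) (i : Fin n) (t : ℝ)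
    (h : 0 < ‖x + t • EuclideanSpace.single i (1 : ℝ) - y‖) :
    |fundDerivTwo k x y i t| ≤
      (k + 2) * (k + 5) * (‖x + t • EuclideanSpace.single i (1 : ℝ) - y‖ ^ (k + 4))⁻¹ := by
  have h1 := abs_coord_le x y i t
  set q := ‖x + t • EuclideanSpace.single i (1 : ℝ) - y‖ with hq
  have hk : (0 : ℝ) ≤ k := k.cast_nonneg
  rw [fundDerivTwo, ← hq]
  have h2 : (x i - y i + t) ^ 2 ≤ q ^ 2 := by
    rw [← sq_abs (x i - y i + t)]
    gcongr
  have h3 : (k + 2) * (k + 4) * (x i - y i + t) ^ 2 * (q ^ (k + 6))⁻¹ ≤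
      ((k : ℝ) + 2) * (k + 4) * (q ^ (k + 4))⁻¹ := by
    calc (k + 2) * (k + 4) * (x i - y i + t) ^ 2 * (q ^ (k + 6))⁻¹
        ≤ ((k : ℝ) + 2) * (k + 4) * q ^ 2 * (q ^ (k + 6))⁻¹ := by gcongr
      _ = ((k : ℝ) + 2) * (k + 4) * (q ^ (k + 4))⁻¹ := by field_simp; ring
  have h4 : 0 ≤ ((k : ℝ) + 2) * (k + 4) * (x i - y i + t) ^ 2 * (q ^ (k + 6))⁻¹ := by positivity
  have h5 : 0 ≤ (q ^ (k + 4))⁻¹ := by positivity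
  rw [abs_le]
  constructor <;> nlinarith [mul_nonneg hk h5, mul_nonneg (mul_nonneg hk hk) h5]

/-- The dimension must be exactly `k + 4`: the trace contributes `-(k+2)(k+4)` and the radial part
`(k+2)(k+4)`. -/
theorem sum_fundDerivTwo (k : ℕ) (x y : EuclideanSpace ℝ (Fin (k + 4))) (h : x ≠ y) :
    ∑ i, fundDerivTwo k x y i 0 = 0 := by
  have hq : 0 < ‖x - y‖ := norm_pos_iff.2 (sub_ne_zero.2 h)
  simp only [fundDerivTwo, zero_smul, add_zero]
  rw [Finset.sum_add_distrib, Finset.sum_const, ← Finset.sum_mul, ← Finset.mul_sum]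
  have : ∑ i, (x i - y i) ^ 2 = ‖x - y‖ ^ 2 := by rw [← sum_coord_sq]; simp
  rw [this]
  simp
  field_simp
  ring

/-! ### Potentials of half-lines -/

/-- Integrability on a half-line from an inverse square bound. -/
theorem integrableOn_Ioi_of_le_inv_sq {f : ℝ → ℝ} {σ C : ℝ} (hσ : 0 < σ)
    (hf : ContinuousOn f (Ioi σ)) (hb : ∀ s, σ < s → |f s| ≤ C * (s ^ 2)⁻¹) :
    IntegrableOn f (Ioi σ) := by
  have h1 : IntegrableOn (fun s : ℝ => C * (s ^ 2)⁻¹) (Ioi σ) := by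
    refine Integrable.const_mul ?_ C
    refine (integrableOn_Ioi_rpow_of_lt (a := -2) (by norm_num) hσ).congr_fun (fun s hs => ?_)
      measurableSet_Ioi
    have : (0 : ℝ) ≤ s := (hσ.trans hs).le
    simp only
    rw [Real.rpow_neg this]
    norm_num
  refine Integrable.mono' h1 (hf.aestronglyMeasurable measurableSet_Ioi) ?_
  exact (ae_restrict_mem measurableSet_Ioi).mono fun s hs => hb s hs

theorem hasDerivAt_integral_Ioi_param {K K' : ℝ → ℝ → ℝ} {σ C t₀ : ℝ} {U : Set ℝ} (hU : U ∈ 𝓝 t₀)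
    (hσ : 0 < σ) (hK : ∀ t ∈ U, ContinuousOn (fun s => K t s) (Ioi σ))
    (hKi : IntegrableOn (K t₀) (Ioi σ))
    (hK' : ContinuousOn (fun s => K' t₀ s) (Ioi σ))
    (hd : ∀ s, σ < s → ∀ t ∈ U, HasDerivAt (fun t => K t s) (K' t s) t)
    (hb : ∀ s, σ < s → ∀ t ∈ U, |K' t s| ≤ C * (s ^ 2)⁻¹) :
    HasDerivAt (fun t => ∫ s in Ioi σ, K t s) (∫ s in Ioi σ, K' t₀ s) t₀ := by
  have h1 : IntegrableOn (fun s : ℝ => C * (s ^ 2)⁻¹) (Ioi σ) := by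
    have hC : 0 ≤ C := by
      have := (abs_nonneg _).trans (hb (σ + 1) (by linarith) t₀ (mem_of_mem_nhds hU))
      exact nonneg_of_mul_nonneg_left this (by positivity)
    refine integrableOn_Ioi_of_le_inv_sq hσ ?_ (C := C) fun s hs => ?_
    · refine continuousOn_const.mul (ContinuousOn.inv₀ (by fun_prop) fun s hs => ?_)
      have : 0 < s := hσ.trans hs
      positivity
    · rw [abs_of_nonneg (by positivity)]
  refine (hasDerivAt_integral_of_dominated_loc_of_deriv_le (μ := volume.restrict (Ioi σ))
    (bound := fun s => C * (s ^ 2)⁻¹) hU ?_ hKi (hK'.aestronglyMeasurable measurableSet_Ioi)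
    ?_ h1 ?_).2
  · filter_upwards [hU] with t ht using (hK t ht).aestronglyMeasurable measurableSet_Ioi
  · exact (ae_restrict_mem measurableSet_Ioi).mono fun s hs => hb s hs
  · exact (ae_restrict_mem measurableSet_Ioi).mono fun s hs => hd s hs

section Potential

variable {k : ℕ} {v x₀ : EuclideanSpace ℝ (Fin (k + 4))} {w κ : ℝ → ℝ} {σ c r C : ℝ}

theorem continuousOn_inv_norm_pow {z : EuclideanSpace ℝ (Fin (k + 4))} (m : ℕ) (hσ : 0 < σ)
    (hc : 0 < c) (hz : ∀ s, σ < s → c * s ≤ ‖z - s • v‖) :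
    ContinuousOn (fun s : ℝ => (‖z - s • v‖ ^ m)⁻¹) (Ioi σ) := by
  refine ContinuousOn.inv₀ (by fun_prop) fun s hs => ?_
  have hs' : σ < s := hs
  have h0 : 0 < s := hσ.trans hs'
  have : 0 < ‖z - s • v‖ := lt_of_lt_of_le (by positivity) (hz s hs')
  positivity

theorem continuousOn_potential_integrand {z : EuclideanSpace ℝ (Fin (k + 4))} (hσ : 0 < σ)
    (hc : 0 < c) (hw : ContinuousOn w (Ioi σ)) (hκ : ContinuousOn κ (Ioi σ))
    (hz : ∀ s, σ < s → c * s ≤ ‖z - s • v‖) :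
    ContinuousOn (fun s : ℝ => w s * fund k z (s • v) - κ s) (Ioi σ) :=
  (hw.mul (continuousOn_inv_norm_pow (k + 2) hσ hc hz)).sub hκ

/-- Here `w` is the density on the ray and `κ` a counterterm, independent of the point, that makes
the integral converge: `0` for the half-space and `1/s` for the ball. The uniform majorant `C/s²`
justifies dominated convergence. -/
theorem continuousAt_potential (hσ : 0 < σ) (hc : 0 < c) (hr : 0 < r)
    (hw : ContinuousOn w (Ioi σ)) (hκ : ContinuousOn κ (Ioi σ))
    (hz : ∀ z, ‖z - x₀‖ < r → ∀ s, σ < s → c * s ≤ ‖z - s • v‖)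
    (hb : ∀ z, ‖z - x₀‖ < r → ∀ s, σ < s → |w s * fund k z (s • v) - κ s| ≤ C * (s ^ 2)⁻¹) :
    ContinuousAt (fun z => ∫ s in Ioi σ, (w s * fund k z (s • v) - κ s)) x₀ := by
  have hnh : ∀ᶠ z in 𝓝 x₀, ‖z - x₀‖ < r := by
    filter_upwards [Metric.ball_mem_nhds x₀ hr] with z hz
    rwa [Metric.mem_ball, dist_eq_norm] at hz
  have hx₀ : ‖x₀ - x₀‖ < r := by simpa using hr
  have hC : 0 ≤ C := by
    have := (abs_nonneg _).trans (hb x₀ hx₀ (σ + 1) (by linarith))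
    exact nonneg_of_mul_nonneg_left this (by positivity)
  refine continuousAt_of_dominated (bound := fun s => C * (s ^ 2)⁻¹) ?_ ?_ ?_ ?_
  · filter_upwards [hnh] with z hz'
    exact (continuousOn_potential_integrand hσ hc hw hκ (hz z hz')).aestronglyMeasurable
      measurableSet_Ioi
  · filter_upwards [hnh] with z hz'
    exact (ae_restrict_mem measurableSet_Ioi).mono fun s hs => hb z hz' s hs
  · refine integrableOn_Ioi_of_le_inv_sq hσ ?_ (C := C) fun s hs => ?_
    · refine continuousOn_const.mul (ContinuousOn.inv₀ (by fun_prop) fun s hs => ?_)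
      have : 0 < s := hσ.trans hs
      positivity
    · rw [abs_of_nonneg (by positivity)]
  · refine (ae_restrict_mem measurableSet_Ioi).mono fun s hs => ?_
    have hs' : σ < s := hs
    have h0 : 0 < s := hσ.trans hs'
    have : 0 < ‖x₀ - s • v‖ := lt_of_lt_of_le (by positivity) (hz x₀ hx₀ s hs')
    unfold fund
    have h2 : ‖x₀ - s • v‖ ^ (k + 2) ≠ 0 := by positivity
    fun_prop (disch := exact h2)

/-- A superposition of fundamental solutions with poles on a ray is harmonic off the ray. -/
theorem hasLineLaplacian_potential (hσ : 0 < σ) (hc : 0 < c) (hr : 0 < r)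
    (hw : ContinuousOn w (Ioi σ)) (hκ : ContinuousOn κ (Ioi σ))
    (hwb : ∀ s, σ < s → |w s| ≤ s ^ (k + 1))
    (hz : ∀ z, ‖z - x₀‖ < r → ∀ s, σ < s → c * s ≤ ‖z - s • v‖)
    (hb : ∀ z, ‖z - x₀‖ < r → ∀ s, σ < s → |w s * fund k z (s • v) - κ s| ≤ C * (s ^ 2)⁻¹) :
    HasLineLaplacian (fun z => ∫ s in Ioi σ, (w s * fund k z (s • v) - κ s)) x₀ 0 := by
  have hk : (0 : ℝ) ≤ k := k.cast_nonneg
  have hnear : ∀ (i : Fin (k + 4)) (t : ℝ), |t| < r →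
      ‖x₀ + t • EuclideanSpace.single i (1 : ℝ) - x₀‖ < r := by
    intro i t ht
    simpa [norm_smul] using ht
  have hpos : ∀ (i : Fin (k + 4)) (t : ℝ), |t| < r → ∀ s, σ < s →
      0 < ‖x₀ + t • EuclideanSpace.single i (1 : ℝ) - s • v‖ := fun i t ht s hs =>
    lt_of_lt_of_le (mul_pos hc (hσ.trans hs)) (hz _ (hnear i t ht) s hs)
  have hball : ∀ t : ℝ, |t| < r → {t : ℝ | |t| < r} ∈ 𝓝 t := fun t ht =>
    (isOpen_lt continuous_abs continuous_const).mem_nhds ht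
  have hcoord : ∀ (i : Fin (k + 4)) (t : ℝ),
      Continuous (fun s : ℝ => x₀ i - (s • v) i + t) := by
    intro i t
    simp only [PiLp.smul_apply, smul_eq_mul]
    fun_prop
  have hc1 : ∀ (i : Fin (k + 4)) (t : ℝ), |t| < r →
      ContinuousOn (fun s => w s * fundDeriv k x₀ (s • v) i t) (Ioi σ) := fun i t ht =>
    hw.mul ((continuousOn_const.mul (hcoord i t).continuousOn).mul
      (continuousOn_inv_norm_pow (k + 4) hσ hc (hz _ (hnear i t ht))))
  have hc2 : ∀ (i : Fin (k + 4)) (t : ℝ), |t| < r →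
      ContinuousOn (fun s => w s * fundDerivTwo k x₀ (s • v) i t) (Ioi σ) := fun i t ht =>
    hw.mul ((continuousOn_const.mul (continuousOn_inv_norm_pow (k + 4) hσ hc
      (hz _ (hnear i t ht)))).add ((continuousOn_const.mul ((hcoord i t).pow 2).continuousOn).mul
      (continuousOn_inv_norm_pow (k + 6) hσ hc (hz _ (hnear i t ht)))))
  -- Differentiation removes the counterterm, and the size `s^{k+1} · s^{-(k+3)} = s^{-2}` is
  -- integrable by itself.
  have hb1 : ∀ (i : Fin (k + 4)) (s : ℝ), σ < s → ∀ t : ℝ, |t| < r →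
      |w s * fundDeriv k x₀ (s • v) i t| ≤ ((k + 2) * (c ^ (k + 3))⁻¹) * (s ^ 2)⁻¹ := by
    intro i s hs t ht
    have hs0 : 0 < s := hσ.trans hs
    rw [abs_mul]
    calc |w s| * |fundDeriv k x₀ (s • v) i t| ≤ s ^ (k + 1) *
          ((k + 2) * ((c * s) ^ (k + 3))⁻¹) := by
          refine mul_le_mul (hwb s hs) ?_ (abs_nonneg _) (by positivity)
          refine (abs_fundDeriv_le k x₀ (s • v) i t (hpos i t ht s hs)).trans ?_
          gcongr
          exact hz _ (hnear i t ht) s hs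
      _ = _ := by field_simp; ring
  -- A second derivative gains one more power of `s`; since `s > σ` it is spent as the constant
  -- `σ⁻¹`, so that the same majorant applies.
  have hb2 : ∀ (i : Fin (k + 4)) (s : ℝ), σ < s → ∀ t : ℝ, |t| < r →
      |w s * fundDerivTwo k x₀ (s • v) i t| ≤
        ((k + 2) * (k + 5) * (c ^ (k + 4))⁻¹ * σ⁻¹) * (s ^ 2)⁻¹ := by
    intro i s hs t ht
    have hs0 : 0 < s := hσ.trans hs
    rw [abs_mul]
    calc |w s| * |fundDerivTwo k x₀ (s • v) i t| ≤ s ^ (k + 1) *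
          ((k + 2) * (k + 5) * ((c * s) ^ (k + 4))⁻¹) := by
          refine mul_le_mul (hwb s hs) ?_ (abs_nonneg _) (by positivity)
          refine (abs_fundDerivTwo_le k x₀ (s • v) i t (hpos i t ht s hs)).trans ?_
          gcongr
          exact hz _ (hnear i t ht) s hs
      _ = ((k + 2) * (k + 5) * (c ^ (k + 4))⁻¹ * s⁻¹) * (s ^ 2)⁻¹ := by field_simp; ring
      _ ≤ _ := by gcongr
  have h0r : |(0 : ℝ)| < r := by simpa using hr
  refine ⟨fun i t => ∫ s in Ioi σ, w s * fundDeriv k x₀ (s • v) i t,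
    fun i => ∫ s in Ioi σ, w s * fundDerivTwo k x₀ (s • v) i 0, fun i => ?_, fun i => ?_, ?_⟩
  · filter_upwards [hball 0 h0r] with t ht
    have ht' : |t| < r := ht
    refine hasDerivAt_integral_Ioi_param (hball t ht') hσ
      (K := fun t s => w s * fund k (x₀ + t • EuclideanSpace.single i (1 : ℝ)) (s • v) - κ s)
      (K' := fun t s => w s * fundDeriv k x₀ (s • v) i t)
      (fun t ht => continuousOn_potential_integrand hσ hc hw hκ (hz _ (hnear i t ht)))
      (integrableOn_Ioi_of_le_inv_sq hσ
        (continuousOn_potential_integrand hσ hc hw hκ (hz _ (hnear i t ht')))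
        (hb _ (hnear i t ht'))) (hc1 i t ht')
      (fun s hs t ht => ?_) (fun s hs t ht => hb1 i s hs t ht)
    exact ((hasDerivAt_fund_line k x₀ (s • v) i t (hpos i t ht s hs)).const_mul (w s)).sub_const _
  · refine hasDerivAt_integral_Ioi_param (hball 0 h0r) hσ
      (K := fun t s => w s * fundDeriv k x₀ (s • v) i t)
      (K' := fun t s => w s * fundDerivTwo k x₀ (s • v) i t)
      (fun t ht => hc1 i t ht)
      (integrableOn_Ioi_of_le_inv_sq hσ (hc1 i 0 h0r) (fun s hs => hb1 i s hs 0 h0r)) (hc2 i 0 h0r)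
      (fun s hs t ht => ?_) (fun s hs t ht => hb2 i s hs t ht)
    exact (hasDerivAt_fundDeriv k x₀ (s • v) i t (hpos i t ht s hs)).const_mul (w s)
  · rw [← integral_finsetSum]
    · refine (setIntegral_congr_fun measurableSet_Ioi fun s hs => ?_).trans (integral_zero _ _)
      have hne : x₀ ≠ s • v := by
        have := hpos 0 0 h0r s hs
        simpa [sub_eq_zero] using this
      rw [← Finset.mul_sum, sum_fundDerivTwo k x₀ (s • v) hne, mul_zero]
    · intro i _
      exact integrableOn_Ioi_of_le_inv_sq hσ (hc2 i 0 h0r) (fun s hs => hb2 i s hs 0 h0r)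

end Potential

theorem hasLineLaplacian_fund (k : ℕ) (x y : EuclideanSpace ℝ (Fin (k + 4))) (h : x ≠ y) :
    HasLineLaplacian (fun z => fund k z y) x 0 := by
  have hq : 0 < ‖x - y‖ := norm_pos_iff.2 (sub_ne_zero.2 h)
  simp only [fund_eq_rpow]
  refine (hasLineLaplacian_rpow 0 (-((k : ℝ) + 2) / 2) x y (by positivity)).congr_val ?_
  push_cast
  ring

/-- The integral over a half-line as a function of its end point. -/
theorem hasDerivAt_integral_Ioi_left {f : ℝ → ℝ} {a b : ℝ} (hab : a < b)
    (hf : IntegrableOn f (Ioi a)) (hc : ContinuousAt f b) :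
    HasDerivAt (fun u => ∫ s in Ioi u, f s) (-f b) b := by
  have hi : IntervalIntegrable f volume a b := by
    rw [intervalIntegrable_iff_integrableOn_Ioc_of_le hab.le]
    exact hf.mono_set Ioc_subset_Ioi_self
  have hm : StronglyMeasurableAtFilter f (𝓝 b) :=
    ⟨Ioi a, Ioi_mem_nhds hab, hf.aestronglyMeasurable⟩
  have h1 := (intervalIntegral.integral_hasDerivAt_right hi hm hc).const_sub (∫ s in Ioi a, f s)
  refine h1.congr_of_eventuallyEq ?_
  filter_upwards [Ioi_mem_nhds hab] with u hu
  have := intervalIntegral.integral_Ioi_sub_Ioi hf (le_of_lt hu)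
  linarith

theorem integral_Ioi_inv_add_pow {σ b : ℝ} (m : ℕ) (h : 0 < σ + b) :
    IntegrableOn (fun s : ℝ => ((s + b) ^ (m + 2))⁻¹) (Ioi σ) ∧
      ∫ s in Ioi σ, ((s + b) ^ (m + 2))⁻¹ = ((m + 1) * (σ + b) ^ (m + 1))⁻¹ := by
  have hm : (0 : ℝ) < m + 1 := by positivity
  have hd : ∀ s ∈ Ici σ, HasDerivAt (fun s : ℝ => -((m + 1) * (s + b) ^ (m + 1))⁻¹)
      ((s + b) ^ (m + 2))⁻¹ s := by
    intro s hs
    have hs' : σ ≤ s := hs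
    have h0 : 0 < s + b := by linarith
    have h2 : HasDerivAt (fun s : ℝ => (m + 1) * (s + b) ^ (m + 1))
        ((m + 1) * ((m + 1) * (s + b) ^ m)) s := by
      simpa using (((hasDerivAt_id s).add_const b).pow (m + 1)).const_mul ((m : ℝ) + 1)
    refine (h2.inv (by positivity)).neg.congr_deriv ?_
    field_simp
    ring
  have hpos : ∀ s ∈ Ioi σ, 0 ≤ ((s + b) ^ (m + 2))⁻¹ := by
    intro s hs
    have hs' : σ < s := hs
    have h0 : 0 < s + b := by linarith
    positivity
  have hlim : Tendsto (fun s : ℝ => -((m + 1) * (s + b) ^ (m + 1))⁻¹) atTop (𝓝 0) := by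
    have h1 : Tendsto (fun s : ℝ => (m + 1) * (s + b) ^ (m + 1)) atTop atTop :=
      Tendsto.const_mul_atTop hm ((tendsto_pow_atTop (by omega)).comp
        (tendsto_atTop_add_const_right _ b tendsto_id))
    simpa using h1.inv_tendsto_atTop.neg
  refine ⟨integrableOn_Ioi_deriv_of_nonneg' hd hpos hlim, ?_⟩
  rw [integral_Ioi_of_hasDerivAt_of_nonneg' hd hpos hlim]
  simp

theorem abs_integral_Ioi_le {f : ℝ → ℝ} {σ b C : ℝ} (m : ℕ) (h : 0 < σ + b)
    (hf : ∀ s, σ < s → |f s| ≤ C * ((s + b) ^ (m + 2))⁻¹) :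
    |∫ s in Ioi σ, f s| ≤ C * ((σ + b) ^ (m + 1))⁻¹ := by
  obtain ⟨h1, h2⟩ := integral_Ioi_inv_add_pow m h
  have hC : 0 ≤ C := by
    have h0 : 0 < σ + 1 + b := by linarith
    exact nonneg_of_mul_nonneg_left ((abs_nonneg _).trans (hf (σ + 1) (by linarith)))
      (by positivity)
  have h3 := norm_integral_le_of_norm_le (μ := volume.restrict (Ioi σ)) (f := f)
    (h1.const_mul C) ((ae_restrict_mem measurableSet_Ioi).mono fun s hs => hf s hs)
  rw [integral_const_mul, h2] at h3
  refine h3.trans ?_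
  gcongr
  have : (0 : ℝ) ≤ m := m.cast_nonneg
  have h4 : 0 < (σ + b) ^ (m + 1) := by positivity
  nlinarith

/-! ### The explicit half-space corrector -/

theorem fund_neg {n : ℕ} (k : ℕ) (x y : EuclideanSpace ℝ (Fin n)) :
    fund k (-x) y = fund k x (-y) := by
  unfold fund
  rw [show -x - y = -(x - -y) by abel, norm_neg]

theorem lastCoord_le_norm {n : ℕ} (hn : 1 ≤ n) (x : EuclideanSpace ℝ (Fin n)) :
    |lastCoord n x| ≤ ‖x‖ := by
  have := abs_real_inner_le_norm (eN n) x
  rwa [norm_eN hn, one_mul] at this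

theorem sub_smul_neg_eN {n : ℕ} (x : EuclideanSpace ℝ (Fin n)) (s : ℝ) :
    x - s • -eN n = x + s • eN n := by
  rw [smul_neg, sub_neg_eq_add]

/-- The potential of the ray `{-s e_n : s > 1}`. -/
noncomputable def rayPotential (k : ℕ) (y : EuclideanSpace ℝ (Fin (k + 4))) : ℝ :=
  ∫ s in Ioi (1 : ℝ), (1 * fund k y (s • -eN (k + 4)) - 0)

/-- The explicit solution of the half-space problem. -/
noncomputable def halfSpaceSolution (k : ℕ) (y : EuclideanSpace ℝ (Fin (k + 4))) : ℝ :=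
  alpha (k + 4) * (((k : ℝ) + 2) / 2) *
    ((1 / ((k : ℝ) + 2)) * fund k y (-eN (k + 4)) - rayPotential k y)

section HalfSpace

variable {k : ℕ} {y : EuclideanSpace ℝ (Fin (k + 4))}

theorem ray_lower_bound (hy : 0 ≤ lastCoord (k + 4) y) :
    ∀ z, ‖z - y‖ < 1 / 2 → ∀ s : ℝ, 1 < s → 1 / 2 * s ≤ ‖z - s • -eN (k + 4)‖ := by
  intro z hz s hs
  have h1 := (lastCoord_le_norm (by omega) (z - y)).trans_lt hz
  have h2 := lastCoord_le_norm (by omega) (z - s • -eN (k + 4))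
  rw [sub_smul_neg_eN, lastCoord_add_smul (by omega)] at h2
  have h3 : lastCoord (k + 4) (z - y) = lastCoord (k + 4) z - lastCoord (k + 4) y := by
    simp [lastCoord, inner_sub_right]
  rw [h3, abs_lt] at h1
  have h4 := le_abs_self (lastCoord (k + 4) z + s)
  rw [sub_smul_neg_eN]
  linarith

theorem ray_bound (hy : 0 ≤ lastCoord (k + 4) y) :
    ∀ z, ‖z - y‖ < 1 / 2 → ∀ s : ℝ, 1 < s →
      |1 * fund k z (s • -eN (k + 4)) - 0| ≤ (2 : ℝ) ^ (k + 2) * (s ^ 2)⁻¹ := by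
  intro z hz s hs
  rw [one_mul, sub_zero, abs_of_nonneg (fund_nonneg _ _ _)]
  have h1 := ray_lower_bound hy z hz s hs
  have hs0 : 0 < s := by linarith
  unfold fund
  calc (‖z - s • -eN (k + 4)‖ ^ (k + 2))⁻¹ ≤ ((1 / 2 * s) ^ (k + 2))⁻¹ := by gcongr
    _ = 2 ^ (k + 2) * (s ^ (k + 2))⁻¹ := by
      rw [mul_pow, mul_inv, one_div, inv_pow, inv_inv]
    _ ≤ 2 ^ (k + 2) * (s ^ 2)⁻¹ := by
      gcongr
      · exact hs.le
      · omega

theorem continuousAt_rayPotential (hy : 0 ≤ lastCoord (k + 4) y) :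
    ContinuousAt (rayPotential k) y :=
  continuousAt_potential (w := fun _ => 1) (κ := fun _ => 0) one_pos one_half_pos one_half_pos
    continuousOn_const continuousOn_const (ray_lower_bound hy) (ray_bound hy)

theorem hasLineLaplacian_rayPotential (hy : 0 ≤ lastCoord (k + 4) y) :
    HasLineLaplacian (rayPotential k) y 0 :=
  hasLineLaplacian_potential (w := fun _ => 1) (κ := fun _ => 0) one_pos one_half_pos one_half_pos
    continuousOn_const continuousOn_const (fun s hs => by
      rw [abs_one]
      exact one_le_pow₀ (le_of_lt hs)) (ray_lower_bound hy) (ray_bound hy)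

theorem norm_sub_neg_eN_pos (hy : 0 ≤ lastCoord (k + 4) y) : 0 < ‖y - -eN (k + 4)‖ := by
  have h := norm_add_smul_eN_sq (by omega) y 1
  rw [one_smul] at h
  rw [sub_neg_eq_add]
  by_contra hcon
  have : ‖y + eN (k + 4)‖ = 0 := le_antisymm (not_lt.1 hcon) (norm_nonneg _)
  rw [this] at h
  nlinarith [sq_nonneg ‖y‖]

theorem hasLineLaplacian_halfSpaceSolution (hy : 0 ≤ lastCoord (k + 4) y) :
    HasLineLaplacian (halfSpaceSolution k) y 0 := by
  have h0 : y ≠ -eN (k + 4) := by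
    intro h
    have := norm_sub_neg_eN_pos hy
    simp [h] at this
  exact ((((hasLineLaplacian_fund k y (-eN (k + 4)) h0).const_mul _).sub
    (hasLineLaplacian_rayPotential hy)).const_mul _).congr_val (by simp)

theorem continuousAt_fund {n : ℕ} {x z : EuclideanSpace ℝ (Fin n)} (h : 0 < ‖x - z‖) :
    ContinuousAt (fun x => fund k x z) x := by
  unfold fund
  have : ‖x - z‖ ^ (k + 2) ≠ 0 := by positivity
  fun_prop (disch := exact this)

theorem continuousAt_halfSpaceSolution (hy : 0 ≤ lastCoord (k + 4) y) :
    ContinuousAt (halfSpaceSolution k) y :=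
  (((continuousAt_fund (norm_sub_neg_eN_pos hy)).const_mul _).sub
    (continuousAt_rayPotential hy)).const_mul _

theorem setIntegral_Ioi_add_right (f : ℝ → ℝ) (a t : ℝ) :
    ∫ s in Ioi a, f (s + t) = ∫ s in Ioi (a + t), f s := by
  have := (measurePreserving_add_right volume t).setIntegral_preimage_emb
    (measurableEmbedding_addRight t) f (Ioi (a + t))
  rw [preimage_add_const_Ioi, add_sub_cancel_right] at this
  exact this

/-- A displacement along the normal slides the ray along itself. The parameter then sits only in the
endpoint, and the normal derivative follows from the fundamental theorem of calculus. -/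
theorem rayPotential_add_smul (t : ℝ) : rayPotential k (y + t • eN (k + 4)) =
    ∫ s in Ioi (1 + t), fund k y (s • -eN (k + 4)) := by
  rw [← setIntegral_Ioi_add_right (fun s => fund k y (s • -eN (k + 4)))]
  simp only [rayPotential, one_mul, sub_zero, fund]
  congr 1
  ext s
  congr 3
  module

theorem hasDerivAt_fund_normal (hy : lastCoord (k + 4) y = 0) :
    HasDerivAt (fun t : ℝ => fund k (y + t • eN (k + 4)) (-eN (k + 4)))
      (-((k : ℝ) + 2) * (1 + ‖y‖ ^ 2) ^ (-((k : ℝ) + 2) / 2 - 1)) 0 := by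
  have e : (fun t : ℝ => fund k (y + t • eN (k + 4)) (-eN (k + 4))) =
      fun t : ℝ => (‖y‖ ^ 2 + (1 + t) ^ 2) ^ (-((k : ℝ) + 2) / 2) := by
    ext t
    have := norm_add_smul_eN_sq (by omega) y (1 + t)
    rw [hy] at this
    rw [fund_eq_rpow, sub_neg_eq_add, add_assoc,
      show t • eN (k + 4) + eN (k + 4) = (1 + t) • eN (k + 4) by module, this]
    simp
  rw [e]
  have h1 : HasDerivAt (fun t : ℝ => ‖y‖ ^ 2 + (1 + t) ^ 2) 2 0 := by
    have := (((hasDerivAt_id (0 : ℝ)).const_add 1).pow 2).const_add (‖y‖ ^ 2)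
    simpa using this
  refine (h1.rpow_const (p := (-((k : ℝ) + 2) / 2)) (Or.inl (by positivity))).congr_deriv ?_
  rw [show ‖y‖ ^ 2 + (1 + 0) ^ 2 = 1 + ‖y‖ ^ 2 by ring]
  ring

theorem hasDerivAt_rayPotential_normal (hy : lastCoord (k + 4) y = 0) :
    HasDerivAt (fun t : ℝ => rayPotential k (y + t • eN (k + 4)))
      (-fund k y (-eN (k + 4))) 0 := by
  simp only [rayPotential_add_smul]
  -- The ray is prolonged back to `1/2` so that the endpoint `1` is interior and can move both ways.
  have hlow : ∀ s : ℝ, 1 / 2 < s → 1 * s ≤ ‖y - s • -eN (k + 4)‖ := by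
    intro s hs
    have h2 := lastCoord_le_norm (by omega) (y - s • -eN (k + 4))
    rw [sub_smul_neg_eN, lastCoord_add_smul (by omega), hy, zero_add] at h2
    rw [sub_smul_neg_eN]
    linarith [le_abs_self s]
  have hcont : ContinuousOn (fun s : ℝ => fund k y (s • -eN (k + 4))) (Ioi (1 / 2)) :=
    continuousOn_inv_norm_pow (k + 2) one_half_pos one_pos hlow
  have hint : IntegrableOn (fun s : ℝ => fund k y (s • -eN (k + 4))) (Ioi (1 / 2)) := by
    refine integrableOn_Ioi_of_le_inv_sq one_half_pos hcont (C := (2 : ℝ) ^ k) fun s hs => ?_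
    have hs0 : 0 < s := one_half_pos.trans hs
    rw [abs_of_nonneg (fund_nonneg _ _ _), fund]
    calc (‖y - s • -eN (k + 4)‖ ^ (k + 2))⁻¹ ≤ ((1 * s) ^ (k + 2))⁻¹ := by
          have := hlow s hs
          gcongr
      _ = ((s ^ k)⁻¹) * (s ^ 2)⁻¹ := by rw [one_mul, pow_add, mul_inv]
      _ ≤ 2 ^ k * (s ^ 2)⁻¹ := by
          gcongr
          rw [← inv_pow]
          gcongr
          rw [inv_le_comm₀ hs0 two_pos]
          linarith
  have h1 : HasDerivAt (fun u : ℝ => ∫ s in Ioi u, fund k y (s • -eN (k + 4)))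
      (-fund k y ((1 : ℝ) • -eN (k + 4))) (1 + 0) := by
    rw [add_zero]
    exact hasDerivAt_integral_Ioi_left (by norm_num) hint
      (hcont.continuousAt (Ioi_mem_nhds (by norm_num)))
  have h2 := h1.comp (0 : ℝ) ((hasDerivAt_id (0 : ℝ)).const_add 1)
  refine h2.congr_deriv ?_
  simp

/-- With `S = 1 + |y|²` on the boundary, the pole contributes `-S^{-(k+4)/2}` and the ray
`S^{-(k+2)/2} = S · S^{-(k+4)/2}`; the sum is `|y|² S^{-(k+4)/2}`. -/
theorem hasDerivWithinAt_halfSpaceSolution (hy : lastCoord (k + 4) y = 0) :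
    HasDerivWithinAt (fun t : ℝ => halfSpaceSolution k (y + t • eN (k + 4)))
      (alpha (k + 4) * ((((k + 4 : ℕ) : ℝ) - 2) / 2) *
        (‖y‖ ^ 2 / (1 + ‖y‖ ^ 2) ^ (((k + 4 : ℕ) : ℝ) / 2))) (Ici 0) 0 := by
  refine ((((hasDerivAt_fund_normal hy).const_mul (1 / ((k : ℝ) + 2))).sub
    (hasDerivAt_rayPotential_normal hy)).const_mul
      (alpha (k + 4) * (((k : ℝ) + 2) / 2))).hasDerivWithinAt.congr_deriv ?_
  have hpos : 0 < 1 + ‖y‖ ^ 2 := by positivity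
  have h1 : fund k y (-eN (k + 4)) = (1 + ‖y‖ ^ 2) * (1 + ‖y‖ ^ 2) ^ (-((k : ℝ) + 2) / 2 - 1) := by
    have := norm_add_smul_eN_sq (by omega) y 1
    rw [hy, one_smul] at this
    rw [fund_eq_rpow, sub_neg_eq_add, this, mul_comm (1 + ‖y‖ ^ 2), ← Real.rpow_add_one hpos.ne']
    congr 1 <;> ring
  have h2 : ((1 + ‖y‖ ^ 2) ^ (((k + 4 : ℕ) : ℝ) / 2))⁻¹ =
      (1 + ‖y‖ ^ 2) ^ (-((k : ℝ) + 2) / 2 - 1) := by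
    rw [← Real.rpow_neg hpos.le]
    congr 1
    push_cast
    ring
  rw [h1, div_eq_mul_inv (‖y‖ ^ 2), h2]
  have hk : (k : ℝ) + 2 ≠ 0 := by positivity
  push_cast
  field_simp
  ring

/-- The cross term in `|y + s e_n|²` is nonnegative, so this square is at least `|y|² + s²`, hence
at least half of `(s + |y|)²`. -/
theorem norm_add_le_two_mul (hy : 0 ≤ lastCoord (k + 4) y) {s : ℝ} (hs : 0 ≤ s) :
    s + ‖y‖ ≤ 2 * ‖y - s • -eN (k + 4)‖ := by
  have h := norm_add_smul_eN_sq (by omega) y s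
  rw [← sub_smul_neg_eN] at h
  have h1 : ‖y‖ ^ 2 + s ^ 2 ≤ ‖y - s • -eN (k + 4)‖ ^ 2 := by
    rw [h]
    nlinarith [mul_nonneg hs hy]
  refine abs_le_of_sq_le_sq' ?_ (by positivity) |>.2
  nlinarith [sq_nonneg (s - ‖y‖)]

theorem fund_ray_le (hy : 0 ≤ lastCoord (k + 4) y) {s : ℝ} (hs : 0 < s) :
    fund k y (s • -eN (k + 4)) ≤ 2 ^ (k + 2) * ((s + ‖y‖) ^ (k + 2))⁻¹ := by
  have h1 := norm_add_le_two_mul hy hs.le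
  have h2 : 0 < s + ‖y‖ := by positivity
  have h3 : 0 < ‖y - s • -eN (k + 4)‖ := by linarith
  unfold fund
  calc (‖y - s • -eN (k + 4)‖ ^ (k + 2))⁻¹
      = 2 ^ (k + 2) * ((2 * ‖y - s • -eN (k + 4)‖) ^ (k + 2))⁻¹ := by
        rw [mul_pow, mul_inv]
        field_simp
    _ ≤ _ := by gcongr

theorem abs_halfSpaceSolution_le (hy : 0 ≤ lastCoord (k + 4) y) :
    |halfSpaceSolution k y| ≤ |alpha (k + 4)| * (((k : ℝ) + 2) / 2) *
      (2 ^ (k + 3) * ((1 + ‖y‖) ^ (k + 1))⁻¹) := by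
  have hk : (0 : ℝ) ≤ k := k.cast_nonneg
  have h1 : |rayPotential k y| ≤ 2 ^ (k + 2) * ((1 + ‖y‖) ^ (k + 1))⁻¹ := by
    refine abs_integral_Ioi_le k (by positivity) fun s hs => ?_
    rw [one_mul, sub_zero, abs_of_nonneg (fund_nonneg _ _ _)]
    exact fund_ray_le hy (by linarith)
  have h2 : fund k y (-eN (k + 4)) ≤ 2 ^ (k + 2) * ((1 + ‖y‖) ^ (k + 1))⁻¹ := by
    have := fund_ray_le hy one_pos
    rw [one_smul] at this
    refine this.trans ?_
    gcongr 2 ^ (k + 2) * ?_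
    gcongr
    · linarith [norm_nonneg y]
    · omega
  have h3 := fund_nonneg k y (-eN (k + 4))
  rw [halfSpaceSolution, abs_mul, abs_mul, abs_of_nonneg (by positivity : 0 ≤ ((k : ℝ) + 2) / 2)]
  gcongr
  have h4 : 1 / ((k : ℝ) + 2) * fund k y (-eN (k + 4)) ≤ 1 * fund k y (-eN (k + 4)) := by
    gcongr
    rw [div_le_one (by positivity)]
    linarith
  have h5 : 0 ≤ 1 / ((k : ℝ) + 2) * fund k y (-eN (k + 4)) := by positivity
  rw [abs_le] at h1 ⊢
  rw [show (2 : ℝ) ^ (k + 3) = 2 * 2 ^ (k + 2) by ring]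
  constructor <;> linarith

theorem tendsto_halfSpaceSolution :
    Tendsto (halfSpaceSolution k) (Bornology.cobounded (EuclideanSpace ℝ (Fin (k + 4))) ⊓
      𝓟 {x | 0 ≤ lastCoord (k + 4) x}) (𝓝 0) := by
  have h1 : Tendsto (fun y : EuclideanSpace ℝ (Fin (k + 4)) => |alpha (k + 4)| *
      (((k : ℝ) + 2) / 2) * (2 ^ (k + 3) * ((1 + ‖y‖) ^ (k + 1))⁻¹))
      (Bornology.cobounded (EuclideanSpace ℝ (Fin (k + 4)))) (𝓝 0) := by
    have h2 : Tendsto (fun y : EuclideanSpace ℝ (Fin (k + 4)) => (1 + ‖y‖) ^ (k + 1))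
        (Bornology.cobounded (EuclideanSpace ℝ (Fin (k + 4)))) atTop :=
      (tendsto_pow_atTop (by omega)).comp
        (tendsto_atTop_add_const_left _ 1 tendsto_norm_cobounded_atTop)
    simpa using (h2.inv_tendsto_atTop.const_mul (2 ^ (k + 3))).const_mul
      (|alpha (k + 4)| * (((k : ℝ) + 2) / 2))
  refine squeeze_zero_norm' ?_ (h1.mono_left inf_le_left)
  rw [eventually_inf_principal]
  exact Eventually.of_forall fun y hy => abs_halfSpaceSolution_le hy

theorem IsCorrector.eq_halfSpaceSolution {φ : EuclideanSpace ℝ (Fin (k + 4)) → ℝ}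
    (hφ : IsCorrector (k + 4) φ) (hy : 0 ≤ lastCoord (k + 4) y) : φ y = halfSpaceSolution k y := by
  have := halfSpace_neumann_eq_zero (n := k + 4) (by omega)
    (v := fun z => φ z - halfSpaceSolution k z)
    (hφ.continuousOn.sub fun z hz => (continuousAt_halfSpaceSolution hz).continuousWithinAt)
    (fun z hz => ?_) (fun z hz => ?_) ?_ hy
  · linarith
  · obtain ⟨h1, h2⟩ := hφ.harmonic z hz
    refine ((HasLineLaplacian.of_contDiffAt h1).sub
      (hasLineLaplacian_halfSpaceSolution (le_of_lt hz))).congr_val ?_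
    rw [h2.self_of_nhds]
    simp
  · exact ((hφ.neumann z hz).sub (hasDerivWithinAt_halfSpaceSolution hz)).congr_deriv (by simp)
  · simpa using hφ.tendsto_zero.sub tendsto_halfSpaceSolution

end HalfSpace

/-! ### The explicit projected bubble in the ball -/

/-- The positive root of `τ - τ⁻¹ = δ`. -/
noncomputable def tau (δ : ℝ) : ℝ := (δ + √(δ ^ 2 + 4)) / 2

theorem tau_sq (δ : ℝ) : tau δ ^ 2 = δ * tau δ + 1 := by
  have h : √(δ ^ 2 + 4) ^ 2 = δ ^ 2 + 4 := Real.sq_sqrt (by positivity)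
  unfold tau
  nlinarith

theorem tau_pos (δ : ℝ) : 0 < tau δ := by
  have h : |δ| < √(δ ^ 2 + 4) := by
    rw [← Real.sqrt_sq_eq_abs]
    exact Real.sqrt_lt_sqrt (sq_nonneg _) (by linarith)
  have := (abs_lt.1 h).1
  unfold tau
  linarith

theorem one_le_tau {δ : ℝ} (hδ : 0 ≤ δ) : 1 ≤ tau δ := by
  nlinarith [tau_sq δ, mul_nonneg hδ (tau_pos δ).le, tau_pos δ]

theorem one_lt_tau {δ : ℝ} (hδ : 0 < δ) : 1 < tau δ := by
  nlinarith [tau_sq δ, mul_pos hδ (tau_pos δ), tau_pos δ]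

theorem le_tau (δ : ℝ) : δ ≤ tau δ := by
  nlinarith [tau_sq δ, tau_pos δ]

theorem contDiff_tau (m : ℕ) : ContDiff ℝ m tau := by
  unfold tau
  have h : ∀ δ : ℝ, δ ^ 2 + 4 ≠ 0 := fun δ => by positivity
  have : ContDiff ℝ m (fun δ : ℝ => √(δ ^ 2 + 4)) := ContDiff.sqrt (by fun_prop) h
  fun_prop

/-- Implicit differentiation of `τ - τ⁻¹ = δ` predicts the value: `τ'(1 + τ⁻²) = 1`. -/
theorem hasDerivAt_tau (δ : ℝ) : HasDerivAt tau (tau δ ^ 2 / (tau δ ^ 2 + 1)) δ := by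
  have hs : 0 < √(δ ^ 2 + 4) := Real.sqrt_pos.2 (by positivity)
  have h1 : HasDerivAt (fun δ : ℝ => δ ^ 2 + 4) (2 * δ) δ := by
    simpa using (hasDerivAt_pow 2 δ).add_const (4 : ℝ)
  refine (((hasDerivAt_id δ).add (h1.sqrt (by positivity))).div_const 2).congr_deriv ?_
  have e : √(δ ^ 2 + 4) = 2 * tau δ - δ := by unfold tau; ring
  rw [e] at hs ⊢
  have := tau_sq δ
  field_simp
  nlinarith

/-- The potential of the ray `{s v : s > ρ}` with density `s^(k+1)`, renormalised at infinity. -/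
noncomputable def ballPotential (k : ℕ) (v : EuclideanSpace ℝ (Fin (k + 4))) (ρ : ℝ)
    (x : EuclideanSpace ℝ (Fin (k + 4))) : ℝ :=
  ∫ s in Ioi ρ, (s ^ (k + 1) * fund k x (s • v) - s⁻¹)

/-- The two coefficients solve a linear system: on the sphere the nonconstant part of the normal
derivative is, up to a common power of the distance to the image pole, affine in `⟨x, v⟩`, and both
of its coefficients must vanish. -/
noncomputable def coefA (k : ℕ) (δ : ℝ) : ℝ := (tau δ ^ (k + 2) * (tau δ ^ 2 + 1))⁻¹

noncomputable def coefB (k : ℕ) (δ : ℝ) : ℝ :=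
  δ * (tau δ ^ (k + 3) / ((k + 2) * (tau δ ^ 2 + 1)))

/-- Half of the normalised regular part of the projected bubble. -/
noncomputable def ballSolution (k : ℕ) (v : EuclideanSpace ℝ (Fin (k + 4))) (δ : ℝ)
    (x : EuclideanSpace ℝ (Fin (k + 4))) : ℝ :=
  coefA k δ * ballPotential k v (tau δ ^ 2) x - coefB k δ * fund k x (tau δ ^ 2 • v)

section Ball

variable {k : ℕ} {v x : EuclideanSpace ℝ (Fin (k + 4))} {ρ δ s : ℝ}

theorem ballPotential_neg : ballPotential k v ρ (-x) = ballPotential k (-v) ρ x := by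
  simp only [ballPotential, fund_neg, smul_neg]

theorem ballSolution_neg : ballSolution k v δ (-x) = ballSolution k (-v) δ x := by
  simp only [ballSolution, ballPotential_neg, fund_neg, smul_neg]

theorem norm_sub_smul_ge (hv : ‖v‖ = 1) (hs : 0 ≤ s) : s - ‖x‖ ≤ ‖x - s • v‖ := by
  have := norm_sub_norm_le (s • v) x
  rw [norm_smul, hv, Real.norm_of_nonneg hs, mul_one, norm_sub_rev] at this
  exact this

/-- Points this close to `x` have norm at most `(1 + ρ)/2`. The factor `(ρ-1)/(2ρ)` is the ratio of
`s - (1+ρ)/2` to `s` at `s = ρ`, and this ratio increases with `s`. -/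
theorem ball_lower_bound (hv : ‖v‖ = 1) (hx : ‖x‖ ≤ 1) (hρ : 1 < ρ) :
    ∀ z, ‖z - x‖ < (ρ - 1) / 2 → ∀ s : ℝ, ρ < s → (ρ - 1) / (2 * ρ) * s ≤ ‖z - s • v‖ := by
  intro z hz s hs
  have h0 := norm_sub_smul_ge (x := z) (s := s) hv (by linarith)
  have h1 : ‖z‖ ≤ (1 + ρ) / 2 := by
    have := norm_le_norm_add_norm_sub x z
    rw [norm_sub_rev] at this
    linarith
  refine le_trans ?_ (h0.trans' (by linarith : s - (1 + ρ) / 2 ≤ s - ‖z‖))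
  rw [div_mul_eq_mul_div, div_le_iff₀ (by linarith)]
  nlinarith

/-- With `g = |x - sv|` the integrand is `(s^{k+2} - g^{k+2}) / (s g^{k+2})`. Since `|s - g| ≤ |x|`
and `g ≤ 2s`, the counterterm gains a factor `|x|/s`. -/
theorem abs_ball_integrand_le (hv : ‖v‖ = 1) (hs : 0 < s) (hx : ‖x‖ ≤ s) (hne : 0 < ‖x - s • v‖) :
    |s ^ (k + 1) * fund k x (s • v) - s⁻¹| ≤
      (k + 2) * 2 ^ (k + 1) * ‖x‖ * (s ^ k * fund k x (s • v)) := by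
  have h1 : ‖s • v‖ = s := by rw [norm_smul, hv, Real.norm_of_nonneg hs.le, mul_one]
  have h2 : |s - ‖x - s • v‖| ≤ ‖x‖ := by
    have := abs_norm_sub_norm_le (s • v) (s • v - x)
    rw [h1, norm_sub_rev (s • v) x] at this
    simpa using this
  have h3 : ‖x - s • v‖ ≤ 2 * s := by
    have := norm_sub_le x (s • v)
    linarith
  set g := ‖x - s • v‖ with hg
  have h4 := abs_pow_sub_pow_le s g (k + 2)
  rw [abs_of_pos hs, abs_of_pos hne, show k + 2 - 1 = k + 1 by omega] at h4
  have h5 : |s ^ (k + 2) - g ^ (k + 2)| ≤ ‖x‖ * ((k : ℝ) + 2) * (2 * s) ^ (k + 1) := by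
    refine h4.trans ?_
    push_cast
    gcongr
    exact max_le (by linarith) h3
  have h6 : s ^ (k + 1) * fund k x (s • v) - s⁻¹ =
      (s ^ (k + 2) - g ^ (k + 2)) * (s⁻¹ * (g ^ (k + 2))⁻¹) := by
    rw [fund, ← hg]
    field_simp
    ring
  rw [h6, abs_mul, abs_of_pos (by positivity : 0 < s⁻¹ * (g ^ (k + 2))⁻¹), fund, ← hg]
  calc _ ≤ ‖x‖ * ((k : ℝ) + 2) * (2 * s) ^ (k + 1) * (s⁻¹ * (g ^ (k + 2))⁻¹) := by gcongr
    _ = _ := by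
      field_simp
      ring

theorem ball_bound (hv : ‖v‖ = 1) (hx : ‖x‖ ≤ 1) (hρ : 1 < ρ) :
    ∀ z, ‖z - x‖ < (ρ - 1) / 2 → ∀ s : ℝ, ρ < s →
      |s ^ (k + 1) * fund k z (s • v) - s⁻¹| ≤
        ((k + 2) * 2 ^ (k + 1) * ρ * (((ρ - 1) / (2 * ρ)) ^ (k + 2))⁻¹) * (s ^ 2)⁻¹ := by
  intro z hz s hs
  have h0 := ball_lower_bound hv hx hρ z hz s hs
  have h1 : ‖z‖ ≤ ρ := by
    have := norm_le_norm_add_norm_sub x z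
    rw [norm_sub_rev] at this
    linarith
  have hs0 : 0 < s := by linarith
  have hc : 0 < (ρ - 1) / (2 * ρ) := div_pos (by linarith) (by linarith)
  refine (abs_ball_integrand_le hv hs0 (by linarith) (lt_of_lt_of_le (by positivity) h0)).trans ?_
  calc _ ≤ (k + 2) * 2 ^ (k + 1) * ρ * (s ^ k * (((ρ - 1) / (2 * ρ) * s) ^ (k + 2))⁻¹) := by
        unfold fund
        gcongr
    _ = _ := by
        rw [mul_pow _ s, mul_inv]
        field_simp
        ring

theorem continuousOn_pow_Ioi (m : ℕ) : ContinuousOn (fun s : ℝ => s ^ m) (Ioi ρ) := by fun_prop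

theorem continuousOn_inv_Ioi (hρ : 0 < ρ) : ContinuousOn (fun s : ℝ => s⁻¹) (Ioi ρ) :=
  continuousOn_id.inv₀ fun _ hs => (hρ.trans hs).ne'

theorem continuousAt_ballPotential (hv : ‖v‖ = 1) (hx : ‖x‖ ≤ 1) (hρ : 1 < ρ) :
    ContinuousAt (ballPotential k v ρ) x :=
  continuousAt_potential (by linarith) (div_pos (by linarith) (by linarith)) (by linarith)
    (continuousOn_pow_Ioi _) (continuousOn_inv_Ioi (by linarith)) (ball_lower_bound hv hx hρ)
    (ball_bound hv hx hρ)

theorem hasLineLaplacian_ballPotential (hv : ‖v‖ = 1) (hx : ‖x‖ ≤ 1) (hρ : 1 < ρ) :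
    HasLineLaplacian (ballPotential k v ρ) x 0 :=
  hasLineLaplacian_potential (by linarith) (div_pos (by linarith) (by linarith)) (by linarith)
    (continuousOn_pow_Ioi _) (continuousOn_inv_Ioi (by linarith))
    (fun s hs => by
      have : 0 < s := by linarith
      rw [abs_of_pos (by positivity)])
    (ball_lower_bound hv hx hρ) (ball_bound hv hx hρ)

theorem norm_sub_smul_pos (hv : ‖v‖ = 1) (hx : ‖x‖ ≤ 1) (hρ : 1 < ρ) : 0 < ‖x - ρ • v‖ :=
  lt_of_lt_of_le (by linarith) (norm_sub_smul_ge hv (by linarith))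

theorem continuousOn_ball_integrand (hv : ‖v‖ = 1) (hx : ‖x‖ ≤ 1) (hρ : 1 < ρ) :
    ContinuousOn (fun s : ℝ => s ^ (k + 1) * fund k x (s • v) - s⁻¹) (Ioi ρ) :=
  continuousOn_potential_integrand (by linarith) (div_pos (by linarith) (by linarith))
    (continuousOn_pow_Ioi _) (continuousOn_inv_Ioi (by linarith))
    (ball_lower_bound hv hx hρ x (by simpa using hρ))

theorem integrableOn_ball_integrand (hv : ‖v‖ = 1) (hx : ‖x‖ ≤ 1) (hρ : 1 < ρ) :
    IntegrableOn (fun s : ℝ => s ^ (k + 1) * fund k x (s • v) - s⁻¹) (Ioi ρ) :=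
  integrableOn_Ioi_of_le_inv_sq (by linarith) (continuousOn_ball_integrand hv hx hρ)
    (ball_bound hv hx hρ x (by simpa using hρ))

theorem hasDerivAt_ballPotential (hv : ‖v‖ = 1) (hx : ‖x‖ ≤ 1) (hρ : 1 < ρ) :
    HasDerivAt (fun ρ => ballPotential k v ρ x)
      (-(ρ ^ (k + 1) * fund k x (ρ • v) - ρ⁻¹)) ρ := by
  have h1 : 1 < (1 + ρ) / 2 := by linarith
  have h2 : (1 + ρ) / 2 < ρ := by linarith
  exact hasDerivAt_integral_Ioi_left h2 (integrableOn_ball_integrand hv hx h1)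
    ((continuousOn_ball_integrand hv hx h1).continuousAt (Ioi_mem_nhds h2))

/-- The density `s^{k+1}` is the one for which `s^{k+1} Γ(x, sv) ds` and `ds/s` are both invariant
under simultaneous dilation of `x` and `s`. -/
theorem ballPotential_smul {l : ℝ} (hl : 0 < l) (hρ : 0 < ρ) :
    ballPotential k v ρ (l • x) = ballPotential k v (ρ / l) x := by
  unfold ballPotential
  have h := integral_comp_mul_left_Ioi'
    (fun s : ℝ => s ^ (k + 1) * fund k (l • x) (s • v) - s⁻¹) (ρ / l) hl
  rw [mul_div_cancel₀ _ hl.ne'] at h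
  rw [← h, smul_eq_mul, ← integral_const_mul]
  refine setIntegral_congr_fun measurableSet_Ioi fun s hs => ?_
  have hs0 : 0 < s := (div_pos hρ hl).trans hs
  have h1 : ‖l • x - (l * s) • v‖ = l * ‖x - s • v‖ := by
    rw [mul_smul, ← smul_sub, norm_smul, Real.norm_of_nonneg hl.le]
  simp only [fund, h1]
  rw [mul_pow, mul_pow, mul_inv, mul_inv]
  field_simp
  ring

/-- By dilation invariance a radial displacement only moves the endpoint to `ρ/l`, whose derivative
at `l = 1` is `-ρ`. -/
theorem hasDerivAt_ballPotential_radial (hv : ‖v‖ = 1) (hx : ‖x‖ ≤ 1) (hρ : 1 < ρ) :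
    HasDerivAt (fun l : ℝ => ballPotential k v ρ (l • x))
      (ρ ^ (k + 2) * fund k x (ρ • v) - 1) 1 := by
  have hρ0 : 0 < ρ := by linarith
  have h1 : HasDerivAt (fun l : ℝ => ρ / l) (-ρ) 1 := by
    have := (hasDerivAt_inv (one_ne_zero (α := ℝ))).const_mul ρ
    simpa [div_eq_mul_inv] using this
  have h2 : HasDerivAt (fun ρ => ballPotential k v ρ x)
      (-(ρ ^ (k + 1) * fund k x (ρ • v) - ρ⁻¹)) (ρ / 1) := by
    simpa using hasDerivAt_ballPotential hv hx hρ
  refine ((h2.comp (1 : ℝ) h1).congr_of_eventuallyEq ?_).congr_deriv ?_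
  · filter_upwards [lt_mem_nhds (zero_lt_one (α := ℝ))] with l hl
    exact ballPotential_smul hl hρ0
  · field_simp
    ring

theorem hasDerivAt_rpow_radial (hv : ‖v‖ = 1) (hx : ‖x‖ = 1) (a p : ℝ)
    (h : 0 < a + (1 - 2 * ρ * inner ℝ x v + ρ ^ 2)) :
    HasDerivAt (fun l : ℝ => (a + ‖l • x - ρ • v‖ ^ 2) ^ p)
      (2 * p * (1 - ρ * inner ℝ x v) * (a + (1 - 2 * ρ * inner ℝ x v + ρ ^ 2)) ^ (p - 1)) 1 := by
  have e : (fun l : ℝ => (a + ‖l • x - ρ • v‖ ^ 2) ^ p) =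
      fun l : ℝ => (a + (l ^ 2 - 2 * ρ * inner ℝ x v * l + ρ ^ 2)) ^ p := by
    ext l
    rw [norm_sub_sq_real, norm_smul, norm_smul, hx, hv, inner_smul_left, inner_smul_right]
    simp only [mul_one, Real.norm_eq_abs, sq_abs, conj_trivial]
    congr 2
    ring
  rw [e]
  have h1 : HasDerivAt (fun l : ℝ => a + (l ^ 2 - 2 * ρ * inner ℝ x v * l + ρ ^ 2))
      (2 - 2 * ρ * inner ℝ x v) 1 := by
    have := ((((hasDerivAt_pow 2 (1 : ℝ)).sub
      ((hasDerivAt_id (1 : ℝ)).const_mul (2 * ρ * inner ℝ x v))).add_const (ρ ^ 2)).const_add a)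
    simpa using this
  have e2 : a + ((1 : ℝ) ^ 2 - 2 * ρ * inner ℝ x v * 1 + ρ ^ 2) =
    a + (1 - 2 * ρ * inner ℝ x v + ρ ^ 2) := by ring
  refine (h1.rpow_const (p := p) (Or.inl (by rw [e2]; exact h.ne'))).congr_deriv ?_
  rw [e2]
  ring

/-- The bubble without its constants. -/
noncomputable def unitBubble (k : ℕ) (v : EuclideanSpace ℝ (Fin (k + 4))) (δ : ℝ)
    (x : EuclideanSpace ℝ (Fin (k + 4))) : ℝ :=
  (δ ^ 2 + ‖x - v‖ ^ 2) ^ (-((k : ℝ) + 2) / 2)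

theorem norm_sub_smul_sq (hv : ‖v‖ = 1) (hx : ‖x‖ = 1) :
    ‖x - ρ • v‖ ^ 2 = 1 - 2 * ρ * inner ℝ x v + ρ ^ 2 := by
  rw [norm_sub_sq_real, norm_smul, hx, hv, inner_smul_right]
  simp only [mul_one, Real.norm_eq_abs, sq_abs]
  ring

/-- The bubble corrected by the ball solution has constant normal derivative on the sphere. -/
theorem hasDerivAt_projected_radial (hv : ‖v‖ = 1) (hx : ‖x‖ = 1) (hδ : 0 < δ) :
    HasDerivAt (fun l : ℝ => unitBubble k v δ (l • x) + (k + 2) * ballSolution k v δ (l • x))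
      (-((k + 2) * coefA k δ)) 1 := by
  have ht := tau_pos δ
  have hsq := tau_sq δ
  set τ := tau δ with hτ
  have hρ : 1 < τ ^ 2 := by rw [hsq]; nlinarith
  set c : ℝ := inner ℝ x v with hc
  have hD := norm_sub_smul_sq (ρ := τ ^ 2) hv hx
  have hDpos : 0 < 1 - 2 * τ ^ 2 * c + (τ ^ 2) ^ 2 := by
    rw [← hD]
    have := norm_sub_smul_pos hv hx.le hρ
    positivity
  set D : ℝ := 1 - 2 * τ ^ 2 * c + (τ ^ 2) ^ 2 with hDdef
  -- This identity dictates the choice of `τ`: on the sphere the bubble's denominator is the squared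
  -- distance to the image pole `τ² v`, up to the factor `τ²`.
  have hS : δ ^ 2 + (1 - 2 * 1 * c + 1 ^ 2) = D / τ ^ 2 := by
    have : δ = (τ ^ 2 - 1) / τ := by rw [hsq]; field_simp; ring
    rw [this, hDdef]
    field_simp
    ring
  have hSpos : 0 < δ ^ 2 + (1 - 2 * 1 * c + 1 ^ 2) := by rw [hS]; positivity
  set T : ℝ := D ^ (-((k : ℝ) + 2) / 2 - 1) with hT
  have hST : (δ ^ 2 + (1 - 2 * 1 * c + 1 ^ 2)) ^ (-((k : ℝ) + 2) / 2 - 1) = τ ^ (k + 4) * T := by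
    rw [hS, Real.div_rpow hDpos.le (by positivity), ← hT, div_eq_mul_inv, mul_comm]
    congr 1
    rw [← Real.rpow_neg (by positivity), ← Real.rpow_natCast τ 2, ← Real.rpow_mul ht.le,
      ← Real.rpow_natCast]
    congr 1
    push_cast
    ring
  have h1 := hasDerivAt_rpow_radial (ρ := 1) hv hx (δ ^ 2) (-((k : ℝ) + 2) / 2) hSpos
  rw [← hc, hST] at h1
  simp only [one_smul] at h1
  have h2 := hasDerivAt_rpow_radial (ρ := τ ^ 2) hv hx 0 (-((k : ℝ) + 2) / 2)
    (by rw [zero_add]; exact hDpos)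
  simp only [← fund_eq_rpow] at h2
  rw [← hc, ← hDdef, zero_add, ← hT] at h2
  have h3 := hasDerivAt_ballPotential_radial (k := k) hv hx.le hρ
  have hG : fund k x (τ ^ 2 • v) = D * T := by
    rw [fund_eq_rpow, hD, zero_add, hT, mul_comm, ← Real.rpow_add_one hDpos.ne']
    congr 1
    ring
  rw [hG] at h3
  refine (h1.add (((h3.const_mul (coefA k δ)).sub (h2.const_mul (coefB k δ))).const_mul
    ((k : ℝ) + 2))).congr_deriv ?_
  have hk : (k : ℝ) + 2 ≠ 0 := by positivity
  have ha : coefA k δ * (τ ^ 2) ^ (k + 2) = τ ^ (k + 2) / (τ ^ 2 + 1) := by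
    rw [coefA, ← hτ]
    field_simp
    ring
  have hb : coefB k δ * (k + 2) = τ ^ (k + 2) * (τ ^ 2 - 1) / (τ ^ 2 + 1) := by
    rw [coefB, ← hτ, show τ ^ 2 - 1 = δ * τ by rw [hsq]; ring]
    field_simp
    ring
  -- The multiple of `T` isolated here vanishes identically in `c` once the values of the
  -- coefficients and `D` are inserted, leaving only the constant.
  have e : 2 * (-((k : ℝ) + 2) / 2) * (1 - 1 * c) * (τ ^ (k + 4) * T) +
      (k + 2) * (coefA k δ * ((τ ^ 2) ^ (k + 2) * (D * T) - 1) -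
        coefB k δ * (2 * (-((k : ℝ) + 2) / 2) * (1 - τ ^ 2 * c) * T)) =
      (k + 2) * (-(1 - c) * (τ ^ (k + 4) * T) + (coefA k δ * (τ ^ 2) ^ (k + 2)) * (D * T)
        + coefB k δ * (k + 2) * ((1 - τ ^ 2 * c) * T)) - (k + 2) * coefA k δ := by ring
  rw [e, ha, hb, hDdef]
  have : τ ^ 2 + 1 ≠ 0 := by positivity
  field_simp
  ring

theorem hasLineLaplacian_ballSolution (hv : ‖v‖ = 1) (hx : ‖x‖ ≤ 1) (hδ : 0 < δ) :
    HasLineLaplacian (ballSolution k v δ) x 0 := by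
  have hρ : 1 < tau δ ^ 2 := one_lt_pow₀ (one_lt_tau hδ) two_ne_zero
  have hne : x ≠ tau δ ^ 2 • v := by
    have := norm_sub_smul_pos hv hx hρ
    intro h
    rw [← h] at this
    simp at this
  exact (((hasLineLaplacian_ballPotential hv hx hρ).const_mul _).sub
    ((hasLineLaplacian_fund k x _ hne).const_mul _)).congr_val (by simp)

theorem continuousAt_ballSolution (hv : ‖v‖ = 1) (hx : ‖x‖ ≤ 1) (hδ : 0 < δ) :
    ContinuousAt (ballSolution k v δ) x := by
  have hρ : 1 < tau δ ^ 2 := one_lt_pow₀ (one_lt_tau hδ) two_ne_zero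
  exact ((continuousAt_ballPotential hv hx hρ).const_mul _).sub
    ((continuousAt_fund (norm_sub_smul_pos hv hx hρ)).const_mul _)

theorem continuous_unitBubble (hδ : 0 < δ) : Continuous (unitBubble k v δ) := by
  unfold unitBubble
  exact Continuous.rpow_const (by fun_prop) fun z => Or.inl (by positivity)

theorem hasLineLaplacian_unitBubble (hδ : 0 < δ) : HasLineLaplacian (unitBubble k v δ) x
    (-((k + 2) * (k + 4) * δ ^ 2 * (δ ^ 2 + ‖x - v‖ ^ 2) ^ (-((k : ℝ) + 6) / 2))) := by
  refine (hasLineLaplacian_rpow (δ ^ 2) (-((k : ℝ) + 2) / 2) x v (by positivity)).congr_val ?_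
  rw [show -((k : ℝ) + 2) / 2 - 2 = -((k : ℝ) + 6) / 2 by ring]
  push_cast
  ring

theorem unitBubble_neg : unitBubble k v δ (-x) = unitBubble k (-v) δ x := by
  unfold unitBubble
  rw [show -x - v = -(x - -v) by abel, norm_neg]

theorem bubble_eq (hδ : 0 < δ) : bubble (k + 4) δ v x =
    alpha (k + 4) * δ ^ (((k : ℝ) + 2) / 2) * unitBubble k v δ x := by
  have : ((k + 4 : ℕ) : ℝ) - 2 = k + 2 := by push_cast; ring
  rw [bubble, this, unitBubble, neg_div, Real.rpow_neg (by positivity), div_eq_mul_inv, mul_assoc]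

theorem alpha_pos : 0 < alpha (k + 4) := by
  unfold alpha
  have : (0 : ℝ) < ((k + 4 : ℕ) : ℝ) - 2 := by push_cast; linarith [k.cast_nonneg (α := ℝ)]
  positivity

/-- The normalisation of `α_n` enters only here: `α_n^{p-1} = n(n-2)`, which turns the Laplacian of
the bubble into its `p`-th power. -/
theorem bubble_rpow (hδ : 0 < δ) :
    bubble (k + 4) δ v x ^ ((((k + 4 : ℕ) : ℝ) + 2) / (((k + 4 : ℕ) : ℝ) - 2)) =
    alpha (k + 4) * δ ^ (((k : ℝ) + 2) / 2) *
      ((k + 2) * (k + 4) * δ ^ 2 * (δ ^ 2 + ‖x - v‖ ^ 2) ^ (-((k : ℝ) + 6) / 2)) := by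
  have hk : (k : ℝ) + 2 ≠ 0 := by positivity
  have e : (((k + 4 : ℕ) : ℝ) + 2) / (((k + 4 : ℕ) : ℝ) - 2) = (k + 6) / (k + 2) := by
    push_cast
    congr 1 <;> ring
  have hS : 0 < δ ^ 2 + ‖x - v‖ ^ 2 := by positivity
  have hα := alpha_pos (k := k)
  rw [bubble_eq hδ, unitBubble, e, Real.mul_rpow (by positivity) (by positivity),
    Real.mul_rpow (by positivity) (by positivity), ← Real.rpow_mul hδ.le, ← Real.rpow_mul hS.le]
  have h1 : ((k : ℝ) + 2) / 2 * ((k + 6) / (k + 2)) = (k + 2) / 2 + 2 := by field_simp; ring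
  have h2 : -((k : ℝ) + 2) / 2 * ((k + 6) / (k + 2)) = -((k : ℝ) + 6) / 2 := by field_simp
  have h3 : alpha (k + 4) ^ (((k : ℝ) + 6) / (k + 2)) = alpha (k + 4) * ((k + 4) * (k + 2)) := by
    have hb : (0 : ℝ) < (k + 4) * (k + 2) := by positivity
    have hab : alpha (k + 4) = ((k + 4) * (k + 2) : ℝ) ^ (((k : ℝ) + 2) / 4) := by
      unfold alpha
      push_cast
      congr 1 <;> ring
    rw [hab, ← Real.rpow_mul hb.le, ← Real.rpow_add_one hb.ne']
    congr 1
    field_simp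
    ring
  rw [h1, h2, h3, Real.rpow_add hδ, Real.rpow_two]
  ring

end Ball

/-- Integrals of odd functions over a centred ball vanish. -/
theorem integral_ball_eq_zero_of_odd {n : ℕ} {f : EuclideanSpace ℝ (Fin n) → ℝ}
    (hf : ∀ x, f (-x) = -f x) : ∫ x in Metric.ball (0 : EuclideanSpace ℝ (Fin n)) 1, f x = 0 := by
  have h := (Measure.measurePreserving_neg (volume : Measure (EuclideanSpace ℝ (Fin n)))).setIntegral_preimage_emb
    (MeasurableEquiv.neg (EuclideanSpace ℝ (Fin n))).measurableEmbedding f (Metric.ball 0 1)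
  have hb : Neg.neg ⁻¹' Metric.ball (0 : EuclideanSpace ℝ (Fin n)) 1 = Metric.ball 0 1 := by
    ext x
    simp
  rw [hb] at h
  simp only [hf, integral_neg] at h
  linarith

/-- The explicit form of the projected bubble. -/
theorem IsPW.sub_W_eq {k : ℕ} {δ : ℝ} {u : EuclideanSpace ℝ (Fin (k + 4)) → ℝ} (hδ : 0 < δ)
    (hu : IsPW (k + 4) δ u) {x : EuclideanSpace ℝ (Fin (k + 4))} (hx : ‖x‖ ≤ 1) :
    u x - W (k + 4) δ x = alpha (k + 4) * δ ^ (((k : ℝ) + 2) / 2) * ((k + 2) *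
      (ballSolution k (eN (k + 4)) δ x - ballSolution k (eN (k + 4)) δ (-x))) := by
  set e := eN (k + 4) with he
  have hv : ‖e‖ = 1 := norm_eN (by omega)
  have hv' : ‖-e‖ = 1 := by rw [norm_neg, hv]
  set A : ℝ := alpha (k + 4) * δ ^ (((k : ℝ) + 2) / 2) with hA
  set R : EuclideanSpace ℝ (Fin (k + 4)) → EuclideanSpace ℝ (Fin (k + 4)) → ℝ :=
    fun v z => unitBubble k v δ z + (k + 2) * ballSolution k v δ z with hR
  -- The candidate for `PW`. In the antipodal difference the two constant normal derivatives cancel,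
  -- and the result is odd.
  set V : EuclideanSpace ℝ (Fin (k + 4)) → ℝ := fun z => A * (R e z - R (-e) z) with hV
  have hVW : ∀ z, V z = W (k + 4) δ z + A * ((k + 2) *
      (ballSolution k e δ z - ballSolution k e δ (-z))) := by
    intro z
    simp only [hV, hR, W, ← he]
    rw [bubble_eq hδ, bubble_eq hδ, ballSolution_neg]
    ring
  have hcR : ∀ v, ‖v‖ = 1 → ∀ z, ‖z‖ ≤ 1 → ContinuousAt (R v) z := fun v hv z hz =>
    (continuous_unitBubble hδ).continuousAt.add
      ((continuousAt_ballSolution hv hz hδ).const_mul _)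
  have hcV : ContinuousOn V (Metric.closedBall 0 1) := fun z hz => by
    have hz' : ‖z‖ ≤ 1 := by simpa using hz
    exact (((hcR e hv z hz').sub (hcR (-e) hv' z hz')).const_mul A).continuousWithinAt
  have hcv : ContinuousOn (fun z => u z - V z) (Metric.closedBall 0 1) := hu.continuousOn.sub hcV
  have hRl : ∀ v, ‖v‖ = 1 → ∀ z, ‖z‖ ≤ 1 → HasLineLaplacian (R v) z
      (-((k + 2) * (k + 4) * δ ^ 2 * (δ ^ 2 + ‖z - v‖ ^ 2) ^ (-((k : ℝ) + 6) / 2)) +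
        (k + 2) * 0) := fun v hv z hz =>
    (hasLineLaplacian_unitBubble hδ).add ((hasLineLaplacian_ballSolution hv hz hδ).const_mul _)
  have hconst : ∀ z : EuclideanSpace ℝ (Fin (k + 4)), ‖z‖ ≤ 1 → u z - V z = u 0 - V 0 := by
    intro z hz
    refine ball_neumann_eq_const (v := fun z => u z - V z) (by omega) hcv (fun y hy => ?_)
      (fun y hy => ?_) hz
    · have hy' : ‖y‖ ≤ 1 := by simpa using (Metric.ball_subset_closedBall hy)
      have h1 := HasLineLaplacian.of_contDiffAt
        (hu.contDiffOn.contDiffAt (Metric.isOpen_ball.mem_nhds hy))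
      refine (h1.sub (((hRl e hv y hy').sub (hRl (-e) hv' y hy')).const_mul A)).congr_val ?_
      have h2 := hu.equation y hy
      rw [bubble_rpow hδ, bubble_rpow hδ, ← hA, ← he] at h2
      linarith
    · have hy' : ‖y‖ = 1 := by simpa using hy
      exact ((hu.neumann y hy).sub (((hasDerivAt_projected_radial hv hy' hδ).sub
        (hasDerivAt_projected_radial hv' hy' hδ)).const_mul A).hasDerivWithinAt).congr_deriv
          (by simp)
  have hVint : ∫ z in Metric.ball (0 : EuclideanSpace ℝ (Fin (k + 4))) 1, V z = 0 := by
    refine integral_ball_eq_zero_of_odd fun z => ?_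
    simp only [hV, hR, unitBubble_neg, ballSolution_neg, neg_neg]
    ring
  have hint : ∀ f : EuclideanSpace ℝ (Fin (k + 4)) → ℝ, ContinuousOn f (Metric.closedBall 0 1) →
      IntegrableOn f (Metric.ball 0 1) := fun f hf =>
    (hf.integrableOn_compact (isCompact_closedBall _ _)).mono_set Metric.ball_subset_closedBall
  -- The difference `u - V` is constant and both functions have mean zero, `V` by oddness; as the
  -- ball has positive finite measure, the constant is `0`.
  have hzero : u 0 - V 0 = 0 := by
    have h1 : ∫ z in Metric.ball (0 : EuclideanSpace ℝ (Fin (k + 4))) 1, (u z - V z) = 0 := by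
      rw [integral_sub (hint u hu.continuousOn) (hint V hcV), hu.mean_zero, hVint, sub_zero]
    have h2 : ∫ z in Metric.ball (0 : EuclideanSpace ℝ (Fin (k + 4))) 1, (u z - V z) =
        ∫ z in Metric.ball (0 : EuclideanSpace ℝ (Fin (k + 4))) 1, (u 0 - V 0) :=
      setIntegral_congr_fun Metric.isOpen_ball.measurableSet fun z hz =>
        hconst z (by simpa using Metric.ball_subset_closedBall hz)
    rw [h1, setIntegral_const, smul_eq_mul, eq_comm, mul_eq_zero] at h2
    refine h2.resolve_left ?_
    have := Metric.measure_ball_pos volume (0 : EuclideanSpace ℝ (Fin (k + 4))) one_pos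
    exact (ENNReal.toReal_pos this.ne' measure_ball_lt_top.ne).ne'
  have h3 := hconst x hx
  rw [hzero, hVW x] at h3
  linarith

/-! ### Calculus of bounds in the parameter -/

/-- For parameters `δ ∈ S`, uniformly for `x` in the closed unit ball, the function `f` is
differentiable in `δ`, and `f` and `δ ∂_δ f` are bounded by a constant times `N`. -/
def ParamBound {E : Type*} [NormedAddCommGroup E] (S : Set ℝ) (f N : ℝ → E → ℝ) : Prop :=
  ∃ C, 0 ≤ C ∧ ∀ δ ∈ S, ∀ x : E, ‖x‖ ≤ 1 → ∃ d, HasDerivAt (fun s => f s x) d δ ∧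
    |f δ x| ≤ C * N δ x ∧ |δ * d| ≤ C * N δ x

namespace ParamBound

variable {E : Type*} [NormedAddCommGroup E] {S S' : Set ℝ} {f g N M : ℝ → E → ℝ}

theorem mono (hf : ParamBound S f N) (c : ℝ) (hS : S' ⊆ S)
    (h : ∀ δ ∈ S', ∀ x : E, ‖x‖ ≤ 1 → N δ x ≤ c * M δ x) (hM : ∀ δ ∈ S', ∀ x : E, ‖x‖ ≤ 1 → 0 ≤ M δ x) :
    ParamBound S' f M := by
  obtain ⟨C, hC, H⟩ := hf
  refine ⟨C * |c|, by positivity, fun δ hδ x hx => ?_⟩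
  obtain ⟨d, h1, h2, h3⟩ := H δ (hS hδ) x hx
  have h4 : C * N δ x ≤ C * |c| * M δ x := by
    rw [mul_assoc]
    refine mul_le_mul_of_nonneg_left ((h δ hδ x hx).trans ?_) hC
    exact mul_le_mul_of_nonneg_right (le_abs_self c) (hM δ hδ x hx)
  exact ⟨d, h1, h2.trans h4, h3.trans h4⟩

theorem mono_set (hf : ParamBound S f N) (hS : S' ⊆ S) : ParamBound S' f N := by
  obtain ⟨C, hC, H⟩ := hf
  exact ⟨C, hC, fun δ hδ => H δ (hS hδ)⟩

theorem add (hf : ParamBound S f N) (hg : ParamBound S g N) :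
    ParamBound S (fun δ x => f δ x + g δ x) N := by
  obtain ⟨C, hC, H⟩ := hf
  obtain ⟨C', hC', H'⟩ := hg
  refine ⟨C + C', by positivity, fun δ hδ x hx => ?_⟩
  obtain ⟨d, h1, h2, h3⟩ := H δ hδ x hx
  obtain ⟨d', h1', h2', h3'⟩ := H' δ hδ x hx
  refine ⟨d + d', h1.add h1', ?_, ?_⟩
  · rw [add_mul]
    exact (abs_add_le _ _).trans (add_le_add h2 h2')
  · rw [add_mul, mul_add]
    exact (abs_add_le _ _).trans (add_le_add h3 h3')

theorem const_mul (hf : ParamBound S f N) (c : ℝ) : ParamBound S (fun δ x => c * f δ x) N := by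
  obtain ⟨C, hC, H⟩ := hf
  refine ⟨|c| * C, by positivity, fun δ hδ x hx => ?_⟩
  obtain ⟨d, h1, h2, h3⟩ := H δ hδ x hx
  refine ⟨c * d, h1.const_mul c, ?_, ?_⟩
  · rw [abs_mul, mul_assoc]
    gcongr
  · rw [mul_left_comm, abs_mul, mul_assoc]
    gcongr

theorem sub (hf : ParamBound S f N) (hg : ParamBound S g N) :
    ParamBound S (fun δ x => f δ x - g δ x) N := by
  simpa [sub_eq_add_neg] using hf.add (hg.const_mul (-1))

theorem mul (hf : ParamBound S f N) (hg : ParamBound S g M) :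
    ParamBound S (fun δ x => f δ x * g δ x) (fun δ x => N δ x * M δ x) := by
  obtain ⟨C, hC, H⟩ := hf
  obtain ⟨C', hC', H'⟩ := hg
  refine ⟨2 * (C * C'), by positivity, fun δ hδ x hx => ?_⟩
  obtain ⟨d, h1, h2, h3⟩ := H δ hδ x hx
  obtain ⟨d', h1', h2', h3'⟩ := H' δ hδ x hx
  have h4 : ∀ a b : ℝ, |a| ≤ C * N δ x → |b| ≤ C' * M δ x →
      |a * b| ≤ C * C' * (N δ x * M δ x) := by
    intro a b ha hb
    rw [abs_mul, mul_mul_mul_comm]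
    exact mul_le_mul ha hb (abs_nonneg _) ((abs_nonneg _).trans ha)
  have h5 := h4 _ _ h2 h2'
  refine ⟨d * g δ x + f δ x * d', h1.mul h1', ?_, ?_⟩
  · have := (abs_nonneg _).trans h5
    linarith
  · rw [show δ * (d * g δ x + f δ x * d') = δ * d * g δ x + f δ x * (δ * d') by ring]
    have := (abs_add_le _ _).trans (add_le_add (h4 _ _ h3 h2') (h4 _ _ h2 h3'))
    linarith

/-- Since `δ ∂_δ(1/f) = -(δ ∂_δ f)/f²`, a bound of `f` from below by a multiple of `N` is needed
besides the upper bounds. -/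
theorem inv (hf : ParamBound S f N) {c : ℝ} (hc : 0 < c) (hN : ∀ δ ∈ S, ∀ x : E, ‖x‖ ≤ 1 → 0 < N δ x)
    (hfN : ∀ δ ∈ S, ∀ x : E, ‖x‖ ≤ 1 → c * N δ x ≤ f δ x) :
    ParamBound S (fun δ x => (f δ x)⁻¹) (fun δ x => (N δ x)⁻¹) := by
  obtain ⟨C, hC, H⟩ := hf
  refine ⟨c⁻¹ + C * (c⁻¹) ^ 2, by positivity, fun δ hδ x hx => ?_⟩
  obtain ⟨d, h1, h2, h3⟩ := H δ hδ x hx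
  have hNp := hN δ hδ x hx
  have hfp : 0 < f δ x := lt_of_lt_of_le (by positivity) (hfN δ hδ x hx)
  have hle : (f δ x)⁻¹ ≤ c⁻¹ * (N δ x)⁻¹ := by
    rw [← mul_inv]
    have := hfN δ hδ x hx
    gcongr
  refine ⟨_, h1.inv hfp.ne', ?_, ?_⟩
  · rw [abs_of_pos (by positivity), add_mul]
    have : 0 ≤ C * (c⁻¹) ^ 2 * (N δ x)⁻¹ := by positivity
    linarith
  · have e : δ * (-d / f δ x ^ 2) = -(δ * d * ((f δ x)⁻¹) ^ 2) := by
      field_simp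
    rw [e, abs_neg, abs_mul, abs_of_nonneg (sq_nonneg (f δ x)⁻¹), add_mul]
    have h4 : |δ * d| * ((f δ x)⁻¹) ^ 2 ≤ C * N δ x * (c⁻¹ * (N δ x)⁻¹) ^ 2 := by
      gcongr
    have h5 : C * N δ x * (c⁻¹ * (N δ x)⁻¹) ^ 2 = C * (c⁻¹) ^ 2 * (N δ x)⁻¹ := by
      field_simp
    have h6 : 0 ≤ c⁻¹ * (N δ x)⁻¹ := by positivity
    linarith

theorem const (c : ℝ) : ParamBound S (fun _ (_ : E) => c) (fun _ _ => 1) :=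
  ⟨|c|, abs_nonneg _, fun δ _ x _ => ⟨0, hasDerivAt_const δ c, by simp, by simp⟩⟩

theorem pow (hf : ParamBound S f N) (m : ℕ) :
    ParamBound S (fun δ x => f δ x ^ m) (fun δ x => N δ x ^ m) := by
  induction m with
  | zero => simpa using const (E := E) (S := S) 1
  | succ m ih => simpa only [pow_succ] using ih.mul hf

theorem id : ParamBound (Ioi 0) (fun δ (_ : E) => δ) (fun δ _ => δ) :=
  ⟨1, zero_le_one, fun δ hδ x _ => ⟨1, hasDerivAt_id δ, by
    have : 0 < δ := hδ
    rw [abs_of_pos this]; simp, by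
    have : 0 < δ := hδ
    rw [mul_one, abs_of_pos this]; simp⟩⟩

theorem rpow (p : ℝ) : ParamBound (Ioi 0) (fun δ (_ : E) => δ ^ p) (fun δ _ => δ ^ p) := by
  refine ⟨1 + |p|, by positivity, fun δ hδ x _ => ?_⟩
  have hδ' : 0 < δ := hδ
  have h0 : 0 < δ ^ p := by positivity
  refine ⟨_, Real.hasDerivAt_rpow_const (Or.inl hδ'.ne'), ?_, ?_⟩
  · rw [abs_of_pos h0]
    nlinarith [abs_nonneg p]
  · have : δ * (p * δ ^ (p - 1)) = p * δ ^ p := by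
      rw [Real.rpow_sub_one hδ'.ne']
      field_simp
    rw [this, abs_mul, abs_of_pos h0]
    nlinarith [abs_nonneg p]

theorem comp_neg (hf : ParamBound S f N) :
    ParamBound S (fun δ x => f δ (-x)) (fun δ x => N δ (-x)) := by
  obtain ⟨C, hC, H⟩ := hf
  exact ⟨C, hC, fun δ hδ x hx => H δ hδ (-x) (by rwa [norm_neg])⟩

/-- The vanishing at `0` and the mean value inequality bound `h` by a multiple of `δ`; for `δ h'`
the factor `δ` is already present. -/
theorem of_contDiff {h : ℝ → ℝ} (hh : ContDiff ℝ 1 h) (h0 : h 0 = 0) :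
    ParamBound (Ioc 0 1) (fun δ (_ : E) => h δ) (fun δ _ => δ) := by
  have hd : Continuous (deriv h) := hh.continuous_deriv le_rfl
  obtain ⟨C, hC⟩ := (isCompact_Icc (a := (0 : ℝ)) (b := 1)).exists_bound_of_continuousOn
    hd.continuousOn
  have hC0 : 0 ≤ C := (norm_nonneg _).trans (hC 0 (by simp))
  have hdiff : ∀ δ, HasDerivAt h (deriv h δ) δ := fun δ =>
    (hh.differentiable one_ne_zero δ).hasDerivAt
  refine ⟨C, hC0, fun δ hδ x _ => ⟨deriv h δ, hdiff δ, ?_, ?_⟩⟩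
  · have := (convex_Icc (0 : ℝ) 1).norm_image_sub_le_of_norm_hasDerivWithin_le
      (fun t _ => (hdiff t).hasDerivWithinAt) hC (left_mem_Icc.2 zero_le_one)
      (Ioc_subset_Icc_self hδ)
    rw [h0, sub_zero, sub_zero, Real.norm_eq_abs, Real.norm_eq_abs, abs_of_pos hδ.1] at this
    exact this
  · rw [abs_mul, abs_of_pos hδ.1, mul_comm]
    exact mul_le_mul_of_nonneg_right (hC δ (Ioc_subset_Icc_self hδ)) hδ.1.le

end ParamBound

/-! ### Size and limits of the coefficients -/

section Coefficients

variable {E : Type*} [NormedAddCommGroup E]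

theorem paramBound_tau : ParamBound (Ioi 0) (fun δ (_ : E) => tau δ) (fun δ _ => tau δ) := by
  refine ⟨1, zero_le_one, fun δ hδ x _ => ⟨_, hasDerivAt_tau δ, ?_, ?_⟩⟩
  · rw [abs_of_pos (tau_pos δ), one_mul]
  · have h0 : 0 < δ := hδ
    have h1 := tau_pos δ
    rw [abs_of_pos (by positivity), one_mul, mul_div_assoc', div_le_iff₀ (by positivity)]
    nlinarith [tau_sq δ]

theorem paramBound_tau_sq_add_one :
    ParamBound (Ioi 0) (fun δ (_ : E) => tau δ ^ 2 + 1) (fun δ _ => tau δ ^ 2) :=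
  (paramBound_tau.pow 2).add ((ParamBound.const 1).mono 1 subset_rfl
    (fun δ hδ x _ => by
      rw [one_mul]
      exact one_le_pow₀ (one_le_tau (le_of_lt hδ)))
    (fun δ _ x _ => by positivity))

/-- The argument first obtains `τ^{-(k+4)}`. The weaker `τ^{-k}` suffices, because it cancels
exactly the growth `τ^k` allowed for the potential. -/
theorem paramBound_coefA (k : ℕ) :
    ParamBound (Ioi 0) (fun δ (_ : E) => coefA k δ) (fun δ _ => (tau δ ^ k)⁻¹) := by
  have h1 := ((paramBound_tau (E := E)).pow (k + 2)).mul paramBound_tau_sq_add_one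
  have h2 := h1.inv one_pos (fun δ _ x _ => by have := tau_pos δ; positivity) (fun δ _ x _ => by
    have := tau_pos δ
    rw [one_mul]
    gcongr
    linarith)
  refine h2.mono 1 subset_rfl (fun δ hδ x _ => ?_) (fun δ _ x _ => by
    have := tau_pos δ
    positivity)
  have h3 := one_le_tau (le_of_lt hδ)
  have h4 := tau_pos δ
  rw [one_mul, ← pow_add]
  gcongr
  omega

theorem paramBound_coefB (k : ℕ) :
    ParamBound (Ioi 0) (fun δ (_ : E) => coefB k δ) (fun δ _ => δ * tau δ ^ (k + 1)) := by
  have hinv := (paramBound_tau_sq_add_one (E := E)).inv one_pos (fun δ _ x _ => by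
    have := tau_pos δ
    positivity) (fun δ _ x _ => by linarith)
  have h := ((ParamBound.id (E := E)).mul
    (((paramBound_tau (E := E)).pow (k + 3)).mul hinv)).const_mul ((k : ℝ) + 2)⁻¹
  have e : (fun δ (_ : E) => coefB k δ) = fun δ (_ : E) => ((k : ℝ) + 2)⁻¹ *
      (δ * (tau δ ^ (k + 3) * (tau δ ^ 2 + 1)⁻¹)) := by
    ext δ x
    rw [coefB]
    field_simp
  rw [e]
  refine h.mono 1 subset_rfl (fun δ hδ x _ => ?_) (fun δ hδ x _ => by
    have := tau_pos δ
    have hδ' : 0 < δ := hδ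
    positivity)
  have h4 := tau_pos δ
  rw [show k + 3 = k + 1 + 2 by ring, pow_add _ (k + 1) 2, mul_inv_cancel_right₀ (by positivity),
    one_mul]

theorem tau_zero : tau 0 = 1 := by
  have : √((0 : ℝ) ^ 2 + 4) = 2 := by
    rw [show (0 : ℝ) ^ 2 + 4 = 2 ^ 2 by norm_num]
    exact Real.sqrt_sq (by norm_num)
  rw [tau, this]
  norm_num

/-- At `δ = 0` one has `τ = 1`, so `½` is the value of the smooth coefficient there. -/
theorem paramBound_coefA_sub (k : ℕ) :
    ParamBound (Ioc 0 1) (fun δ (_ : E) => coefA k δ - 1 / 2) (fun δ _ => δ) := by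
  refine ParamBound.of_contDiff (h := fun δ => coefA k δ - 1 / 2) ?_ ?_
  · have ht : ContDiff ℝ 1 tau := contDiff_tau 1
    unfold coefA
    refine (ContDiff.inv (((ht.pow _).mul ((ht.pow 2).add contDiff_const))) fun δ => ?_).sub
      contDiff_const
    have := tau_pos δ
    positivity
  · simp only [coefA, tau_zero]
    norm_num

theorem coefB_sub_eq (k : ℕ) (δ : ℝ) : coefB k δ - δ * (1 / (2 * ((k : ℝ) + 2))) =
    δ * (tau δ ^ (k + 3) / ((k + 2) * (tau δ ^ 2 + 1)) - 1 / (2 * ((k : ℝ) + 2))) := by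
  rw [coefB]
  ring

theorem paramBound_coefB_sub (k : ℕ) : ParamBound (Ioc 0 1)
    (fun δ (_ : E) => coefB k δ - δ * (1 / (2 * ((k : ℝ) + 2)))) (fun δ _ => δ * δ) := by
  simp only [coefB_sub_eq]
  refine (ParamBound.id.mono_set fun δ hδ => hδ.1).mul (ParamBound.of_contDiff
    (h := fun δ => tau δ ^ (k + 3) / ((k + 2) * (tau δ ^ 2 + 1)) - 1 / (2 * ((k : ℝ) + 2))) ?_ ?_)
  · have ht : ContDiff ℝ 1 tau := contDiff_tau 1
    refine (ContDiff.div (ht.pow _) (contDiff_const.mul ((ht.pow 2).add contDiff_const))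
      fun δ => ?_).sub contDiff_const
    have := tau_pos δ
    positivity
  · simp only [tau_zero]
    have hk : (k : ℝ) + 2 ≠ 0 := by positivity
    field_simp
    norm_num

end Coefficients

/-! ### Decay bounds for all positive `δ` -/

/-- The potential of the ray `{s v : s > σ}`. -/
noncomputable def rayIntegral (k : ℕ) (v : EuclideanSpace ℝ (Fin (k + 4))) (σ : ℝ)
    (x : EuclideanSpace ℝ (Fin (k + 4))) : ℝ :=
  ∫ s in Ioi σ, fund k x (s • v)

/-- The rescaled half-space solution. -/
noncomputable def scaledCorrector (k : ℕ) (v : EuclideanSpace ℝ (Fin (k + 4))) (δ : ℝ)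
    (x : EuclideanSpace ℝ (Fin (k + 4))) : ℝ :=
  1 / 2 * rayIntegral k v (1 + δ) x - δ * (1 / (2 * ((k : ℝ) + 2))) * fund k x ((1 + δ) • v)

section Decay

variable {k : ℕ} {v x : EuclideanSpace ℝ (Fin (k + 4))} {δ s ρ σ : ℝ}

/-- The distance to the pole is at least `s - 1`, and at least `|x - v| - (s - 1)`; twice the first
bound plus the second gives the constant `3`. -/
theorem add_norm_le_three_mul (hv : ‖v‖ = 1) (hx : ‖x‖ ≤ 1) (hs : 1 ≤ s) :
    s - 1 + ‖x - v‖ ≤ 3 * ‖x - s • v‖ := by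
  have h1 := norm_sub_smul_ge (x := x) (s := s) hv (by linarith)
  have h2 : ‖x - v‖ ≤ ‖x - s • v‖ + (s - 1) := by
    have := norm_add_le (x - s • v) ((s - 1) • v)
    rw [norm_smul, hv, Real.norm_of_nonneg (by linarith), mul_one,
      show x - s • v + (s - 1) • v = x - v by module] at this
    exact this
  linarith

theorem norm_sub_le_two (hv : ‖v‖ = 1) (hx : ‖x‖ ≤ 1) : ‖x - v‖ ≤ 2 := by
  have := norm_sub_le x v
  linarith

theorem one_lt_tau_sq (hδ : 0 < δ) : 1 < tau δ ^ 2 := one_lt_pow₀ (one_lt_tau hδ) two_ne_zero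

/-- Since `τ² - 1 = δτ`, the distance to the image pole controls `δτ + |x - v|`. For `τ ≤ 3` the
missing factor `τ` on `|x - v|` costs `3`; for `τ ≥ 3` one has `δ ≥ 2 ≥ |x - v|`, so `δτ` absorbs
it. -/
theorem tau_mul_le (hv : ‖v‖ = 1) (hx : ‖x‖ ≤ 1) (hδ : 0 < δ) :
    tau δ * (δ + ‖x - v‖) ≤ 9 * ‖x - tau δ ^ 2 • v‖ := by
  have h1 := add_norm_le_three_mul hv hx (one_lt_tau_sq hδ).le
  have h2 := tau_sq δ
  have h3 := norm_sub_le_two hv hx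
  have h4 := tau_pos δ
  have h5 := norm_nonneg (x - v)
  have h6 := mul_pos hδ h4
  rcases le_total (tau δ) 3 with h | h
  · nlinarith
  · have : 2 ≤ δ := by nlinarith
    nlinarith

theorem hasDerivAt_fund_pole (h : 0 < ‖x - s • v‖) :
    HasDerivAt (fun s : ℝ => fund k x (s • v))
      ((k + 2) * (inner ℝ (x - s • v) v * (‖x - s • v‖ ^ (k + 4))⁻¹)) s := by
  simp only [fund_eq_rpow]
  have e : ∀ s : ℝ, ‖x - s • v‖ ^ 2 = ‖x‖ ^ 2 - 2 * inner ℝ x v * s + ‖v‖ ^ 2 * s ^ 2 := by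
    intro s
    rw [norm_sub_sq_real, norm_smul, inner_smul_right, mul_pow, Real.norm_eq_abs, sq_abs]
    ring
  have h1 : HasDerivAt (fun s : ℝ => 0 + ‖x - s • v‖ ^ 2) (-2 * inner ℝ (x - s • v) v) s := by
    simp only [e]
    have := (((((hasDerivAt_id s).const_mul (2 * inner ℝ x v)).const_sub (‖x‖ ^ 2)).add
      ((hasDerivAt_pow 2 s).const_mul (‖v‖ ^ 2)))).const_add 0
    refine this.congr_deriv ?_
    rw [inner_sub_left, inner_smul_left, real_inner_self_eq_norm_sq]
    simp
    ring
  refine (h1.rpow_const (p := -((k : ℝ) + 2) / 2) (Or.inl (by positivity))).congr_deriv ?_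
  rw [zero_add_sq_rpow h.le (k + 3) _ (by push_cast; ring)]
  ring

theorem abs_fund_pole_deriv_le (hv : ‖v‖ = 1) (h : 0 < ‖x - s • v‖) :
    |(k + 2) * (inner ℝ (x - s • v) v * (‖x - s • v‖ ^ (k + 4))⁻¹)| * ‖x - s • v‖ ≤
      (k + 2) * fund k x (s • v) := by
  have h1 := abs_real_inner_le_norm (x - s • v) v
  rw [hv, mul_one] at h1
  rw [abs_mul, abs_mul, abs_of_pos (by positivity : (0 : ℝ) < k + 2),
    abs_of_pos (by positivity : 0 < (‖x - s • v‖ ^ (k + 4))⁻¹), mul_assoc]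
  gcongr
  calc |inner ℝ (x - s • v) v| * (‖x - s • v‖ ^ (k + 4))⁻¹ * ‖x - s • v‖
      ≤ ‖x - s • v‖ * (‖x - s • v‖ ^ (k + 4))⁻¹ * ‖x - s • v‖ := by gcongr
    _ = fund k x (s • v) := by
      unfold fund
      field_simp
      ring

theorem fund_le_of_le_mul {c y : ℝ} (hc : 0 < c) (hy : 0 < y) (h : y ≤ c * ‖x - s • v‖) :
    fund k x (s • v) ≤ c ^ (k + 2) * (y ^ (k + 2))⁻¹ := by
  have h1 : y / c ≤ ‖x - s • v‖ := by rwa [div_le_iff₀' hc]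
  calc fund k x (s • v) ≤ ((y / c) ^ (k + 2))⁻¹ := by
        unfold fund
        gcongr
    _ = _ := by rw [div_pow, inv_div, div_eq_mul_inv]

/-- Decay of the fundamental solution with pole `p(δ) v` moving with `δ`. -/
theorem paramBound_fund_comp (hv : ‖v‖ = 1) {p p' : ℝ → ℝ} {y : ℝ → EuclideanSpace ℝ (Fin (k + 4)) → ℝ}
    {c : ℝ} (hc : 0 < c) (hp : ∀ δ, 0 < δ → HasDerivAt p (p' δ) δ)
    (hp' : ∀ δ, 0 < δ → ∀ x, ‖x‖ ≤ 1 → |δ * p' δ| ≤ c * ‖x - p δ • v‖)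
    (hy : ∀ δ, 0 < δ → ∀ x, ‖x‖ ≤ 1 → 0 < y δ x)
    (hle : ∀ δ, 0 < δ → ∀ x, ‖x‖ ≤ 1 → y δ x ≤ c * ‖x - p δ • v‖) :
    ParamBound (Ioi 0) (fun δ x => fund k x (p δ • v)) (fun δ x => (y δ x ^ (k + 2))⁻¹) := by
  refine ⟨(1 + c * (k + 2)) * c ^ (k + 2), by positivity, fun δ hδ x hx => ?_⟩
  have hδ' : 0 < δ := hδ
  have hypos := hy δ hδ' x hx
  have hg : 0 < ‖x - p δ • v‖ :=
    pos_of_mul_pos_right (hypos.trans_le (hle δ hδ' x hx)) hc.le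
  have hG := fund_le_of_le_mul (k := k) hc hypos (hle δ hδ' x hx)
  have hG0 := fund_nonneg k x (p δ • v)
  have hmain : (1 + c * (k + 2)) * fund k x (p δ • v) ≤
      (1 + c * (k + 2)) * c ^ (k + 2) * (y δ x ^ (k + 2))⁻¹ := by
    rw [mul_assoc]
    gcongr
  refine ⟨_, (hasDerivAt_fund_pole hg).comp δ (hp δ hδ'), ?_, ?_⟩
  · refine le_trans ?_ hmain
    rw [abs_of_nonneg hG0]
    nlinarith [mul_nonneg (by positivity : 0 ≤ c * (k + 2)) hG0]
  · refine le_trans ?_ hmain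
    rw [mul_comm _ (p' δ), ← mul_assoc, abs_mul]
    calc _ ≤ c * ‖x - p δ • v‖ *
          |(k + 2) * (inner ℝ (x - p δ • v) v * (‖x - p δ • v‖ ^ (k + 4))⁻¹)| := by
          gcongr
          exact hp' δ hδ' x hx
      _ = c * (|(k + 2) * (inner ℝ (x - p δ • v) v * (‖x - p δ • v‖ ^ (k + 4))⁻¹)| *
          ‖x - p δ • v‖) := by ring
      _ ≤ c * ((k + 2) * fund k x (p δ • v)) := by
          exact mul_le_mul_of_nonneg_left (abs_fund_pole_deriv_le hv hg) hc.le
      _ ≤ _ := by linarith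

theorem hasDerivAt_tau_sq (δ : ℝ) :
    HasDerivAt (fun δ => tau δ ^ 2) (2 * tau δ ^ 3 / (tau δ ^ 2 + 1)) δ := by
  refine ((hasDerivAt_tau δ).pow 2).congr_deriv ?_
  simp
  ring

theorem abs_mul_tau_sq_deriv_le (hδ : 0 < δ) :
    |δ * (2 * tau δ ^ 3 / (tau δ ^ 2 + 1))| ≤ 2 * (δ * tau δ) := by
  have h := tau_pos δ
  rw [abs_of_pos (by positivity), mul_div_assoc', div_le_iff₀ (by positivity)]
  nlinarith [mul_pos hδ h]

theorem paramBound_fund_tau (hv : ‖v‖ = 1) : ParamBound (Ioi 0)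
    (fun δ x => fund k x (tau δ ^ 2 • v))
    (fun δ x => ((tau δ * (δ + ‖x - v‖)) ^ (k + 2))⁻¹) := by
  -- The constant is `2 · 9`: the speed of the pole satisfies `|δ(τ²)'| ≤ 2δτ`, and `δτ` is at most
  -- `9` times the distance to the pole.
  refine paramBound_fund_comp hv (c := 18) (by norm_num) (fun δ _ => hasDerivAt_tau_sq δ)
    (fun δ hδ x hx => ?_) (fun δ hδ x hx => ?_) (fun δ hδ x hx => ?_)
  · have h1 := abs_mul_tau_sq_deriv_le hδ
    have h2 := tau_mul_le hv hx hδ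
    nlinarith [mul_nonneg (tau_pos δ).le (norm_nonneg (x - v))]
  · have := tau_pos δ
    positivity
  · have h2 := tau_mul_le hv hx hδ
    linarith [norm_nonneg (x - tau δ ^ 2 • v)]

theorem add_norm_le_pole (hv : ‖v‖ = 1) (hx : ‖x‖ ≤ 1) (hδ : 0 < δ) :
    δ + ‖x - v‖ ≤ 3 * ‖x - (1 + δ) • v‖ := by
  have := add_norm_le_three_mul hv hx (by linarith : 1 ≤ 1 + δ)
  linarith

theorem paramBound_fund_pole (hv : ‖v‖ = 1) : ParamBound (Ioi 0)
    (fun δ x => fund k x ((1 + δ) • v)) (fun δ x => ((δ + ‖x - v‖) ^ (k + 2))⁻¹) := by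
  refine paramBound_fund_comp hv (c := 3) (by norm_num)
    (fun δ _ => (hasDerivAt_id δ).const_add 1)
    (fun δ hδ x hx => ?_) (fun δ hδ x hx => ?_) (fun δ hδ x hx => add_norm_le_pole hv hx hδ)
  · have := add_norm_le_pole hv hx hδ
    rw [mul_one, abs_of_pos hδ]
    linarith [norm_nonneg (x - v)]
  · positivity

theorem continuousOn_ray_integrand (hv : ‖v‖ = 1) (hx : ‖x‖ ≤ 1) :
    ContinuousOn (fun s : ℝ => fund k x (s • v)) (Ioi 1) := by
  refine ContinuousOn.inv₀ (by fun_prop) fun s hs => ?_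
  have := norm_sub_smul_pos hv hx hs
  positivity

theorem fund_ray_bound (hv : ‖v‖ = 1) (hx : ‖x‖ ≤ 1) (hs : 1 < s) :
    fund k x (s • v) ≤ 3 ^ (k + 2) * ((s + (‖x - v‖ - 1)) ^ (k + 2))⁻¹ := by
  have h1 := add_norm_le_three_mul hv hx hs.le
  have h2 := norm_nonneg (x - v)
  exact fund_le_of_le_mul (by norm_num) (by linarith) (by linarith)

theorem integrableOn_ray_integrand (hv : ‖v‖ = 1) (hx : ‖x‖ ≤ 1) (hσ : 1 < σ) :
    IntegrableOn (fun s : ℝ => fund k x (s • v)) (Ioi σ) := by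
  have h2 := norm_nonneg (x - v)
  refine Integrable.mono' ((integral_Ioi_inv_add_pow (σ := σ) (b := ‖x - v‖ - 1) k
    (by linarith)).1.const_mul (3 ^ (k + 2))) (((continuousOn_ray_integrand hv hx).mono
      (Ioi_subset_Ioi hσ.le)).aestronglyMeasurable measurableSet_Ioi) ?_
  refine (ae_restrict_mem measurableSet_Ioi).mono fun s hs => ?_
  rw [Real.norm_of_nonneg (fund_nonneg _ _ _)]
  exact fund_ray_bound hv hx (hσ.trans hs)

theorem hasDerivAt_rayIntegral (hv : ‖v‖ = 1) (hx : ‖x‖ ≤ 1) (hσ : 1 < σ) :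
    HasDerivAt (fun σ => rayIntegral k v σ x) (-fund k x (σ • v)) σ := by
  have h1 : 1 < (1 + σ) / 2 := by linarith
  exact hasDerivAt_integral_Ioi_left (by linarith) (integrableOn_ray_integrand hv hx h1)
    ((continuousOn_ray_integrand hv hx).continuousAt (Ioi_mem_nhds hσ))

theorem abs_rayIntegral_le (hv : ‖v‖ = 1) (hx : ‖x‖ ≤ 1) (hσ : 1 < σ) :
    |rayIntegral k v σ x| ≤ 3 ^ (k + 2) * ((σ + (‖x - v‖ - 1)) ^ (k + 1))⁻¹ := by
  have h2 := norm_nonneg (x - v)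
  refine abs_integral_Ioi_le k (by linarith) fun s hs => ?_
  rw [abs_of_nonneg (fund_nonneg _ _ _)]
  exact fund_ray_bound hv hx (hσ.trans hs)

theorem paramBound_rayIntegral (hv : ‖v‖ = 1) : ParamBound (Ioi 0)
    (fun δ x => rayIntegral k v (1 + δ) x) (fun δ x => ((δ + ‖x - v‖) ^ (k + 1))⁻¹) := by
  refine ⟨3 ^ (k + 2), by positivity, fun δ hδ x hx => ?_⟩
  have hδ' : 0 < δ := hδ
  have hσ : 1 < 1 + δ := by linarith
  have h0 := norm_nonneg (x - v)
  refine ⟨_, (hasDerivAt_rayIntegral hv hx hσ).comp δ ((hasDerivAt_id δ).const_add 1), ?_, ?_⟩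
  · refine (abs_rayIntegral_le hv hx hσ).trans_eq ?_
    rw [show 1 + δ + (‖x - v‖ - 1) = δ + ‖x - v‖ by ring]
  · rw [mul_one, mul_neg, abs_neg, abs_of_nonneg (mul_nonneg hδ'.le (fund_nonneg _ _ _))]
    have h1 := fund_ray_bound (k := k) hv hx hσ
    rw [show 1 + δ + (‖x - v‖ - 1) = δ + ‖x - v‖ by ring] at h1
    calc δ * fund k x ((1 + δ) • v) ≤
        (δ + ‖x - v‖) * (3 ^ (k + 2) * ((δ + ‖x - v‖) ^ (k + 2))⁻¹) := by
          gcongr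
          · exact fund_nonneg _ _ _
          · linarith
      _ = _ := by
          field_simp
          ring

theorem paramBound_scaledCorrector (hv : ‖v‖ = 1) : ParamBound (Ioi 0)
    (scaledCorrector k v) (fun δ x => ((δ + ‖x - v‖) ^ (k + 1))⁻¹) := by
  have h1 := (paramBound_rayIntegral (k := k) hv).const_mul (1 / 2)
  have h2 := (ParamBound.id.mul (paramBound_fund_pole (k := k) hv)).const_mul
    (1 / (2 * ((k : ℝ) + 2)))
  have h3 := h1.sub (h2.mono (M := fun δ x => ((δ + ‖x - v‖) ^ (k + 1))⁻¹) 1 subset_rfl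
    (fun δ hδ x hx => ?_) (fun δ hδ x hx => ?_))
  · have e : scaledCorrector k v = fun δ x => 1 / 2 * rayIntegral k v (1 + δ) x -
        1 / (2 * ((k : ℝ) + 2)) * (δ * fund k x ((1 + δ) • v)) := by
      ext δ x
      rw [scaledCorrector]
      ring
    rwa [e]
  · have hδ' : 0 < δ := hδ
    have h0 := norm_nonneg (x - v)
    calc δ * ((δ + ‖x - v‖) ^ (k + 2))⁻¹ ≤ (δ + ‖x - v‖) * ((δ + ‖x - v‖) ^ (k + 2))⁻¹ := by
          gcongr
          linarith
      _ = _ := by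
          field_simp
          ring
  · have hδ' : 0 < δ := hδ
    positivity

theorem ball_integrand_le (hv : ‖v‖ = 1) (hx : ‖x‖ ≤ 1) (hs : 1 < s) :
    |s ^ (k + 1) * fund k x (s • v) - s⁻¹| ≤ (k + 2) * 2 ^ (k + 1) * (s ^ k * fund k x (s • v)) := by
  refine (abs_ball_integrand_le hv (by linarith) (by linarith)
    (norm_sub_smul_pos hv hx hs)).trans ?_
  have h0 := fund_nonneg k x (s • v)
  have h1 : 0 < s ^ k := by positivity
  exact mul_le_mul_of_nonneg_right (mul_le_of_le_one_right (by positivity) hx) (by positivity)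

/-- With `y = s - 1 + |x - v|`, the weight satisfies `s^k ≤ 2^k (1 + y^k)`. Its two parts give the
singular term `y^{-(k+2)}` and the tail `y^{-2}`; the exponent `0 + 2` matches the form of the
integral bound. -/
theorem ball_integrand_le_add (hv : ‖v‖ = 1) (hx : ‖x‖ ≤ 1) (hs : 1 < s) :
    |s ^ (k + 1) * fund k x (s • v) - s⁻¹| ≤ (k + 2) * 2 ^ (k + 1) * (2 ^ k * 3 ^ (k + 2)) *
      (((s + (‖x - v‖ - 1)) ^ (k + 2))⁻¹ + ((s + (‖x - v‖ - 1)) ^ (0 + 2))⁻¹) := by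
  refine (ball_integrand_le hv hx hs).trans ?_
  have h1 := fund_ray_bound (k := k) hv hx hs
  have h2 := norm_nonneg (x - v)
  set y := s + (‖x - v‖ - 1) with hy
  have hy0 : 0 < y := by linarith
  have h3 : s ^ k ≤ 2 ^ k * (1 + y ^ k) := by
    calc s ^ k ≤ (1 + y) ^ k := by
          gcongr
          linarith
      _ ≤ 2 ^ (k - 1) * (1 ^ k + y ^ k) := add_pow_le zero_le_one hy0.le k
      _ ≤ 2 ^ k * (1 + y ^ k) := by
          rw [one_pow]
          gcongr
          · norm_num
          · omega
  rw [mul_assoc ((k + 2 : ℝ) * 2 ^ (k + 1))]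
  refine mul_le_mul_of_nonneg_left ?_ (by positivity)
  calc s ^ k * fund k x (s • v) ≤ (2 ^ k * (1 + y ^ k)) * (3 ^ (k + 2) * (y ^ (k + 2))⁻¹) := by
        gcongr
        exact fund_nonneg _ _ _
    _ = _ := by
        field_simp
        ring

theorem abs_integral_Ioi_le_add {f : ℝ → ℝ} {σ b C : ℝ} (m l : ℕ) (h : 0 < σ + b)
    (hf : ∀ s, σ < s → |f s| ≤ C * (((s + b) ^ (m + 2))⁻¹ + ((s + b) ^ (l + 2))⁻¹)) :
    |∫ s in Ioi σ, f s| ≤ C * (((σ + b) ^ (m + 1))⁻¹ + ((σ + b) ^ (l + 1))⁻¹) := by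
  obtain ⟨h1, h2⟩ := integral_Ioi_inv_add_pow m h
  obtain ⟨h1', h2'⟩ := integral_Ioi_inv_add_pow l h
  have hC : 0 ≤ C := by
    have h0 : 0 < σ + 1 + b := by linarith
    exact nonneg_of_mul_nonneg_left ((abs_nonneg _).trans (hf (σ + 1) (by linarith)))
      (by positivity)
  have h3 := norm_integral_le_of_norm_le (μ := volume.restrict (Ioi σ)) (f := f)
    ((h1.add h1').const_mul C) ((ae_restrict_mem measurableSet_Ioi).mono fun s hs => hf s hs)
  have h5 := integral_add h1 h1'
  simp only [Pi.add_apply] at h3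
  rw [integral_const_mul, h5, h2, h2'] at h3
  refine h3.trans ?_
  have key : ∀ j : ℕ, (((j : ℝ) + 1) * (σ + b) ^ (j + 1))⁻¹ ≤ ((σ + b) ^ (j + 1))⁻¹ := by
    intro j
    have : (0 : ℝ) ≤ j := j.cast_nonneg
    have h4 : 0 < (σ + b) ^ (j + 1) := by positivity
    gcongr
    nlinarith
  have := key m
  have := key l
  gcongr

theorem paramBound_ballPotential (hv : ‖v‖ = 1) : ParamBound (Ioi 0)
    (fun δ x => ballPotential k v (tau δ ^ 2) x)
    (fun δ x => tau δ ^ k * ((δ + ‖x - v‖) ^ (k + 1))⁻¹) := by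
  set C₀ : ℝ := (k + 2) * 2 ^ (k + 1) with hC₀
  have hC₀pos : 0 < C₀ := by positivity
  -- The first summand serves the bound on the function, the second the bound on its derivative.
  set C : ℝ := C₀ * (2 ^ k * 3 ^ (k + 2)) * (1 + 3 ^ k) + 2 * C₀ * 9 ^ (k + 2) with hC
  refine ⟨C, by positivity, fun δ hδ x hx => ?_⟩
  have hδ' : 0 < δ := hδ
  have h0 := norm_nonneg (x - v)
  have ht := tau_pos δ
  have ht1 := one_le_tau hδ'.le
  have hρ := one_lt_tau_sq hδ'
  have hD : 0 < δ + ‖x - v‖ := by positivity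
  have hW : 0 ≤ tau δ ^ k * ((δ + ‖x - v‖) ^ (k + 1))⁻¹ := by positivity
  refine ⟨_, HasDerivAt.comp (h₂ := fun ρ => ballPotential k v ρ x) δ
    (hasDerivAt_ballPotential hv hx hρ) (hasDerivAt_tau_sq δ), ?_, ?_⟩
  · have h1 := abs_integral_Ioi_le_add k 0 (by linarith : 0 < tau δ ^ 2 + (‖x - v‖ - 1))
      (fun s hs => ball_integrand_le_add (k := k) hv hx (hρ.trans hs))
    have h2 : δ + ‖x - v‖ ≤ tau δ ^ 2 + (‖x - v‖ - 1) := by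
      rw [tau_sq]
      nlinarith
    have h3 : ((tau δ ^ 2 + (‖x - v‖ - 1)) ^ (k + 1))⁻¹ + ((tau δ ^ 2 + (‖x - v‖ - 1)) ^ (0 + 1))⁻¹ ≤
        (1 + 3 ^ k) * (tau δ ^ k * ((δ + ‖x - v‖) ^ (k + 1))⁻¹) := by
      have h4 : ((tau δ ^ 2 + (‖x - v‖ - 1)) ^ (k + 1))⁻¹ ≤
          tau δ ^ k * ((δ + ‖x - v‖) ^ (k + 1))⁻¹ := by
        calc _ ≤ 1 * ((δ + ‖x - v‖) ^ (k + 1))⁻¹ := by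
              rw [one_mul]
              gcongr
          _ ≤ _ := by
              gcongr
              exact one_le_pow₀ ht1
      -- The tail contributes only a first inverse power. The inequality `δ + |x - v| ≤ 3τ` trades
      -- it for the power `k + 1` at the price of `(3τ)^k`.
      have h5 : ((tau δ ^ 2 + (‖x - v‖ - 1)) ^ (0 + 1))⁻¹ ≤
          3 ^ k * (tau δ ^ k * ((δ + ‖x - v‖) ^ (k + 1))⁻¹) := by
        have h6 : δ + ‖x - v‖ ≤ 3 * tau δ := by
          have := norm_sub_le_two hv hx
          linarith [le_tau δ]
        calc _ ≤ ((δ + ‖x - v‖) ^ (0 + 1))⁻¹ := by gcongr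
          _ = (δ + ‖x - v‖) ^ k * ((δ + ‖x - v‖) ^ (k + 1))⁻¹ := by
              field_simp
              ring
          _ ≤ (3 * tau δ) ^ k * ((δ + ‖x - v‖) ^ (k + 1))⁻¹ := by gcongr
          _ = _ := by rw [mul_pow, mul_assoc]
      linarith
    refine h1.trans ?_
    calc _ ≤ C₀ * (2 ^ k * 3 ^ (k + 2)) *
          ((1 + 3 ^ k) * (tau δ ^ k * ((δ + ‖x - v‖) ^ (k + 1))⁻¹)) := by
          gcongr
      _ ≤ C * (tau δ ^ k * ((δ + ‖x - v‖) ^ (k + 1))⁻¹) := by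
          rw [← mul_assoc]
          gcongr
          rw [hC]
          have : 0 ≤ 2 * C₀ * 9 ^ (k + 2) := by positivity
          linarith
  -- The derivative is the integrand at the endpoint times the speed of the endpoint, so no integral
  -- is estimated here.
  · have h1 := ball_integrand_le (k := k) hv hx hρ
    have h2 := fund_le_of_le_mul (k := k) (by norm_num : (0 : ℝ) < 9)
      (by positivity) (tau_mul_le hv hx hδ')
    rw [mul_comm, mul_assoc, mul_comm _ δ, abs_mul, abs_neg]
    calc _ ≤ C₀ * ((tau δ ^ 2) ^ k * (9 ^ (k + 2) * ((tau δ * (δ + ‖x - v‖)) ^ (k + 2))⁻¹)) *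
          (2 * (δ * tau δ)) := by
          refine mul_le_mul (h1.trans ?_) (abs_mul_tau_sq_deriv_le hδ') (abs_nonneg _)
            (by positivity)
          gcongr
      _ = 2 * C₀ * 9 ^ (k + 2) * (tau δ ^ k * (δ * ((δ + ‖x - v‖) ^ (k + 2))⁻¹) * (tau δ)⁻¹) := by
          rw [mul_pow, mul_inv]
          field_simp
          ring
      _ ≤ 2 * C₀ * 9 ^ (k + 2) * (tau δ ^ k * ((δ + ‖x - v‖) ^ (k + 1))⁻¹ * 1) := by
          gcongr
          · calc δ * ((δ + ‖x - v‖) ^ (k + 2))⁻¹ ≤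
                (δ + ‖x - v‖) * ((δ + ‖x - v‖) ^ (k + 2))⁻¹ := by
                  gcongr
                  linarith
              _ = _ := by
                  field_simp
                  ring
          · exact inv_le_one_of_one_le₀ ht1
      _ ≤ C * (tau δ ^ k * ((δ + ‖x - v‖) ^ (k + 1))⁻¹) := by
          rw [mul_one]
          gcongr
          rw [hC]
          have : 0 ≤ C₀ * (2 ^ k * 3 ^ (k + 2)) * (1 + 3 ^ k) := by positivity
          linarith

theorem paramBound_ballSolution (hv : ‖v‖ = 1) : ParamBound (Ioi 0)
    (ballSolution k v) (fun δ x => ((δ + ‖x - v‖) ^ (k + 1))⁻¹) := by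
  have hpos : ∀ δ ∈ Ioi (0 : ℝ), ∀ x : EuclideanSpace ℝ (Fin (k + 4)), ‖x‖ ≤ 1 →
      0 ≤ ((δ + ‖x - v‖) ^ (k + 1))⁻¹ := fun δ hδ x _ => by
    have hδ' : 0 < δ := hδ
    positivity
  refine ParamBound.sub
    (((paramBound_coefA k).mul (paramBound_ballPotential hv)).mono 1 subset_rfl ?_ hpos)
    (((paramBound_coefB k).mul (paramBound_fund_tau hv)).mono 1 subset_rfl ?_ hpos)
  · intro δ hδ x hx
    have ht := tau_pos δ
    rw [one_mul, inv_mul_cancel_left₀ (by positivity)]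
  · intro δ hδ x hx
    have hδ' : 0 < δ := hδ
    have ht := tau_pos δ
    have h0 := norm_nonneg (x - v)
    have hD : 0 < δ + ‖x - v‖ := by positivity
    have ht1 := one_le_tau hδ'.le
    calc δ * tau δ ^ (k + 1) * ((tau δ * (δ + ‖x - v‖)) ^ (k + 2))⁻¹
        = (tau δ)⁻¹ * (δ * ((δ + ‖x - v‖) ^ (k + 2))⁻¹) := by
          rw [mul_pow, mul_inv]
          field_simp
          ring
      _ ≤ 1 * ((δ + ‖x - v‖) * ((δ + ‖x - v‖) ^ (k + 2))⁻¹) := by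
          gcongr
          · exact inv_le_one_of_one_le₀ ht1
          · linarith
      _ = _ := by
          field_simp
          ring

end Decay

/-! ### Comparison of the two explicit solutions for small `δ` -/

/-- The size of the remainder for small `δ`, normalised: `δ^{-k}`, with a logarithm if `k = 0`. -/
noncomputable def smallWeight (k : ℕ) (δ : ℝ) : ℝ := if k = 0 then 1 + |Real.log δ| else (δ ^ k)⁻¹

theorem inv_pow_le_smallWeight (k : ℕ) (δ : ℝ) : (δ ^ k)⁻¹ ≤ smallWeight k δ := by
  unfold smallWeight
  split_ifs with h
  · subst h
    simp
  · exact le_rfl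

theorem smallWeight_nonneg {k : ℕ} {δ : ℝ} (hδ : 0 < δ) : 0 ≤ smallWeight k δ :=
  le_trans (by positivity) (inv_pow_le_smallWeight k δ)

theorem tau_le_one_add {δ : ℝ} (hδ : 0 < δ) : tau δ ≤ 1 + δ := by
  nlinarith [tau_sq δ, tau_pos δ]

theorem one_add_le_tau_sq {δ : ℝ} (hδ : 0 < δ) : 1 + δ ≤ tau δ ^ 2 := by
  nlinarith [tau_sq δ, one_le_tau hδ.le]

/-- From `τ² = 1 + δτ` and `τ ≤ 1 + δ`. The image pole thus differs from `(1+δ)v` to second order,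
while both poles stay at distance at least `δ` from the ball; moving one to the other gains a factor
`δ`. -/
theorem tau_sq_sub_le {δ : ℝ} (hδ : 0 < δ) : tau δ ^ 2 - (1 + δ) ≤ δ ^ 2 := by
  nlinarith [tau_sq δ, tau_le_one_add hδ]

theorem abs_tau_sq_deriv_sub_one_le {δ : ℝ} (hδ : 0 < δ) :
    |2 * tau δ ^ 3 / (tau δ ^ 2 + 1) - 1| ≤ 3 * δ := by
  have h1 := one_le_tau hδ.le
  have h2 := tau_le_one_add hδ
  set t := tau δ
  have e : 2 * t ^ 3 / (t ^ 2 + 1) - 1 = (t - 1) * ((2 * t ^ 2 + t + 1) / (t ^ 2 + 1)) := by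
    field_simp
    ring
  have h3 : (2 * t ^ 2 + t + 1) / (t ^ 2 + 1) ≤ 3 := by
    rw [div_le_iff₀ (by positivity)]
    nlinarith [sq_nonneg (t - 1)]
  have h4 : 0 ≤ (2 * t ^ 2 + t + 1) / (t ^ 2 + 1) := by positivity
  rw [e, abs_mul, abs_of_nonneg (by linarith : 0 ≤ t - 1), abs_of_nonneg h4]
  nlinarith

/-- Difference of negative powers. -/
theorem mul_abs_inv_pow_sub_le {a b δ : ℝ} (hδ : 0 < δ) (ha : δ ≤ a) (hb : δ ≤ b) (m : ℕ) :
    a * |(a ^ (m + 1))⁻¹ - (b ^ (m + 1))⁻¹| ≤ (m + 1) * |a - b| * (δ ^ (m + 1))⁻¹ := by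
  have ha0 : 0 < a := hδ.trans_le ha
  have hb0 : 0 < b := hδ.trans_le hb
  have h1 := abs_pow_sub_pow_le a⁻¹ b⁻¹ (m + 1)
  rw [abs_of_pos (inv_pos.2 ha0), abs_of_pos (inv_pos.2 hb0), inv_pow, inv_pow,
    Nat.add_sub_cancel] at h1
  have h2 : max a⁻¹ b⁻¹ ≤ δ⁻¹ := max_le (by gcongr) (by gcongr)
  -- The prefactor `a` cancels one inverse power exactly, even when `a` is much larger than `δ`; it
  -- later absorbs an inner product of size at most `a`.
  have h3 : a * |a⁻¹ - b⁻¹| ≤ |a - b| * δ⁻¹ := by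
    have e : a⁻¹ - b⁻¹ = -(a - b) * (a⁻¹ * b⁻¹) := by field_simp; ring
    rw [e, abs_mul, abs_neg, abs_of_pos (by positivity : 0 < a⁻¹ * b⁻¹)]
    calc a * (|a - b| * (a⁻¹ * b⁻¹)) = |a - b| * b⁻¹ := by field_simp
      _ ≤ _ := by gcongr
  have h4 : 0 ≤ max a⁻¹ b⁻¹ := le_max_of_le_left (by positivity)
  calc a * |(a ^ (m + 1))⁻¹ - (b ^ (m + 1))⁻¹|
      ≤ a * (|a⁻¹ - b⁻¹| * ((m + 1 : ℕ) : ℝ) * max a⁻¹ b⁻¹ ^ m) := by gcongr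
    _ = (a * |a⁻¹ - b⁻¹|) * ((m + 1 : ℕ) : ℝ) * max a⁻¹ b⁻¹ ^ m := by ring
    _ ≤ (|a - b| * δ⁻¹) * ((m + 1 : ℕ) : ℝ) * (δ⁻¹) ^ m := by gcongr
    _ = _ := by
      push_cast
      rw [inv_pow]
      field_simp
      ring

section SmallParameter

variable {k : ℕ} {v x : EuclideanSpace ℝ (Fin (k + 4))} {δ s ρ σ : ℝ}

theorem le_norm_sub_smul (hv : ‖v‖ = 1) (hx : ‖x‖ ≤ 1) (hs : 1 + δ ≤ s) (hδ : 0 < δ) :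
    δ ≤ ‖x - s • v‖ := by
  have := norm_sub_smul_ge (x := x) (s := s) hv (by linarith)
  linarith

theorem abs_norm_sub_norm_pole_le (hv : ‖v‖ = 1) (hδ : 0 < δ) :
    |‖x - tau δ ^ 2 • v‖ - ‖x - (1 + δ) • v‖| ≤ δ ^ 2 := by
  refine (abs_norm_sub_norm_le _ _).trans ?_
  rw [show x - tau δ ^ 2 • v - (x - (1 + δ) • v) = -((tau δ ^ 2 - (1 + δ)) • v) by module,
    norm_neg, norm_smul, hv, mul_one,
    Real.norm_of_nonneg (sub_nonneg.2 (one_add_le_tau_sq hδ))]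
  exact tau_sq_sub_le hδ

theorem fund_le_inv_pow (hv : ‖v‖ = 1) (hx : ‖x‖ ≤ 1) (hs : 1 + δ ≤ s) (hδ : 0 < δ) :
    fund k x (s • v) ≤ (δ ^ (k + 2))⁻¹ := by
  have := le_norm_sub_smul hv hx hs hδ
  unfold fund
  gcongr

theorem mul_abs_inv_norm_pow_sub_le (hv : ‖v‖ = 1) (hx : ‖x‖ ≤ 1) (hδ : 0 < δ) (m : ℕ) :
    ‖x - tau δ ^ 2 • v‖ * |(‖x - tau δ ^ 2 • v‖ ^ (m + 1))⁻¹ - (‖x - (1 + δ) • v‖ ^ (m + 1))⁻¹| ≤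
      (m + 1) * (δ ^ 2 * (δ ^ (m + 1))⁻¹) := by
  refine (mul_abs_inv_pow_sub_le hδ (le_norm_sub_smul hv hx (one_add_le_tau_sq hδ) hδ)
    (le_norm_sub_smul hv hx le_rfl hδ) m).trans ?_
  rw [mul_assoc]
  have := abs_norm_sub_norm_pole_le (x := x) hv hδ
  gcongr

theorem abs_fund_sub_le (hv : ‖v‖ = 1) (hx : ‖x‖ ≤ 1) (hδ : 0 < δ) :
    |fund k x (tau δ ^ 2 • v) - fund k x ((1 + δ) • v)| ≤ (k + 2) * (δ ^ (k + 1))⁻¹ := by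
  have h1 := mul_abs_inv_norm_pow_sub_le hv hx hδ (k + 1)
  have h2 := le_norm_sub_smul hv hx (one_add_le_tau_sq hδ) hδ
  have h3 : δ * |fund k x (tau δ ^ 2 • v) - fund k x ((1 + δ) • v)| ≤
      δ * ((k + 2) * (δ ^ (k + 1))⁻¹) := by
    refine (mul_le_mul_of_nonneg_right h2 (abs_nonneg _)).trans (h1.trans_eq ?_)
    push_cast
    field_simp
    ring
  exact le_of_mul_le_mul_left h3 hδ

theorem abs_fund_pole_deriv_sub_le (hv : ‖v‖ = 1) (hx : ‖x‖ ≤ 1) (hδ : 0 < δ) {l : ℝ}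
    (hl : |l - 1| ≤ 3 * δ) :
    |δ * ((k + 2) * (inner ℝ (x - tau δ ^ 2 • v) v * (‖x - tau δ ^ 2 • v‖ ^ (k + 4))⁻¹) * l -
      (k + 2) * (inner ℝ (x - (1 + δ) • v) v * (‖x - (1 + δ) • v‖ ^ (k + 4))⁻¹) * 1)| ≤
      (k + 2) * (k + 8) * (δ ^ (k + 1))⁻¹ := by
  have ha := le_norm_sub_smul hv hx (one_add_le_tau_sq hδ) hδ
  have hb := le_norm_sub_smul hv hx (le_refl (1 + δ)) hδ
  have hinner : |inner ℝ (x - tau δ ^ 2 • v) v| ≤ ‖x - tau δ ^ 2 • v‖ := by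
    have := abs_real_inner_le_norm (x - tau δ ^ 2 • v) v
    rwa [hv, mul_one] at this
  have hdiff : inner ℝ (x - (1 + δ) • v) v =
      inner ℝ (x - tau δ ^ 2 • v) v + (tau δ ^ 2 - (1 + δ)) := by
    simp only [inner_sub_left, inner_smul_left, real_inner_self_eq_norm_sq, hv, conj_trivial]
    ring
  have h1 := abs_fund_pole_deriv_le (k := k) hv (hδ.trans_le ha)
  have h2 := fund_le_inv_pow (k := k) hv hx (one_add_le_tau_sq hδ) hδ
  have h3 := mul_abs_inv_norm_pow_sub_le hv hx hδ (k + 3)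
  have h4 := tau_sq_sub_le hδ
  have h5 : 0 ≤ tau δ ^ 2 - (1 + δ) := sub_nonneg.2 (one_add_le_tau_sq hδ)
  rw [hdiff]
  generalize ‖x - tau δ ^ 2 • v‖ = a at *
  generalize ‖x - (1 + δ) • v‖ = b at *
  generalize inner ℝ (x - tau δ ^ 2 • v) v = c at *
  generalize tau δ ^ 2 - (1 + δ) = r at *
  generalize fund k x (tau δ ^ 2 • v) = G at *
  have hb0 : 0 < b := hδ.trans_le hb
  -- Three errors are separated: the speed `l` of the image pole against `1`, the two distances, and
  -- the shift `r` of the inner product. They contribute `3`, `k + 4` and `1` to the factor `k + 8`.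
  have e : δ * ((k + 2) * (c * (a ^ (k + 4))⁻¹) * l - (k + 2) * ((c + r) * (b ^ (k + 4))⁻¹) * 1) =
      δ * (((k + 2) * (c * (a ^ (k + 4))⁻¹)) * (l - 1)) +
      δ * (k + 2) * (c * ((a ^ (k + 4))⁻¹ - (b ^ (k + 4))⁻¹)) -
      δ * (k + 2) * (r * (b ^ (k + 4))⁻¹) := by ring
  have t1 : |δ * (((k + 2) * (c * (a ^ (k + 4))⁻¹)) * (l - 1))| ≤
      3 * (k + 2) * (δ ^ (k + 1))⁻¹ := by
    have h6 : |(k + 2) * (c * (a ^ (k + 4))⁻¹)| * δ ≤ (k + 2) * (δ ^ (k + 2))⁻¹ :=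
      (mul_le_mul_of_nonneg_left ha (abs_nonneg _)).trans (h1.trans (by gcongr))
    rw [abs_mul, abs_mul _ (l - 1), abs_of_pos hδ]
    calc _ = |(k + 2) * (c * (a ^ (k + 4))⁻¹)| * δ * |l - 1| := by ring
      _ ≤ (k + 2) * (δ ^ (k + 2))⁻¹ * (3 * δ) :=
        mul_le_mul h6 hl (abs_nonneg _) (by positivity)
      _ = _ := by
        field_simp
        ring
  have t2 : |δ * (k + 2) * (c * ((a ^ (k + 4))⁻¹ - (b ^ (k + 4))⁻¹))| ≤
      (k + 2) * (k + 4) * (δ ^ (k + 1))⁻¹ := by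
    rw [abs_mul, abs_mul c, abs_of_pos (by positivity : 0 < δ * ((k : ℝ) + 2))]
    calc _ ≤ δ * ((k : ℝ) + 2) * (a * |(a ^ (k + 4))⁻¹ - (b ^ (k + 4))⁻¹|) := by gcongr
      _ ≤ δ * ((k : ℝ) + 2) * ((((k + 3 : ℕ) : ℝ) + 1) * (δ ^ 2 * (δ ^ (k + 3 + 1))⁻¹)) :=
        mul_le_mul_of_nonneg_left h3 (by positivity)
      _ = _ := by
        push_cast
        field_simp
        ring
  have t3 : |δ * (k + 2) * (r * (b ^ (k + 4))⁻¹)| ≤ (k + 2) * (δ ^ (k + 1))⁻¹ := by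
    rw [abs_of_nonneg (by positivity)]
    calc _ ≤ δ * (k + 2) * (δ ^ 2 * (δ ^ (k + 4))⁻¹) := by gcongr
      _ = _ := by
        field_simp
        ring
  rw [e]
  refine (abs_sub _ _).trans ((add_le_add ((abs_add_le _ _).trans (add_le_add t1 t2)) t3).trans
    (le_of_eq ?_))
  ring

theorem paramBound_fund_sub (hv : ‖v‖ = 1) : ParamBound (Ioc 0 1)
    (fun δ x => fund k x (tau δ ^ 2 • v) - fund k x ((1 + δ) • v))
    (fun δ _ => (δ ^ (k + 1))⁻¹) := by
  refine ⟨(k + 2) * (k + 8), by positivity, fun δ hδ x hx => ?_⟩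
  have hδ' : 0 < δ := hδ.1
  have ha := le_norm_sub_smul hv hx (one_add_le_tau_sq hδ') hδ'
  have hb := le_norm_sub_smul hv hx (le_refl (1 + δ)) hδ'
  have hd1 : HasDerivAt (fun s => fund k x (tau s ^ 2 • v)) _ δ :=
    HasDerivAt.comp (h₂ := fun s => fund k x (s • v)) δ
      (hasDerivAt_fund_pole (k := k) (hδ'.trans_le ha)) (hasDerivAt_tau_sq δ)
  have hd2 : HasDerivAt (fun s => fund k x ((1 + s) • v)) _ δ :=
    HasDerivAt.comp (h₂ := fun s => fund k x (s • v)) δ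
      (hasDerivAt_fund_pole (k := k) (hδ'.trans_le hb)) ((hasDerivAt_id δ).const_add 1)
  refine ⟨_, hd1.fun_sub hd2, ?_, ?_⟩
  · refine (abs_fund_sub_le hv hx hδ').trans ?_
    have hk : (0 : ℝ) ≤ k := k.cast_nonneg
    refine mul_le_mul_of_nonneg_right ?_ (by positivity)
    nlinarith
  · exact abs_fund_pole_deriv_sub_le hv hx hδ' (abs_tau_sq_deriv_sub_one_le hδ')

theorem abs_rayIntegral_sub_le (hv : ‖v‖ = 1) (hx : ‖x‖ ≤ 1) (hδ : 0 < δ) :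
    |rayIntegral k v (tau δ ^ 2) x - rayIntegral k v (1 + δ) x| ≤ (δ ^ k)⁻¹ := by
  have hσ : 1 < 1 + δ := by linarith
  have hle := one_add_le_tau_sq hδ
  rw [abs_sub_comm, rayIntegral, rayIntegral,
    intervalIntegral.integral_Ioi_sub_Ioi (integrableOn_ray_integrand hv hx hσ) hle]
  have h := intervalIntegral.norm_integral_le_of_norm_le_const (a := 1 + δ) (b := tau δ ^ 2)
    (f := fun s => fund k x (s • v)) (C := (δ ^ (k + 2))⁻¹) (fun s hs => by
      rw [uIoc_of_le hle] at hs
      rw [Real.norm_of_nonneg (fund_nonneg _ _ _)]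
      exact fund_le_inv_pow hv hx hs.1.le hδ)
  refine h.trans ?_
  rw [abs_of_nonneg (sub_nonneg.2 hle)]
  calc _ ≤ (δ ^ (k + 2))⁻¹ * δ ^ 2 := by
        gcongr
        exact tau_sq_sub_le hδ
    _ = _ := by
      field_simp
      ring

theorem paramBound_rayIntegral_sub (hv : ‖v‖ = 1) : ParamBound (Ioc 0 1)
    (fun δ x => rayIntegral k v (tau δ ^ 2) x - rayIntegral k v (1 + δ) x)
    (fun δ _ => (δ ^ k)⁻¹) := by
  refine ⟨k + 5, by positivity, fun δ hδ x hx => ?_⟩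
  have hδ' : 0 < δ := hδ.1
  have hk : (0 : ℝ) ≤ k := k.cast_nonneg
  have hσ : 1 < 1 + δ := by linarith
  have hρ := one_lt_tau_sq hδ'
  have hd1 := HasDerivAt.comp (h₂ := fun s => rayIntegral k v s x) δ
    (hasDerivAt_rayIntegral (k := k) hv hx hρ) (hasDerivAt_tau_sq δ)
  have hd2 := HasDerivAt.comp (h₂ := fun s => rayIntegral k v s x) δ
    (hasDerivAt_rayIntegral (k := k) hv hx hσ) ((hasDerivAt_id δ).const_add 1)
  refine ⟨_, hd1.sub hd2, ?_, ?_⟩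
  · have h1 := abs_rayIntegral_sub_le (k := k) hv hx hδ'
    have h2 : 0 < (δ ^ k)⁻¹ := by positivity
    nlinarith
  · set ρ' := 2 * tau δ ^ 3 / (tau δ ^ 2 + 1) with hρ'
    have e : δ * (-fund k x (tau δ ^ 2 • v) * ρ' - -fund k x ((1 + δ) • v) * 1) =
        -(δ * (fund k x (tau δ ^ 2 • v) * (ρ' - 1)) +
          δ * (fund k x (tau δ ^ 2 • v) - fund k x ((1 + δ) • v))) := by ring
    have t1 : |δ * (fund k x (tau δ ^ 2 • v) * (ρ' - 1))| ≤ 3 * (δ ^ k)⁻¹ := by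
      rw [abs_mul, abs_mul, abs_of_pos hδ', abs_of_nonneg (fund_nonneg _ _ _)]
      calc _ ≤ δ * ((δ ^ (k + 2))⁻¹ * (3 * δ)) := by
            have h1 := fund_le_inv_pow (k := k) hv hx (one_add_le_tau_sq hδ') hδ'
            have h2 := abs_tau_sq_deriv_sub_one_le hδ'
            gcongr
        _ = _ := by
          field_simp
          ring
    have t2 : |δ * (fund k x (tau δ ^ 2 • v) - fund k x ((1 + δ) • v))| ≤
        (k + 2) * (δ ^ k)⁻¹ := by
      rw [abs_mul, abs_of_pos hδ']
      calc _ ≤ δ * ((k + 2) * (δ ^ (k + 1))⁻¹) := by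
            have h1 := abs_fund_sub_le (k := k) hv hx hδ'
            gcongr
        _ = _ := by
          field_simp
          ring
    rw [e, abs_neg]
    refine (abs_add_le _ _).trans ((add_le_add t1 t2).trans (le_of_eq ?_))
    ring

/-- The weight `s^{k+1} - 1` vanishes to first order at `s = 1`, which lowers the singularity of `Γ`
by one power. -/
theorem abs_integrand_sub_le_of_le_two (hv : ‖v‖ = 1) (hx : ‖x‖ ≤ 1) (hs : 1 < s) (hs2 : s ≤ 2) :
    |s ^ (k + 1) * fund k x (s • v) - s⁻¹ - fund k x (s • v)| ≤
      (k + 1) * 2 ^ k * ((s - 1) ^ (k + 1))⁻¹ + 1 := by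
  have h1 := fund_le_inv_pow (k := k) (δ := s - 1) hv hx (by linarith : 1 + (s - 1) ≤ s) (by linarith)
  have h0 := fund_nonneg k x (s • v)
  have h2 := abs_pow_sub_pow_le s 1 (k + 1)
  rw [one_pow, abs_one, abs_of_pos (by linarith : 0 < s), max_eq_left hs.le,
    abs_of_pos (by linarith : 0 < s - 1), Nat.add_sub_cancel] at h2
  have h3 : |s ^ (k + 1) - 1| ≤ (s - 1) * ((k : ℝ) + 1) * 2 ^ k := by
    refine h2.trans ?_
    push_cast
    gcongr
  have h4 : 0 < s - 1 := by linarith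
  have e : s ^ (k + 1) * fund k x (s • v) - s⁻¹ - fund k x (s • v) =
      (s ^ (k + 1) - 1) * fund k x (s • v) - s⁻¹ := by ring
  rw [e]
  refine (abs_sub _ _).trans (add_le_add ?_ ?_)
  · rw [abs_mul, abs_of_nonneg h0]
    calc _ ≤ (s - 1) * ((k : ℝ) + 1) * 2 ^ k * ((s - 1) ^ (k + 2))⁻¹ := by gcongr
      _ = _ := by
        field_simp
        ring
  · rw [abs_of_pos (by positivity)]
    exact inv_le_one_of_one_le₀ hs.le

theorem abs_integrand_sub_le_of_two_lt (hv : ‖v‖ = 1) (hx : ‖x‖ ≤ 1) (hs : 2 < s) :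
    |s ^ (k + 1) * fund k x (s • v) - s⁻¹ - fund k x (s • v)| ≤
      ((k + 2) * 2 ^ (k + 1) * 2 ^ k + 1) * ((s - 1) ^ 2)⁻¹ := by
  have h1 := fund_le_inv_pow (k := k) (δ := s - 1) hv hx (by linarith : 1 + (s - 1) ≤ s) (by linarith)
  have h0 := fund_nonneg k x (s • v)
  have h4 : 1 < s - 1 := by linarith
  rw [add_mul, one_mul]
  refine (abs_sub _ _).trans (add_le_add ?_ ?_)
  · refine (ball_integrand_le hv hx (by linarith)).trans ?_
    rw [mul_assoc ((k + 2 : ℝ) * 2 ^ (k + 1))]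
    refine mul_le_mul_of_nonneg_left ?_ (by positivity)
    calc s ^ k * fund k x (s • v) ≤ (2 * (s - 1)) ^ k * ((s - 1) ^ (k + 2))⁻¹ := by
          gcongr
          linarith
      _ = _ := by
        rw [mul_pow]
        field_simp
        ring
  · rw [abs_of_nonneg h0]
    refine h1.trans ?_
    gcongr
    · linarith
    · omega

/-- For `n = 4` this majorant has both required behaviours, `1/(s-1)` near `s = 1` and `s^{-2}` at
infinity, with explicit primitive `log(1 - 1/s)`. -/
theorem integral_Ioi_inv_mul {ρ : ℝ} (hρ : 1 < ρ) :
    IntegrableOn (fun s : ℝ => ((s - 1) * s)⁻¹) (Ioi ρ) ∧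
      ∫ s in Ioi ρ, ((s - 1) * s)⁻¹ = -Real.log (1 - ρ⁻¹) := by
  have hd : ∀ s ∈ Ici ρ, HasDerivAt (fun s : ℝ => Real.log (1 - s⁻¹)) ((s - 1) * s)⁻¹ s := by
    intro s hs
    have hs' : 1 < s := hρ.trans_le hs
    have h1 : s⁻¹ < 1 := inv_lt_one_of_one_lt₀ hs'
    have h2 := ((hasDerivAt_inv (by linarith : s ≠ 0)).const_sub 1).log (by linarith)
    refine h2.congr_deriv ?_
    have h3 : s - 1 ≠ 0 := by linarith
    have h4 : (1 : ℝ) - s⁻¹ = (s - 1) * s⁻¹ := by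
      have : s ≠ 0 := by linarith
      field_simp
    rw [h4]
    have : s ≠ 0 := by linarith
    field_simp
  have hpos : ∀ s ∈ Ioi ρ, 0 ≤ ((s - 1) * s)⁻¹ := by
    intro s hs
    have hs' : 1 < s := hρ.trans hs
    have h3 : 0 < s - 1 := by linarith
    positivity
  have hlim : Tendsto (fun s : ℝ => Real.log (1 - s⁻¹)) atTop (𝓝 0) := by
    have h1 : Tendsto (fun s : ℝ => 1 - s⁻¹) atTop (𝓝 1) := by
      simpa using tendsto_inv_atTop_zero.const_sub (1 : ℝ)
    simpa using h1.log one_ne_zero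
  refine ⟨integrableOn_Ioi_deriv_of_nonneg' hd hpos hlim, ?_⟩
  rw [integral_Ioi_of_hasDerivAt_of_nonneg' hd hpos hlim, zero_sub]

/-- The integrand has size `(s-1)^{-(k+1)}` near `1` and `(s-1)^{-2}` far away, and `ρ - 1 ≥ δ`. For
`k ≥ 1` the singular part integrates to a power of `δ`; for `k = 0` it gives the logarithm. -/
theorem exists_abs_integral_sub_le (k : ℕ) : ∃ C : ℝ, 0 ≤ C ∧
    ∀ v : EuclideanSpace ℝ (Fin (k + 4)), ‖v‖ = 1 → ∀ δ ∈ Ioc (0 : ℝ) 1,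
    ∀ x : EuclideanSpace ℝ (Fin (k + 4)), ‖x‖ ≤ 1 →
    |ballPotential k v (tau δ ^ 2) x - rayIntegral k v (tau δ ^ 2) x| ≤ C * smallWeight k δ := by
  have hint : ∀ v : EuclideanSpace ℝ (Fin (k + 4)), ‖v‖ = 1 → ∀ δ ∈ Ioc (0 : ℝ) 1,
      ∀ x : EuclideanSpace ℝ (Fin (k + 4)), ‖x‖ ≤ 1 →
      ballPotential k v (tau δ ^ 2) x - rayIntegral k v (tau δ ^ 2) x =
      ∫ s in Ioi (tau δ ^ 2), (s ^ (k + 1) * fund k x (s • v) - s⁻¹ - fund k x (s • v)) := by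
    intro v hv δ hδ x hx
    have hρ := one_lt_tau_sq hδ.1
    exact (integral_sub (integrableOn_ball_integrand hv hx hρ)
      (integrableOn_ray_integrand hv hx hρ)).symm
  have hk : (0 : ℝ) ≤ k := k.cast_nonneg
  have hA : 0 < ((k : ℝ) + 2) * 2 ^ (k + 1) * 2 ^ k + 1 := by positivity
  have hB : 0 < ((k : ℝ) + 1) * 2 ^ k := by positivity
  set A : ℝ := (k + 2) * 2 ^ (k + 1) * 2 ^ k + 1
  set B : ℝ := (k + 1) * 2 ^ k
  rcases Nat.eq_zero_or_pos k with hk0 | hk0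
  · refine ⟨2 * (A + B + 1), by positivity, fun v hv δ hδ x hx => ?_⟩
    have hδ' := hδ.1
    have hρ := one_lt_tau_sq hδ'
    obtain ⟨h1, h2⟩ := integral_Ioi_inv_mul hρ
    rw [hint v hv δ hδ x hx]
    have h3 := norm_integral_le_of_norm_le (μ := volume.restrict (Ioi (tau δ ^ 2)))
      (f := fun s => s ^ (k + 1) * fund k x (s • v) - s⁻¹ - fund k x (s • v))
      (h1.const_mul (2 * (A + B + 1))) ((ae_restrict_mem measurableSet_Ioi).mono fun s hs => ?_)
    · rw [integral_const_mul, h2] at h3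
      refine h3.trans ?_
      refine mul_le_mul_of_nonneg_left ?_ (by positivity)
      have ht := tau_pos δ
      -- Hence the integral of the majorant is `log τ - log δ`, and `log τ ≤ τ - 1 ≤ δ ≤ 1`.
      have e : 1 - (tau δ ^ 2)⁻¹ = δ / tau δ := by
        have := tau_sq δ
        field_simp
        nlinarith
      rw [e, Real.log_div hδ'.ne' ht.ne', smallWeight, if_pos hk0]
      have h4 := Real.log_le_sub_one_of_pos ht
      have h5 := tau_le_one_add hδ'
      have h6 := neg_le_abs (Real.log δ)
      linarith [hδ.2]
    · have hs1 : 1 < s := hρ.trans hs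
      have hu : 0 < s - 1 := by linarith
      rw [Real.norm_eq_abs]
      rcases le_or_gt s 2 with h | h
      · refine (abs_integrand_sub_le_of_le_two hv hx hs1 h).trans ?_
        subst hk0
        have h6 : (s - 1)⁻¹ ≤ 2 * ((s - 1) * s)⁻¹ := by
          rw [mul_inv, mul_left_comm]
          refine le_mul_of_one_le_right (by positivity) ?_
          rw [← div_eq_mul_inv, le_div_iff₀ (by linarith)]
          linarith
        have h7 : 1 ≤ (s - 1)⁻¹ := one_le_inv_iff₀.2 ⟨hu, by linarith⟩
        rw [zero_add, pow_one]
        have h8 : B * (s - 1)⁻¹ ≤ B * (2 * ((s - 1) * s)⁻¹) := by gcongr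
        have h9 : 0 ≤ A * ((s - 1) * s)⁻¹ := by positivity
        change B * (s - 1)⁻¹ + 1 ≤ _
        nlinarith
      · refine (abs_integrand_sub_le_of_two_lt hv hx h).trans ?_
        have h6 : ((s - 1) ^ 2)⁻¹ ≤ 2 * ((s - 1) * s)⁻¹ := by
          rw [sq, mul_inv, mul_inv, mul_left_comm]
          refine mul_le_mul_of_nonneg_left ?_ (by positivity)
          rw [← div_eq_mul_inv, le_div_iff₀ (by linarith), inv_mul_le_iff₀ hu]
          linarith
        have h8 : A * ((s - 1) ^ 2)⁻¹ ≤ A * (2 * ((s - 1) * s)⁻¹) := by gcongr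
        have h9 : 0 ≤ B * ((s - 1) * s)⁻¹ := by positivity
        have h10 : 0 ≤ ((s - 1) * s)⁻¹ := by positivity
        change A * ((s - 1) ^ 2)⁻¹ ≤ _
        nlinarith
  · obtain ⟨m, rfl⟩ : ∃ m, k = m + 1 := ⟨k - 1, by omega⟩
    refine ⟨(A + B + 1) * 2, by positivity, fun v hv δ hδ x hx => ?_⟩
    have hδ' := hδ.1
    have hρ := one_lt_tau_sq hδ'
    rw [hint v hv δ hδ x hx]
    have h1 := abs_integral_Ioi_le_add (σ := tau δ ^ 2) (b := -1) (C := A + B + 1) m 0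
      (by linarith) (f := fun s => s ^ (m + 1 + 1) * fund (m + 1) x (s • v) - s⁻¹ -
        fund (m + 1) x (s • v)) (fun s hs => ?_)
    · refine h1.trans ?_
      rw [mul_assoc]
      refine mul_le_mul_of_nonneg_left ?_ (by positivity)
      have h2 : δ ≤ tau δ ^ 2 + -1 := by linarith [one_add_le_tau_sq hδ']
      have h3 : ((tau δ ^ 2 + -1) ^ (m + 1))⁻¹ ≤ (δ ^ (m + 1))⁻¹ := by gcongr
      have h4 : ((tau δ ^ 2 + -1) ^ (0 + 1))⁻¹ ≤ (δ ^ (m + 1))⁻¹ := by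
        calc _ ≤ (δ ^ (0 + 1))⁻¹ := by gcongr
          _ ≤ _ := by
            refine inv_anti₀ (by positivity) ?_
            exact pow_le_pow_of_le_one hδ'.le hδ.2 (by omega)
      rw [smallWeight, if_neg (by omega)]
      linarith
    · have hs1 : 1 < s := hρ.trans hs
      have hu : 0 < s + -1 := by linarith
      have hP : 0 ≤ ((s + -1) ^ (m + 2))⁻¹ := by positivity
      have hQ : 0 ≤ ((s + -1) ^ (0 + 2))⁻¹ := by positivity
      rcases le_or_gt s 2 with h | h
      · refine (abs_integrand_sub_le_of_le_two hv hx hs1 h).trans ?_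
        have h7 : 1 ≤ ((s + -1) ^ (0 + 2))⁻¹ :=
          one_le_inv_iff₀.2 ⟨by positivity, pow_le_one₀ hu.le (by linarith)⟩
        change B * ((s - 1) ^ (m + 2))⁻¹ + 1 ≤ _
        rw [sub_eq_add_neg]
        nlinarith [mul_nonneg hA.le hP, mul_nonneg hA.le hQ, mul_nonneg hB.le hQ]
      · refine (abs_integrand_sub_le_of_two_lt hv hx h).trans ?_
        change A * ((s - 1) ^ (0 + 2))⁻¹ ≤ _
        rw [sub_eq_add_neg]
        nlinarith [mul_nonneg hA.le hP, mul_nonneg hB.le hP, mul_nonneg hB.le hQ]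

theorem mul_abs_integrand_sub_le (hv : ‖v‖ = 1) (hx : ‖x‖ ≤ 1) (hδ : δ ∈ Ioc (0 : ℝ) 1) (hs : 1 + δ ≤ s) :
    δ * |s ^ (k + 1) * fund k x (s • v) - s⁻¹ - fund k x (s • v)| ≤
      ((k + 2) * 2 ^ (k + 1) * 2 ^ k + 1 + (k + 1) * 2 ^ k + 1) * (δ ^ k)⁻¹ := by
  have hδ' := hδ.1
  have hA : 0 < ((k : ℝ) + 2) * 2 ^ (k + 1) * 2 ^ k + 1 := by positivity
  have hB : 0 < ((k : ℝ) + 1) * 2 ^ k := by positivity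
  set A : ℝ := (k + 2) * 2 ^ (k + 1) * 2 ^ k + 1
  set B : ℝ := (k + 1) * 2 ^ k
  have h1 : 1 ≤ (δ ^ k)⁻¹ := one_le_inv_iff₀.2 ⟨by positivity, pow_le_one₀ hδ'.le hδ.2⟩
  have hu : δ ≤ s - 1 := by linarith
  rcases le_or_gt s 2 with h | h
  · have h2 := abs_integrand_sub_le_of_le_two (k := k) hv hx (by linarith) h
    calc _ ≤ δ * (B * (δ ^ (k + 1))⁻¹ + 1) := by
          refine mul_le_mul_of_nonneg_left (h2.trans ?_) hδ'.le
          gcongr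
      _ = B * (δ ^ k)⁻¹ + δ := by
          field_simp
          ring
      _ ≤ _ := by nlinarith [hδ.2]
  · have h2 := abs_integrand_sub_le_of_two_lt (k := k) hv hx h
    have h3 : ((s - 1) ^ 2)⁻¹ ≤ 1 := inv_le_one_of_one_le₀ (one_le_pow₀ (by linarith))
    calc _ ≤ 1 * (A * 1) := by
          refine mul_le_mul hδ.2 (h2.trans ?_) (abs_nonneg _) zero_le_one
          exact mul_le_mul_of_nonneg_left h3 hA.le
      _ ≤ _ := by nlinarith

theorem paramBound_potential_sub (hv : ‖v‖ = 1) : ParamBound (Ioc 0 1)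
    (fun δ x => ballPotential k v (tau δ ^ 2) x - rayIntegral k v (tau δ ^ 2) x)
    (fun δ _ => smallWeight k δ) := by
  obtain ⟨C, hC, H⟩ := exists_abs_integral_sub_le k
  set C' : ℝ := (k + 2) * 2 ^ (k + 1) * 2 ^ k + 1 + (k + 1) * 2 ^ k + 1 with hC'
  have hC'pos : 0 < C' := by positivity
  refine ⟨C + 4 * C', by positivity, fun δ hδ x hx => ?_⟩
  have hδ' : 0 < δ := hδ.1
  have hw := smallWeight_nonneg (k := k) hδ'
  have hρ := one_lt_tau_sq hδ'
  have hd1 := HasDerivAt.comp (h₂ := fun s => ballPotential k v s x) δ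
    (hasDerivAt_ballPotential (k := k) hv hx hρ) (hasDerivAt_tau_sq δ)
  have hd2 := HasDerivAt.comp (h₂ := fun s => rayIntegral k v s x) δ
    (hasDerivAt_rayIntegral (k := k) hv hx hρ) (hasDerivAt_tau_sq δ)
  refine ⟨_, hd1.sub hd2, ?_, ?_⟩
  · refine (H v hv δ hδ x hx).trans ?_
    gcongr
    linarith
  · set ρ' := 2 * tau δ ^ 3 / (tau δ ^ 2 + 1) with hρ'
    set f := (tau δ ^ 2) ^ (k + 1) * fund k x (tau δ ^ 2 • v) - (tau δ ^ 2)⁻¹ -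
      fund k x (tau δ ^ 2 • v) with hf
    -- Both half-line integrals start at the same endpoint, so the derivative is the difference of
    -- the integrands there times a common speed.
    have e : δ * (-((tau δ ^ 2) ^ (k + 1) * fund k x (tau δ ^ 2 • v) - (tau δ ^ 2)⁻¹) * ρ' -
        -fund k x (tau δ ^ 2 • v) * ρ') = -(δ * f * ρ') := by
      rw [hf]
      ring
    have h1 := mul_abs_integrand_sub_le (k := k) hv hx hδ (one_add_le_tau_sq hδ')
    have h2 : |ρ'| ≤ 4 := by
      have := abs_tau_sq_deriv_sub_one_le hδ'
      rw [abs_le] at this ⊢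
      constructor <;> linarith [hδ.2]
    rw [e, abs_neg, abs_mul, abs_mul, abs_of_pos hδ']
    calc _ ≤ C' * (δ ^ k)⁻¹ * 4 := by gcongr
      _ ≤ C' * smallWeight k δ * 4 := by
        gcongr
        exact inv_pow_le_smallWeight k δ
      _ ≤ _ := by nlinarith [mul_nonneg hC hw]

/-- The data are replaced one at a time: the coefficient of the potential (`b1`), the density
(`b2`), the endpoint (`b3`), the coefficient of the pole term (`b4`) and the pole itself (`b5`).
Only `b2` can produce the logarithm. -/
theorem paramBound_remainder (hv : ‖v‖ = 1) : ParamBound (Ioc 0 1)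
    (fun δ x => ballSolution k v δ x - scaledCorrector k v δ x)
    (fun δ _ => smallWeight k δ) := by
  have hS : Ioc (0 : ℝ) 1 ⊆ Ioi 0 := fun δ hδ => hδ.1
  have hM : ∀ δ ∈ Ioc (0 : ℝ) 1, ∀ x : EuclideanSpace ℝ (Fin (k + 4)), ‖x‖ ≤ 1 →
      0 ≤ smallWeight k δ := fun δ hδ x _ => smallWeight_nonneg hδ.1
  have b1 := ((paramBound_coefA_sub (E := EuclideanSpace ℝ (Fin (k + 4))) k).mul
    ((paramBound_ballPotential (k := k) hv).mono_set hS)).mono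
    (M := fun δ _ => smallWeight k δ) (2 ^ k) subset_rfl (fun δ hδ x hx => by
      have hδ' := hδ.1
      have ht := tau_pos δ
      have h0 := norm_nonneg (x - v)
      have h2 : tau δ ≤ 2 := by linarith [tau_le_one_add hδ', hδ.2]
      calc δ * (tau δ ^ k * ((δ + ‖x - v‖) ^ (k + 1))⁻¹) ≤ δ * (2 ^ k * (δ ^ (k + 1))⁻¹) := by
            gcongr
            linarith
        _ = 2 ^ k * (δ ^ k)⁻¹ := by
            field_simp
            ring
        _ ≤ _ := by
            gcongr
            exact inv_pow_le_smallWeight k δ) hM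
  have b2 := (paramBound_potential_sub (k := k) hv).const_mul (1 / 2)
  have b3 := ((paramBound_rayIntegral_sub (k := k) hv).mono (M := fun δ _ => smallWeight k δ)
    1 subset_rfl (fun δ hδ x hx => by
      rw [one_mul]
      exact inv_pow_le_smallWeight k δ) hM).const_mul (1 / 2)
  have b4 := ((paramBound_coefB_sub (E := EuclideanSpace ℝ (Fin (k + 4))) k).mul
    ((paramBound_fund_tau (k := k) hv).mono_set hS)).mono
    (M := fun δ _ => smallWeight k δ) 1 subset_rfl (fun δ hδ x hx => by
      have hδ' := hδ.1
      have ht := one_le_tau hδ'.le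
      have h0 := norm_nonneg (x - v)
      calc δ * δ * ((tau δ * (δ + ‖x - v‖)) ^ (k + 2))⁻¹ ≤ δ * δ * ((1 * δ) ^ (k + 2))⁻¹ := by
            gcongr
            linarith
        _ = (δ ^ k)⁻¹ := by
            field_simp
            ring
        _ ≤ _ := by
            rw [one_mul]
            exact inv_pow_le_smallWeight k δ) hM
  have b5 := (((ParamBound.id (E := EuclideanSpace ℝ (Fin (k + 4)))).mono_set hS).mul
    (paramBound_fund_sub (k := k) hv)).mono (M := fun δ _ => smallWeight k δ) 1 subset_rfl
    (fun δ hδ x hx => by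
      have hδ' := hδ.1
      calc δ * (δ ^ (k + 1))⁻¹ = (δ ^ k)⁻¹ := by
            field_simp
            ring
        _ ≤ _ := by
            rw [one_mul]
            exact inv_pow_le_smallWeight k δ) hM
  have b := (((b1.add b2).add b3).sub b4).sub (b5.const_mul (1 / (2 * ((k : ℝ) + 2))))
  refine (congrArg (fun f => ParamBound (Ioc 0 1) f fun δ _ => smallWeight k δ) ?_).mp b
  ext δ x
  rw [ballSolution, scaledCorrector]
  ring

end SmallParameter

/-! ### Rescaling of the corrector and conclusion -/

/-- The point `δ⁻¹(e - x) + s e` is `-δ⁻¹(x - (1 + δs)e)`: the pole `-se` goes to `(1 + δs)e`, so `s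
> 1` becomes the ray beyond `1 + δ`. The Jacobian lowers the power of `δ` on the ray term by one. -/
theorem halfSpaceSolution_scaled {k : ℕ} {δ : ℝ} (hδ : 0 < δ) (x : EuclideanSpace ℝ (Fin (k + 4))) :
    halfSpaceSolution k (δ⁻¹ • (eN (k + 4) - x)) =
      -(alpha (k + 4) * (k + 2) * δ ^ (k + 1) * scaledCorrector k (eN (k + 4)) δ x) := by
  set e := eN (k + 4) with he
  have hfund : ∀ s : ℝ, fund k (δ⁻¹ • (e - x)) (s • -e) =
      δ ^ (k + 2) * fund k x ((1 + δ * s) • e) := by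
    intro s
    have h1 : δ⁻¹ • (e - x) - s • -e = -(δ⁻¹ • (x - (1 + δ * s) • e)) := by
      rw [smul_sub δ⁻¹ x, smul_smul, mul_add, inv_mul_cancel_left₀ hδ.ne']
      module
    rw [fund, fund, h1, norm_neg, norm_smul, norm_inv, Real.norm_of_nonneg hδ.le, mul_pow, mul_inv,
      inv_pow, inv_inv]
  have hray : rayPotential k (δ⁻¹ • (e - x)) = δ ^ (k + 1) * rayIntegral k e (1 + δ) x := by
    have h2 := setIntegral_Ioi_add_right (fun s => fund k x (s • e)) δ 1
    have h3 := integral_comp_mul_left_Ioi' (fun s => fund k x ((s + 1) • e)) 1 hδ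
    rw [mul_one, h2, add_comm δ 1, smul_eq_mul] at h3
    simp only [rayPotential, one_mul, sub_zero]
    rw [← he, rayIntegral, ← h3]
    simp only [hfund]
    rw [integral_const_mul, ← mul_assoc, ← pow_succ]
    simp only [add_comm (1 : ℝ)]
  have h1 := hfund 1
  rw [one_smul, mul_one] at h1
  rw [halfSpaceSolution, scaledCorrector, ← he, hray, h1]
  have hk : (k : ℝ) + 2 ≠ 0 := by positivity
  field_simp
  ring

theorem scale_eq {n : ℕ} {C a b m δ : ℝ} (hδ : 0 < δ) (hb : b = a - m)
    (y : EuclideanSpace ℝ (Fin n)) :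
    C * δ ^ a / (δ + ‖y‖) ^ m = C * δ ^ b / (1 + ‖δ⁻¹ • y‖) ^ m := by
  have h1 : 1 + ‖δ⁻¹ • y‖ = (δ + ‖y‖) / δ := by
    rw [norm_smul, norm_inv, Real.norm_of_nonneg hδ.le]
    field_simp
  have h2 : 0 ≤ δ + ‖y‖ := by positivity
  rw [h1, Real.div_rpow h2 hδ.le, hb, Real.rpow_sub hδ]
  have h3 : 0 < δ ^ m := by positivity
  field_simp

/-- The normalised odd combination `c δ^q (f(δ, x) - f(δ, -x))`. -/
theorem ParamBound.odd_combination {n : ℕ} {S : Set ℝ} {f N : ℝ → EuclideanSpace ℝ (Fin n) → ℝ}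
    (hf : ParamBound S f N) (hS : S ⊆ Ioi 0) (hN : ∀ δ ∈ S, ∀ x, 0 ≤ N δ x) (c q : ℝ) :
    ParamBound S (fun δ x => c * (δ ^ q * (f δ x - f δ (-x))))
      (fun δ x => δ ^ q * (N δ x + N δ (-x))) := by
  have h1 := hf.mono (M := fun δ x => N δ x + N δ (-x)) 1 subset_rfl
    (fun δ hδ x _ => by linarith [hN δ hδ (-x)])
    (fun δ hδ x _ => add_nonneg (hN δ hδ x) (hN δ hδ (-x)))
  have h2 := hf.comp_neg.mono (M := fun δ x => N δ x + N δ (-x)) 1 subset_rfl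
    (fun δ hδ x _ => by linarith [hN δ hδ x])
    (fun δ hδ x _ => add_nonneg (hN δ hδ x) (hN δ hδ (-x)))
  exact (((ParamBound.rpow q).mono_set hS).mul (h1.sub h2)).const_mul c

end NeumannBubble

theorem lemma2p2 (n : ℕ) (hn : 4 ≤ n)
    (φ₀ : EuclideanSpace ℝ (Fin n) → ℝ) (hφ₀ : NeumannBubble.IsCorrector n φ₀)
    (PW : ℝ → EuclideanSpace ℝ (Fin n) → ℝ)
    (hPW : ∀ δ : ℝ, 0 < δ → NeumannBubble.IsPW n δ (PW δ)) :
    ∃ ζ : ℝ → EuclideanSpace ℝ (Fin n) → ℝ,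
      -- the expansion
      (∀ δ : ℝ, 0 < δ → ∀ x ∈ Metric.ball (0 : EuclideanSpace ℝ (Fin n)) 1,
        PW δ x = NeumannBubble.W n δ x
          - δ ^ (-(((n : ℝ) - 4) / 2)) *
            (φ₀ (δ⁻¹ • (NeumannBubble.eN n - x)) - φ₀ (δ⁻¹ • (NeumannBubble.eN n + x)))
          + ζ δ x) ∧
      -- the derivatives with respect to the parameter exist
      (∀ δ : ℝ, 0 < δ → ∀ x ∈ Metric.ball (0 : EuclideanSpace ℝ (Fin n)) 1,
        DifferentiableAt ℝ (fun s : ℝ => ζ s x) δ ∧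
        DifferentiableAt ℝ (fun s : ℝ => PW s x - NeumannBubble.W n s x) δ) ∧
      -- uniform bounds on the remainder as the parameter tends to zero
      (5 ≤ n → ∃ C : ℝ, ∀ᶠ δ in 𝓝[>] (0 : ℝ),
        ∀ x ∈ Metric.ball (0 : EuclideanSpace ℝ (Fin n)) 1,
          |ζ δ x| ≤ C * δ ^ ((6 - (n : ℝ)) / 2) ∧
          |deriv (fun s : ℝ => ζ s x) δ| ≤ C * δ ^ ((4 - (n : ℝ)) / 2)) ∧
      (n = 4 → ∃ C : ℝ, ∀ᶠ δ in 𝓝[>] (0 : ℝ),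
        ∀ x ∈ Metric.ball (0 : EuclideanSpace ℝ (Fin n)) 1,
          |ζ δ x| ≤ C * (δ * |Real.log δ|) ∧
          |deriv (fun s : ℝ => ζ s x) δ| ≤ C * |Real.log δ|) ∧
      -- pointwise decay bounds
      ∃ C : ℝ, 0 < C ∧
        ∀ δ : ℝ, 0 < δ → ∀ x ∈ Metric.ball (0 : EuclideanSpace ℝ (Fin n)) 1,
          (max |ζ δ x| |PW δ x - NeumannBubble.W n δ x| ≤
              C * δ ^ (((n : ℝ) - 2) / 2) / (δ + ‖x - NeumannBubble.eN n‖) ^ ((n : ℝ) - 3)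
              + C * δ ^ (((n : ℝ) - 2) / 2) / (δ + ‖x + NeumannBubble.eN n‖) ^ ((n : ℝ) - 3) ∧
            C * δ ^ (((n : ℝ) - 2) / 2) / (δ + ‖x - NeumannBubble.eN n‖) ^ ((n : ℝ) - 3)
              + C * δ ^ (((n : ℝ) - 2) / 2) / (δ + ‖x + NeumannBubble.eN n‖) ^ ((n : ℝ) - 3)
            = C * δ ^ ((4 - (n : ℝ)) / 2)
                / (1 + ‖δ⁻¹ • (x - NeumannBubble.eN n)‖) ^ ((n : ℝ) - 3)
              + C * δ ^ ((4 - (n : ℝ)) / 2)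
                / (1 + ‖δ⁻¹ • (x + NeumannBubble.eN n)‖) ^ ((n : ℝ) - 3)) ∧
          (max |deriv (fun s : ℝ => ζ s x) δ|
              |deriv (fun s : ℝ => PW s x - NeumannBubble.W n s x) δ| ≤
              C * δ ^ (((n : ℝ) - 4) / 2) / (δ + ‖x - NeumannBubble.eN n‖) ^ ((n : ℝ) - 3)
              + C * δ ^ (((n : ℝ) - 4) / 2) / (δ + ‖x + NeumannBubble.eN n‖) ^ ((n : ℝ) - 3) ∧
            C * δ ^ (((n : ℝ) - 4) / 2) / (δ + ‖x - NeumannBubble.eN n‖) ^ ((n : ℝ) - 3)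
              + C * δ ^ (((n : ℝ) - 4) / 2) / (δ + ‖x + NeumannBubble.eN n‖) ^ ((n : ℝ) - 3)
            = C * δ ^ ((2 - (n : ℝ)) / 2)
                / (1 + ‖δ⁻¹ • (x - NeumannBubble.eN n)‖) ^ ((n : ℝ) - 3)
              + C * δ ^ ((2 - (n : ℝ)) / 2)
                / (1 + ‖δ⁻¹ • (x + NeumannBubble.eN n)‖) ^ ((n : ℝ) - 3)) := by
  obtain ⟨k, rfl⟩ : ∃ k, n = k + 4 := ⟨n - 4, by omega⟩
  open NeumannBubble in
  set e := eN (k + 4) with he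
  have hv : ‖e‖ = 1 := norm_eN (by omega)
  set c : ℝ := alpha (k + 4) * (k + 2) with hc
  set q : ℝ := ((k : ℝ) + 2) / 2 with hq
  have hball : ∀ x : EuclideanSpace ℝ (Fin (k + 4)), x ∈ Metric.ball 0 1 → ‖x‖ < 1 :=
    fun x hx => by simpa using hx
  have hR : ∀ δ : ℝ, 0 < δ → ∀ x : EuclideanSpace ℝ (Fin (k + 4)), x ∈ Metric.ball 0 1 →
      PW δ x - W (k + 4) δ x =
        c * (δ ^ q * (ballSolution k e δ x - ballSolution k e δ (-x))) := by
    intro δ hδ x hx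
    rw [IsPW.sub_W_eq hδ (hPW δ hδ) (hball x hx).le]
    ring
  have hK : ∀ δ : ℝ, 0 < δ → ∀ x : EuclideanSpace ℝ (Fin (k + 4)), x ∈ Metric.ball 0 1 →
      δ ^ (-((((k + 4 : ℕ) : ℝ) - 4) / 2)) * (φ₀ (δ⁻¹ • (e - x)) - φ₀ (δ⁻¹ • (e + x))) =
        -(c * (δ ^ q * (scaledCorrector k e δ x - scaledCorrector k e δ (-x)))) := by
    intro δ hδ x hx
    -- The explicit form of `φ₀` is known only on the closed half-space; the rescaled points lie in
    -- it because the last coordinate of a point of the ball is below `1`.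
    have hpos : ∀ z : EuclideanSpace ℝ (Fin (k + 4)), ‖z‖ < 1 →
        0 ≤ lastCoord (k + 4) (δ⁻¹ • (e - z)) := by
      intro z hz
      have h1 := (le_abs_self _).trans (lastCoord_le_norm (n := k + 4) (by omega) z)
      have h2 : lastCoord (k + 4) (δ⁻¹ • (e - z)) = δ⁻¹ * (1 - lastCoord (k + 4) z) := by
        simp [lastCoord, inner_smul_right, inner_sub_right, ← he, hv]
      rw [h2]
      exact mul_nonneg (by positivity) (by linarith)
    have hx1 := hball x hx
    rw [show e + x = e - -x by abel, hφ₀.eq_halfSpaceSolution (hpos x hx1),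
      hφ₀.eq_halfSpaceSolution (hpos (-x) (by rwa [norm_neg])), halfSpaceSolution_scaled hδ,
      halfSpaceSolution_scaled hδ, ← he, ← hc]
    have h3 : δ ^ (-((((k + 4 : ℕ) : ℝ) - 4) / 2)) * δ ^ (k + 1) = δ ^ q := by
      rw [← Real.rpow_natCast δ (k + 1), ← Real.rpow_add hδ, hq]
      congr 1
      push_cast
      ring
    rw [← h3]
    ring
  -- The expansion leaves no choice for the remainder.
  set ζ : ℝ → EuclideanSpace ℝ (Fin (k + 4)) → ℝ := fun δ x => PW δ x - W (k + 4) δ x +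
    δ ^ (-((((k + 4 : ℕ) : ℝ) - 4) / 2)) * (φ₀ (δ⁻¹ • (e - x)) - φ₀ (δ⁻¹ • (e + x))) with hζ
  have hZ : ∀ δ : ℝ, 0 < δ → ∀ x : EuclideanSpace ℝ (Fin (k + 4)), x ∈ Metric.ball 0 1 →
      ζ δ x = c * (δ ^ q * ((ballSolution k e δ x - scaledCorrector k e δ x) -
        (ballSolution k e δ (-x) - scaledCorrector k e δ (-x)))) := by
    intro δ hδ x hx
    simp only [hζ]
    rw [hR δ hδ x hx, hK δ hδ x hx]
    ring
  have hN : ∀ δ ∈ Ioi (0 : ℝ), ∀ x : EuclideanSpace ℝ (Fin (k + 4)),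
      0 ≤ ((δ + ‖x - e‖) ^ (k + 1))⁻¹ := fun δ hδ x => by
    have hδ' : 0 < δ := hδ
    positivity
  obtain ⟨C₁, hC₁, H₁⟩ := (paramBound_ballSolution hv).odd_combination subset_rfl hN c q
  obtain ⟨C₂, hC₂, H₂⟩ := ((paramBound_ballSolution hv).sub
    (paramBound_scaledCorrector hv)).odd_combination subset_rfl hN c q
  obtain ⟨C₃, hC₃, H₃⟩ := (paramBound_remainder (k := k) hv).odd_combination
    (fun δ hδ => hδ.1) (fun δ hδ _ => smallWeight_nonneg hδ.1) c q
  -- The explicit formulas hold for positive parameters only, an open condition, so they hold near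
  -- each `δ > 0` and may be differentiated.
  have hRd : ∀ δ : ℝ, 0 < δ → ∀ x : EuclideanSpace ℝ (Fin (k + 4)), x ∈ Metric.ball 0 1 →
      (fun s => PW s x - W (k + 4) s x) =ᶠ[𝓝 δ]
        fun s => c * (s ^ q * (ballSolution k e s x - ballSolution k e s (-x))) := by
    intro δ hδ x hx
    filter_upwards [lt_mem_nhds hδ] with s hs using hR s hs x hx
  have hZd : ∀ δ : ℝ, 0 < δ → ∀ x : EuclideanSpace ℝ (Fin (k + 4)), x ∈ Metric.ball 0 1 →
      (fun s => ζ s x) =ᶠ[𝓝 δ] fun s => c * (s ^ q * ((ballSolution k e s x -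
        scaledCorrector k e s x) - (ballSolution k e s (-x) - scaledCorrector k e s (-x)))) := by
    intro δ hδ x hx
    filter_upwards [lt_mem_nhds hδ] with s hs using hZ s hs x hx
  have hsmall : ∀ δ ∈ Ioc (0 : ℝ) 1, ∀ x : EuclideanSpace ℝ (Fin (k + 4)), x ∈ Metric.ball 0 1 →
      |ζ δ x| ≤ C₃ * (δ ^ q * (2 * smallWeight k δ)) ∧
      |deriv (fun s : ℝ => ζ s x) δ| ≤ C₃ * (δ ^ (q - 1) * (2 * smallWeight k δ)) := by
    intro δ hδ x hx
    obtain ⟨d, h1, h2, h3⟩ := H₃ δ hδ x (hball x hx).le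
    beta_reduce at h2 h3
    rw [← two_mul] at h2 h3
    rw [hZ δ hδ.1 x hx, (h1.congr_of_eventuallyEq (hZd δ hδ.1 x hx)).deriv]
    refine ⟨h2, ?_⟩
    rw [abs_mul, abs_of_pos hδ.1, mul_comm, ← le_div_iff₀ hδ.1] at h3
    rw [Real.rpow_sub_one hδ.1.ne']
    refine h3.trans_eq ?_
    ring
  have hIoc : ∀ᶠ δ in 𝓝[>] (0 : ℝ), δ ∈ Ioc (0 : ℝ) 1 := by
    filter_upwards [Ioo_mem_nhdsGT (zero_lt_one (α := ℝ))] with δ hδ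
    exact ⟨hδ.1, hδ.2.le⟩
  refine ⟨ζ, ?_, ?_, ?_, ?_, ?_⟩
  · intro δ hδ x hx
    simp only [hζ]
    ring
  · intro δ hδ x hx
    obtain ⟨d₁, h1, -⟩ := H₁ δ hδ x (hball x hx).le
    obtain ⟨d₂, h2, -⟩ := H₂ δ hδ x (hball x hx).le
    exact ⟨(h2.congr_of_eventuallyEq (hZd δ hδ x hx)).differentiableAt,
      (h1.congr_of_eventuallyEq (hRd δ hδ x hx)).differentiableAt⟩
  · intro hn5
    refine ⟨2 * C₃, ?_⟩
    filter_upwards [hIoc] with δ hδ x hx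
    obtain ⟨h1, h2⟩ := hsmall δ hδ x hx
    have hw : smallWeight k δ = δ ^ (-(k : ℝ)) := by
      rw [smallWeight, if_neg (by omega), Real.rpow_neg hδ.1.le, Real.rpow_natCast]
    rw [hw, mul_left_comm (δ ^ q), ← Real.rpow_add hδ.1] at h1
    rw [hw, mul_left_comm (δ ^ (q - 1)), ← Real.rpow_add hδ.1] at h2
    constructor
    · refine h1.trans_eq ?_
      rw [show q + -(k : ℝ) = (6 - ((k + 4 : ℕ) : ℝ)) / 2 by rw [hq]; push_cast; ring]
      ring
    · refine h2.trans_eq ?_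
      rw [show q - 1 + -(k : ℝ) = (4 - ((k + 4 : ℕ) : ℝ)) / 2 by rw [hq]; push_cast; ring]
      ring
  · intro hn4
    have hk0 : k = 0 := by omega
    refine ⟨4 * C₃, ?_⟩
    -- Below `e^{-1}` one has `|log δ| ≥ 1`, so the weight `1 + |log δ|` is at most `2|log δ|`; the
    -- two antipodal terms account for the other factor `2` in `4 C₃`.
    filter_upwards [hIoc, Ioo_mem_nhdsGT (Real.exp_pos (-1))] with δ hδ hδe x hx
    obtain ⟨h1, h2⟩ := hsmall δ hδ x hx
    have hlog : 1 ≤ |Real.log δ| := by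
      have := (Real.log_lt_iff_lt_exp hδ.1).2 hδe.2
      linarith [neg_le_abs (Real.log δ)]
    have hw : smallWeight k δ ≤ 2 * |Real.log δ| := by
      rw [smallWeight, if_pos hk0]
      linarith
    have hq1 : q = 1 := by rw [hq, hk0]; norm_num
    have hδ0 := hδ.1
    rw [hq1, Real.rpow_one] at h1
    rw [hq1, sub_self, Real.rpow_zero] at h2
    constructor
    · refine h1.trans ?_
      calc _ ≤ C₃ * (δ * (2 * (2 * |Real.log δ|))) := by gcongr
        _ = _ := by ring
    · refine h2.trans ?_
      calc _ ≤ C₃ * (1 * (2 * (2 * |Real.log δ|))) := by gcongr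
        _ = _ := by ring
  · have hweight : ∀ (C a δ : ℝ) (x : EuclideanSpace ℝ (Fin (k + 4))),
        C * δ ^ a / (δ + ‖x - e‖) ^ (((k + 4 : ℕ) : ℝ) - 3) +
          C * δ ^ a / (δ + ‖x + e‖) ^ (((k + 4 : ℕ) : ℝ) - 3) =
        C * (δ ^ a * (((δ + ‖x - e‖) ^ (k + 1))⁻¹ + ((δ + ‖-x - e‖) ^ (k + 1))⁻¹)) := by
      intro C a δ x
      rw [show ((k + 4 : ℕ) : ℝ) - 3 = ((k + 1 : ℕ) : ℝ) by push_cast; ring, Real.rpow_natCast,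
        Real.rpow_natCast, show -x - e = -(x + e) by abel, norm_neg]
      ring
    have hpow : (((k + 4 : ℕ) : ℝ) - 2) / 2 = q := by rw [hq]; push_cast; ring
    have hpow' : (((k + 4 : ℕ) : ℝ) - 4) / 2 = q - 1 := by rw [hq]; push_cast; ring
    have hdiv : ∀ {C δ d A : ℝ}, 0 < δ → |δ * d| ≤ C * (δ ^ q * A) →
        |d| ≤ C * (δ ^ (q - 1) * A) := by
      intro C δ d A hδ h
      rw [abs_mul, abs_of_pos hδ, mul_comm, ← le_div_iff₀ hδ] at h
      rw [Real.rpow_sub_one hδ.ne']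
      exact h.trans_eq (by ring)
    -- `C₁` bounds `PW - W` and `C₂` bounds `ζ`, each with its derivative; the added `1` makes the
    -- constant positive.
    refine ⟨C₁ + C₂ + 1, by positivity, fun δ hδ x hx => ?_⟩
    obtain ⟨d₁, h1, h1', h1d⟩ := H₁ δ hδ x (hball x hx).le
    obtain ⟨d₂, h2, h2', h2d⟩ := H₂ δ hδ x (hball x hx).le
    rw [(h1.congr_of_eventuallyEq (hRd δ hδ x hx)).deriv,
      (h2.congr_of_eventuallyEq (hZd δ hδ x hx)).deriv, hR δ hδ x hx, hZ δ hδ x hx]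
    refine ⟨⟨?_, ?_⟩, ⟨?_, ?_⟩⟩
    · rw [hweight, hpow]
      refine max_le (h2'.trans ?_) (h1'.trans ?_) <;> beta_reduce <;> gcongr <;> linarith
    · rw [scale_eq (b := (4 - ((k + 4 : ℕ) : ℝ)) / 2) hδ (by ring),
        scale_eq (b := (4 - ((k + 4 : ℕ) : ℝ)) / 2) hδ (by ring)]
    · rw [hweight, hpow']
      refine max_le ((hdiv hδ h2d).trans ?_) ((hdiv hδ h1d).trans ?_) <;> gcongr <;> linarith
    · rw [scale_eq (b := (2 - ((k + 4 : ℕ) : ℝ)) / 2) hδ (by ring),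
        scale_eq (b := (2 - ((k + 4 : ℕ) : ℝ)) / 2) hδ (by ring)]
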